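/- Let $M$ be a connected Riemannian manifold of dimension $n$ (smooth, Hausdorff, second countable), and let $G$ be a compact Lie group that acts smoothly on $M$ by isometries. Let $p: F_O\to M$ be the bundle of orthonormal frames $f:\mathbb{R}^n\to T_xM$. The groups $G$ and $O(n)$ act on $F_O$ by $g\cdot(x,f)=(gx,dg\circ f)$ and $k\cdot(x,f)=(x,f\circ k^{-1})$; these actions commute. Let $F_O$ carry the Sasakian metric $\|(\dot x,\dot f)\|^2=\|\dot x\|^2+\sum_{j}\|\nabla_{\dot x}f_j\|^2$, where $\nabla$ is the Levi-Civita connection of $M$ and $f_j=f(e_j)$; let the fibres of $p$ and the $G$-orbits carry the induced metrics, and let $F_O/G$ carry the metric for which the projection $\pi:F_O\to F_O/G$ is a Riemannian submersion. All integrals below are taken with respect to the corresponding Riemannian volumes. Let $E\to F_O$ be a smooth Hermitian vector bundle that is equivariant with respect to $G\times O(n)$, which acts smoothly on $E$ by linear isometries between the fibres. Let $\rho:G\to U(V_\rho)$ and $\sigma:O(n)\to U(W_\sigma)$ be continuous irreducible (finite-dimensional) unitary representations. For a representation space $\Gamma$ of one of these groups, let $\Gamma^{\rho}$, respectively $\Gamma^{\sigma}$,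 be its part of type $\rho$, respectively $\sigma$, that is, the sum of the images of all equivariant linear maps from $V_\rho$, respectively $W_\sigma$, to $\Gamma$. Let $\Gamma(S,E)$ denote the space of smooth sections of $E$ over a submanifold $S$ of $F_O$. Let $\mathcal{E}^\sigma\to M$ and $\mathcal{T}^\rho\to F_O/G$ be the bundles with the fibres $$\mathcal{E}^\sigma_x=\Gamma(p^{-1}(x),E)^\sigma\quad(x\in M),\qquad \mathcal{T}^\rho_y=\Gamma(\pi^{-1}(y),E)^\rho\quad(y\in F_O/G),$$ each with the $L^2$-norm over $p^{-1}(x)$, respectively $\pi^{-1}(y)$. Their smooth sections are the sections $s$, respectively $t$, for which $z\mapsto s_{p(z)}(z)$, respectively $z\mapsto t_{\pi(z)}(z)$, is a smooth section of $E$ over $F_O$. The group $G$ acts on $\Gamma(M,\mathcal{E}^\sigma)$ by $(gs)_{gx}(gz)=g\cdot s_x(z)$, and $O(n)$ acts on $\Gamma(F_O/G,\mathcal{T}^\rho)$ by $(kt)_{ky}(kz)=k\cdot t_y(z)$. **Theorem.** There is an isomorphism of vector spaces $$\Phi:\Gamma(M,\mathcal{E}^\sigma)^\rho\longrightarrow\Gamma(F_O/G,\mathcal{T}^\rho)^\sigma,\qquad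 (\Phi s)_{\pi(z)}(z)=s_{p(z)}(z)\quad(z\in F_O).$$ It preserves the $L^2$-norms, $$\int_{F_O/G}\int_{\pi^{-1}(y)}\|(\Phi s)_y(z)\|^2\,dz\,dy=\int_M\int_{p^{-1}(x)}\|s_x(z)\|^2\,dz\,dx\in[0,\infty]\qquad\text{for all } s\in\Gamma(M,\mathcal{E}^\sigma)^\rho.$$ The elements of finite $L^2$-norm (all elements, if $M$ is compact) of each of the two spaces have a Hilbert space completion in the $L^2$-norm, and $\Phi$ extends uniquely to a surjective linear isometry between these Hilbert spaces. -/

import Mathlib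

open scoped Manifold ContDiff Topology ENNReal Bundle
open MeasureTheory Bundle

noncomputable section

namespace FrameBundleSections

/-! ### Generalities -/

/-- Euclidean space `ℝⁿ`. -/
abbrev Euc (n : ℕ) : Type := EuclideanSpace ℝ (Fin n)

/-- The orthogonal group `O(n)`, as the group of orthogonal operators on `ℝⁿ`
(`A* A = A A* = 1`, where `A*` is the transpose), with the topology of the operator norm. -/
abbrev OrthGroup (n : ℕ) : Type := unitary (Euc n →L[ℝ] Euc n)

/-- The unitary group `U(W)` of a finite-dimensional Hilbert space, with the norm topology. -/
abbrev UnitaryGroup (W : Type*) [NormedAddCommGroup W] [InnerProductSpace ℂ W]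
    [CompleteSpace W] : Type _ := unitary (W →L[ℂ] W)

/-- Irreducibility of a unitary representation on a finite-dimensional space. -/
def IsIrreducibleRep {A W : Type*} [Group A] [NormedAddCommGroup W] [InnerProductSpace ℂ W]
    [CompleteSpace W] (τ : A →* UnitaryGroup W) : Prop :=
  Nontrivial W ∧ ∀ U : Submodule ℂ W,
    (∀ a : A, ∀ w ∈ U, (τ a : W →L[ℂ] W) w ∈ U) → U = ⊥ ∨ U = ⊤

/-- Let `κ : X → N` be an embedding of `X` near `x₀` as a submanifold of the normed space `N`
(local coordinates of an ambient manifold, restricted to a submanifold `X`).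
The function `h` on `X` is smooth at `x₀` if near `x₀` it is the
restriction of a function that is smooth on a neighbourhood of `κ x₀` in `N`. -/
def SmoothAtIn {X N V : Type*} [TopologicalSpace X] [NormedAddCommGroup N] [NormedSpace ℝ N]
    [NormedAddCommGroup V] [NormedSpace ℝ V] (κ : X → N) (h : X → V) (x₀ : X) : Prop :=
  ∃ H : N → V, ContDiffAt ℝ ∞ H (κ x₀) ∧ ∀ᶠ x in 𝓝 x₀, h x = H (κ x)

/-- The `k`-dimensional volume of the parallelepiped spanned by `v₁, …, v_k`:
the square root of the Gram determinant. -/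
def gramDensity {k : ℕ} {T : Type*} [NormedAddCommGroup T] [InnerProductSpace ℝ T]
    (v : Fin k → T) : ℝ≥0∞ :=
  ENNReal.ofReal (Real.sqrt (Matrix.gram ℝ v).det)

/-! ### The Riemannian manifold and the action -/

section Manifold

variable (n : ℕ) (M : Type*) [TopologicalSpace M] [ChartedSpace (Euc n) M]
  [RiemannianBundle (fun x : M => TangentSpace (𝓡 n) x)]

/-- The Riemannian volume: the measure which on the image of every injective smooth
local parametrization `ψ : U → M`, `U ⊆ ℝⁿ` open, is the push-forward of
`√(det (⟨∂ₐψ, ∂_bψ⟩)) du` (the least measure that dominates all these push-forwards). -/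
def riemannianVolume [MeasurableSpace M] : Measure M :=
  ⨆ (ψ : Euc n → M) (U : Set (Euc n))
    (_ : IsOpen U ∧ ContMDiffOn (𝓡 n) (𝓡 n) ∞ ψ U ∧ U.InjOn ψ),
    ((volume.restrict U).withDensity (fun u => gramDensity (fun a : Fin n =>
      (mfderiv (𝓡 n) (𝓡 n) ψ u (EuclideanSpace.single a (1 : ℝ)) :
        TangentSpace (𝓡 n) (ψ u))))).map ψ

/-- The group `G` acts on the Riemannian manifold `M` by smooth isometries: the differential
of every `g` preserves the length of tangent vectors. -/
class IsometricAction (G : Type*) [Group G] [MulAction G M] : Prop where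
  contMDiff_smul : ∀ g : G, ContMDiff (𝓡 n) (𝓡 n) ∞ (fun y : M => g • y)
  norm_mfderiv_smul : ∀ (g : G) (x : M) (v : TangentSpace (𝓡 n) x),
    ‖(mfderiv (𝓡 n) (𝓡 n) (fun y : M => g • y) x v : TangentSpace (𝓡 n) (g • x))‖ = ‖v‖

/-- The set `F_O` of orthonormal frames of `M`: a frame at `x` is a linear isometry
`ℝⁿ → T_x M`. -/
structure OrthonormalFrame where
  base : M
  frame : Euc n ≃ₗᵢ[ℝ] TangentSpace (𝓡 n) base

end Manifold

namespace OrthonormalFrame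

section Basic

variable {n : ℕ} {M : Type*} [TopologicalSpace M] [ChartedSpace (Euc n) M]
  [RiemannianBundle (fun x : M => TangentSpace (𝓡 n) x)]

/-- The tangent vector `f(v) ∈ TM` for a frame `f` and `v ∈ ℝⁿ`. -/
def vec (z : OrthonormalFrame n M) (v : Euc n) : TangentBundle (𝓡 n) M := ⟨z.base, z.frame v⟩

theorem ext_vec {z w : OrthonormalFrame n M} (hb : z.base = w.base)
    (h : ∀ v, z.vec v = w.vec v) : z = w := by
  obtain ⟨x, f⟩ := z
  obtain ⟨y, f'⟩ := w
  obtain rfl : x = y := hb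
  congr
  ext1 v
  have := h v
  simpa [vec] using this

/-- The topology of `F_O` as a subspace of `M × (TM)ⁿ`. -/
instance [IsManifold (𝓡 n) ∞ M] : TopologicalSpace (OrthonormalFrame n M) :=
  TopologicalSpace.induced
    (fun z => (z.base, fun j : Fin n => z.vec (EuclideanSpace.single j (1 : ℝ)))) inferInstance

instance [IsManifold (𝓡 n) ∞ M] : MeasurableSpace (OrthonormalFrame n M) := borel _

instance [IsManifold (𝓡 n) ∞ M] : BorelSpace (OrthonormalFrame n M) := ⟨rfl⟩

/-- The local coordinates of the bundle of linear maps `ℝⁿ → TM`, of which `F_O` is an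
embedded submanifold, over the chart `φ` of `M` at `x₀`:
`(x, f) ↦ (φ(x), dφ_x ∘ f) ∈ ℝⁿ × Hom(ℝⁿ, ℝⁿ)`. -/
def coord (x₀ : M) (z : OrthonormalFrame n M) : Euc n × (Euc n →L[ℝ] Euc n) :=
  (extChartAt (𝓡 n) x₀ z.base,
    ContinuousLinearMap.comp (mfderiv (𝓡 n) 𝓘(ℝ, Euc n) (extChartAt (𝓡 n) x₀) z.base :
        TangentSpace (𝓡 n) z.base →L[ℝ] Euc n)
      ((z.frame : Euc n →L[ℝ] TangentSpace (𝓡 n) z.base)))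

/-- The fibre of `p : F_O → M` over `x`. -/
def fiber (x : M) : Set (OrthonormalFrame n M) := {z | z.base = x}

/-- `O(n)` acts on `F_O` by `k • (x, f) = (x, f ∘ k⁻¹)`
(the right principal action, turned into a left action). -/
instance : SMul (OrthGroup n) (OrthonormalFrame n M) where
  smul k z := ⟨z.base, (Unitary.linearIsometryEquiv k⁻¹).trans z.frame⟩

theorem orth_smul_base (k : OrthGroup n) (z : OrthonormalFrame n M) :
    (k • z).base = z.base := rfl

theorem orth_smul_vec (k : OrthGroup n) (z : OrthonormalFrame n M) (v : Euc n) :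
    (k • z).vec v = z.vec (Unitary.linearIsometryEquiv k⁻¹ v) := rfl

theorem orth_one_inv (v : Euc n) :
    Unitary.linearIsometryEquiv (1 : OrthGroup n)⁻¹ v = v := by
  simp

theorem orth_mul_inv (k l : OrthGroup n) (v : Euc n) :
    Unitary.linearIsometryEquiv (k * l)⁻¹ v
      = Unitary.linearIsometryEquiv l⁻¹ (Unitary.linearIsometryEquiv k⁻¹ v) := by
  simp

instance : MulAction (OrthGroup n) (OrthonormalFrame n M) where
  one_smul z := ext_vec (orth_smul_base 1 z) fun v =>
    (orth_smul_vec 1 z v).trans (congrArg z.vec (orth_one_inv v))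
  mul_smul k l z :=
    ext_vec ((orth_smul_base (k * l) z).trans
      ((orth_smul_base k (l • z)).trans (orth_smul_base l z)).symm) fun v => by
    rw [orth_smul_vec, orth_smul_vec, orth_smul_vec, orth_mul_inv]

variable {G : Type*} [Group G] [MulAction G M] [IsometricAction n M G]

/-- The differential of `g` as a linear isometry `T_x M → T_{gx} M`. -/
def differential (g : G) (x : M) :
    TangentSpace (𝓡 n) x ≃ₗᵢ[ℝ] TangentSpace (𝓡 n) (g • x) :=
  haveI : FiniteDimensional ℝ (TangentSpace (𝓡 n) x) :=
    inferInstanceAs (FiniteDimensional ℝ (Euc n))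
  haveI : FiniteDimensional ℝ (TangentSpace (𝓡 n) (g • x)) :=
    inferInstanceAs (FiniteDimensional ℝ (Euc n))
  LinearIsometry.toLinearIsometryEquiv
    (⟨(mfderiv (𝓡 n) (𝓡 n) (fun y : M => g • y) x :
        TangentSpace (𝓡 n) x →L[ℝ] TangentSpace (𝓡 n) (g • x)).toLinearMap,
      IsometricAction.norm_mfderiv_smul g x⟩ :
      TangentSpace (𝓡 n) x →ₗᵢ[ℝ] TangentSpace (𝓡 n) (g • x)) rfl

/-- `G` acts on `F_O` by differentials: `g • (x, f) = (g x, dg ∘ f)`. -/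
instance : SMul G (OrthonormalFrame n M) where
  smul g z := ⟨g • z.base, z.frame.trans (differential g z.base)⟩

theorem smul_vec (g : G) (z : OrthonormalFrame n M) (v : Euc n) :
    (g • z).vec v = tangentMap (𝓡 n) (𝓡 n) (fun y : M => g • y) (z.vec v) := rfl

instance : MulAction G (OrthonormalFrame n M) where
  one_smul z := ext_vec (one_smul G z.base) fun v => by
    have h : (fun y : M => (1 : G) • y) = id := funext fun y => one_smul G y
    rw [smul_vec, h, tangentMap_id]; rfl
  mul_smul g h z := ext_vec (mul_smul g h z.base) fun v => by
    have hd : ∀ a : G, MDifferentiable (𝓡 n) (𝓡 n) (fun y : M => a • y) := fun a =>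
      (IsometricAction.contMDiff_smul (n := n) a).mdifferentiable (by simp)
    have e : (fun y : M => (g * h) • y) = (fun y : M => g • y) ∘ (fun y : M => h • y) :=
      funext fun y => mul_smul g h y
    rw [smul_vec, smul_vec, smul_vec, e, tangentMap_comp (hd g) (hd h)]; rfl

end Basic

end OrthonormalFrame

open OrthonormalFrame

/-! ### The Sasakian metric and the volumes that it induces -/

section Metric

variable {n : ℕ} {M : Type*} [TopologicalSpace M] [ChartedSpace (Euc n) M]
  [RiemannianBundle (fun x : M => TangentSpace (𝓡 n) x)]

/-- The Riemannian metric of `M` in the chart at `x₀`, at the point `y` of the chart domain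
in `ℝⁿ`, evaluated on `v, w ∈ ℝⁿ`. -/
def chartMetric (x₀ : M) (y v w : Euc n) : ℝ :=
  inner ℝ
    (mfderiv 𝓘(ℝ, Euc n) (𝓡 n) (extChartAt (𝓡 n) x₀).symm y v :
      TangentSpace (𝓡 n) ((extChartAt (𝓡 n) x₀).symm y))
    (mfderiv 𝓘(ℝ, Euc n) (𝓡 n) (extChartAt (𝓡 n) x₀).symm y w :
      TangentSpace (𝓡 n) ((extChartAt (𝓡 n) x₀).symm y))

/-- The Christoffel symbol of the first kind of the Levi-Civita connection,
`g(∇_a b, c) = ½ (∂_a g(b, c) + ∂_b g(a, c) - ∂_c g(a, b))` for constant fields `a, b, c`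
in the chart at `x₀`, at the point `y`. -/
def christoffel (x₀ : M) (y a b c : Euc n) : ℝ :=
  (fderiv ℝ (fun y' => chartMetric x₀ y' b c) y a
    + fderiv ℝ (fun y' => chartMetric x₀ y' a c) y b
    - fderiv ℝ (fun y' => chartMetric x₀ y' a b) y c) / 2

/-- Let `ψ` be a family of orthonormal frames with parameter in `ℝᵏ`; at the parameter `u` write
`ψ = (x, f)` and `f_j = f(e_j)`. The tangent vector `∂_v ψ` is represented by the values on it of the
solder form, `θ_i = ⟨∂_v x, f_i⟩`, and of the form of the Levi-Civita connection,
`ω_ij = ⟨∇_v f_j, f_i⟩`; the latter are computed in the chart of `M` at `x`.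
The Sasakian metric of `F_O` is `∑ θ_i² + ∑ ω_ij²`, that is
`‖∂_v ψ‖² = ‖∂_v x‖² + ∑_j ‖∇_v f_j‖²`. -/
def sasakiVec {k : ℕ} (ψ : Euc k → OrthonormalFrame n M) (u v : Euc k) :
    EuclideanSpace ℝ (Fin n ⊕ Fin n × Fin n) :=
  let x₀ : M := (ψ u).base
  let c : Euc n × (Euc n →L[ℝ] Euc n) := coord x₀ (ψ u)
  let D : Euc n × (Euc n →L[ℝ] Euc n) := fderiv ℝ (fun u' => coord x₀ (ψ u')) u v
  let e : Fin n → Euc n := fun i => EuclideanSpace.single i (1 : ℝ)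
  WithLp.toLp 2 (Sum.elim
    (fun i => chartMetric x₀ c.1 D.1 (c.2 (e i)))
    (fun ij => chartMetric x₀ c.1 (D.2 (e ij.2)) (c.2 (e ij.1))
      + christoffel x₀ c.1 D.1 (c.2 (e ij.2)) (c.2 (e ij.1))))

variable [IsManifold (𝓡 n) ∞ M]

/-- `ψ` is a smooth family of orthonormal frames on the open set `U ⊆ ℝᵏ`. -/
def IsSmoothParam {k : ℕ} (ψ : Euc k → OrthonormalFrame n M) (U : Set (Euc k)) : Prop :=
  IsOpen U ∧ ContinuousOn ψ U ∧
    ∀ u₀ ∈ U, ContDiffAt ℝ ∞ (fun u => coord (ψ u₀).base (ψ u)) u₀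

/-- The `k`-dimensional Riemannian volume on a `k`-dimensional submanifold `S` of `F_O`, for the
metric induced by the Sasakian metric: on the image of every injective smooth local
parametrization `ψ : U → S` it is the push-forward of `√(det (⟨∂ₐψ, ∂_bψ⟩)) du`. -/
def submanifoldVolume (k : ℕ) (S : Set (OrthonormalFrame n M)) :
    Measure (OrthonormalFrame n M) :=
  ⨆ (ψ : Euc k → OrthonormalFrame n M) (U : Set (Euc k))
    (_ : IsSmoothParam ψ U ∧ U.MapsTo ψ S ∧ U.InjOn ψ),
    ((volume.restrict U).withDensity (fun u => gramDensity (fun a : Fin k =>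
      sasakiVec ψ u (EuclideanSpace.single a (1 : ℝ))))).map ψ

/-- The Riemannian volume of the fibre `p⁻¹(x)`, which has dimension `n(n-1)/2`. -/
def fiberVolume (x : M) : Measure (fiber (n := n) x) :=
  (submanifoldVolume (n.choose 2) (fiber x)).comap Subtype.val

variable (d : ℕ) (G : Type*) [TopologicalSpace G] [ChartedSpace (Euc d) G] [Group G]
  [MulAction G M] [IsometricAction n M G]

variable (n M) in
/-- The orbit space `F_O / G`. -/
abbrev FrameQuotient : Type _ := MulAction.orbitRel.Quotient G (OrthonormalFrame n M)

variable (n M) in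
/-- The projection `π : F_O → F_O / G`. -/
def proj (z : OrthonormalFrame n M) : FrameQuotient n M G := Quotient.mk _ z

/-- The fibre of `π : F_O → F_O / G` over `y`, a `G`-orbit. -/
def orbitFiber (y : FrameQuotient n M G) : Set (OrthonormalFrame n M) := {z | proj n M G z = y}

/-- The tangent space at `z` to the orbit `G z`: the image of the differential at `1` of
`g ↦ g • z`. -/
def orbitTangent (z : OrthonormalFrame n M) :
    Submodule ℝ (EuclideanSpace ℝ (Fin n ⊕ Fin n × Fin n)) :=
  Submodule.span ℝ (Set.range fun v : Euc d =>
    sasakiVec (fun u : Euc d => (extChartAt (𝓡 d) (1 : G)).symm u • z)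
      (extChartAt (𝓡 d) (1 : G) 1) v)

/-- The Riemannian volume of the orbit `π⁻¹(y)`. -/
def orbitVolume (y : FrameQuotient n M G) : Measure (orbitFiber G y) :=
  (submanifoldVolume (Module.finrank ℝ (orbitTangent d G y.out))
    (orbitFiber G y)).comap Subtype.val

/-- The Riemannian volume of `F_O / G` for the metric that makes `π` a Riemannian submersion.
A local parametrization of `F_O / G` is `π ∘ ψ` for a smooth family of frames `ψ : U → F_O`, where
`U ⊆ ℝ^q` is open, `q = dim F_O - dim G z` and `π ∘ ψ` is injective on `U`; the inner products
of the `∂ₐ(π ∘ ψ)` are those of the components of the `∂ₐψ` orthogonal to the orbits. -/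
def quotientVolume : Measure (FrameQuotient n M G) :=
  ⨆ (q : ℕ) (ψ : Euc q → OrthonormalFrame n M) (U : Set (Euc q))
    (_ : IsSmoothParam ψ U ∧ U.InjOn (proj n M G ∘ ψ) ∧
      ∀ u ∈ U, q + Module.finrank ℝ (orbitTangent d G (ψ u)) = n + n.choose 2),
    ((volume.restrict U).withDensity (fun u => gramDensity (fun a : Fin q =>
      (orbitTangent d G (ψ u))ᗮ.starProjection
        (sasakiVec ψ u (EuclideanSpace.single a (1 : ℝ)))))).map (proj n M G ∘ ψ)

end Metric

/-! ### Equivariant Hermitian vector bundles over `F_O` and their sections -/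

section Bundles

variable {n : ℕ} {M : Type*} [TopologicalSpace M] [ChartedSpace (Euc n) M]
  [RiemannianBundle (fun x : M => TangentSpace (𝓡 n) x)] [IsManifold (𝓡 n) ∞ M]
  (F : Type*) [NormedAddCommGroup F] [NormedSpace ℂ F]
  (E : OrthonormalFrame n M → Type*) [∀ z, NormedAddCommGroup (E z)]
  [∀ z, InnerProductSpace ℂ (E z)] [TopologicalSpace (TotalSpace F E)]
  [FiberBundle F E] [VectorBundle ℂ F E]

/-- A complex vector bundle `E → F_O` with an inner product on each fibre is a smooth Hermitian
bundle if the transition functions and the metric in local trivializations are smooth. -/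
class IsSmoothHermitianBundle : Prop where
  smooth_coordChange : ∀ (e e' : Trivialization F (π F E)) [MemTrivializationAtlas e]
    [MemTrivializationAtlas e'], ∀ z₀ ∈ e.baseSet ∩ e'.baseSet, ∀ v : F,
      SmoothAtIn (coord z₀.base) (fun z => (e' ⟨z, e.symm z v⟩).2) z₀
  smooth_inner : ∀ (e : Trivialization F (π F E)) [MemTrivializationAtlas e],
    ∀ z₀ ∈ e.baseSet, ∀ v w : F,
      SmoothAtIn (coord z₀.base) (fun z => inner ℂ (e.symm z v) (e.symm z w)) z₀

/-- Let `A` be a Lie group acting on `F_O`, where `κ a₀ : A → N` are coordinates of `A` near `a₀`.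
An action of `A` on the total space of `E` makes `E` an equivariant Hermitian bundle
if each `a` maps each fibre `E_z` to `E_{az}` by a linear isometry, and if the action is smooth:
in local trivializations, `a • v` depends smoothly on `a` and on `v ∈ E`. -/
class IsEquivariantBundle {A N : Type*} [Group A] [TopologicalSpace A]
    [NormedAddCommGroup N] [NormedSpace ℝ N] (κ : A → A → N)
    [MulAction A (OrthonormalFrame n M)] [MulAction A (TotalSpace F E)] : Prop where
  exists_fiberMap : ∀ (a : A) (z : OrthonormalFrame n M), ∃ L : E z ≃ₗᵢ[ℂ] E (a • z),
    ∀ v : E z, a • (⟨z, v⟩ : TotalSpace F E) = ⟨a • z, L v⟩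
  smooth_smul : ∀ (a₀ : A) (z₀ : OrthonormalFrame n M) (v : F),
    SmoothAtIn (fun az : A × OrthonormalFrame n M => (κ a₀ az.1, coord z₀.base az.2))
      (fun az => (trivializationAt F E (a₀ • z₀)
        (az.1 • (⟨az.2, (trivializationAt F E z₀).symm az.2 v⟩ : TotalSpace F E))).2)
      (a₀, z₀)

/-- The space `Γ(S, E)` of smooth sections of `E` over a submanifold `S` of `F_O`. -/
def smoothSections (S : Set (OrthonormalFrame n M)) : Submodule ℂ (∀ z : S, E z) where
  carrier := {s | ∀ z₀ : S, SmoothAtIn (fun z : S => coord z₀.1.base z.1)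
    (fun z : S => (trivializationAt F E z₀.1 ⟨z.1, s z⟩).2) z₀}
  zero_mem' := fun z₀ => by
    have hb : ∀ᶠ z : S in 𝓝 z₀, z.1 ∈ (trivializationAt F E z₀.1).baseSet :=
      continuousAt_subtype_val.eventually
        ((trivializationAt F E z₀.1).open_baseSet.mem_nhds
          (FiberBundle.mem_baseSet_trivializationAt' z₀.1))
    refine ⟨fun _ => 0, contDiffAt_const, hb.mono fun z hz => ?_⟩
    exact ((trivializationAt F E z₀.1).linear ℂ hz).map_zero
  add_mem' := fun {s t} hs ht z₀ => by
    have hb : ∀ᶠ z : S in 𝓝 z₀, z.1 ∈ (trivializationAt F E z₀.1).baseSet :=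
      continuousAt_subtype_val.eventually
        ((trivializationAt F E z₀.1).open_baseSet.mem_nhds
          (FiberBundle.mem_baseSet_trivializationAt' z₀.1))
    obtain ⟨H, hH, hHs⟩ := hs z₀
    obtain ⟨K, hK, hKt⟩ := ht z₀
    refine ⟨fun x => H x + K x, hH.add hK, ?_⟩
    filter_upwards [hb, hHs, hKt] with z hz h1 h2
    rw [← h1, ← h2]
    exact ((trivializationAt F E z₀.1).linear ℂ hz).map_add _ _
  smul_mem' := fun c s hs z₀ => by
    have hb : ∀ᶠ z : S in 𝓝 z₀, z.1 ∈ (trivializationAt F E z₀.1).baseSet :=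
      continuousAt_subtype_val.eventually
        ((trivializationAt F E z₀.1).open_baseSet.mem_nhds
          (FiberBundle.mem_baseSet_trivializationAt' z₀.1))
    obtain ⟨H, hH, hHs⟩ := hs z₀
    refine ⟨fun x => c • H x, hH.const_smul c, ?_⟩
    filter_upwards [hb, hHs] with z hz h1
    rw [← h1]
    exact ((trivializationAt F E z₀.1).linear ℂ hz).map_smul c _

/-- Let `V ⊆ X` be a space of sections of some bundle, and suppose that an element `s` of `X` is
determined by an associated section `ev s` of `E` over `S ⊆ F_O`, so that the action of `A` on
sections is given by `ev (a s) (a z) = a • ev s z`. The part `V^τ` of type `τ` of `V` is the sum of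
the images of all equivariant linear maps from the representation space `W` of `τ` to `V`. -/
def typePart {A W X : Type*} [Group A] [MulAction A (OrthonormalFrame n M)]
    [MulAction A (TotalSpace F E)] [NormedAddCommGroup W] [InnerProductSpace ℂ W]
    [CompleteSpace W] [AddCommGroup X] [Module ℂ X] {S : Set (OrthonormalFrame n M)}
    (τ : A →* UnitaryGroup W) (V : Submodule ℂ X) (ev : X →ₗ[ℂ] ∀ z : S, E z) :
    Submodule ℂ X :=
  ⨆ (T : W →ₗ[ℂ] X)
    (_ : (∀ w, T w ∈ V) ∧ ∀ (a : A) (w : W) (z z' : S), z'.1 = a • z.1 →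
      a • (⟨z.1, ev (T w) z⟩ : TotalSpace F E) = ⟨z'.1, ev (T ((τ a : W →L[ℂ] W) w)) z'⟩),
    LinearMap.range T

section OverM

variable [MulAction (OrthGroup n) (TotalSpace F E)]
  {W : Type*} [NormedAddCommGroup W] [InnerProductSpace ℂ W] [CompleteSpace W]
  (σ : OrthGroup n →* UnitaryGroup W)

/-- The fibre `E^σ_x = Γ(p⁻¹(x), E)^σ`. -/
def bundleE (x : M) : Submodule ℂ (∀ z : fiber (n := n) x, E z) :=
  typePart F E σ (smoothSections F E (fiber x)) LinearMap.id

/-- The section `z ↦ s_{p(z)}(z)` of `E` over `F_O` that corresponds to a section `s` of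
`E^σ → M`. -/
def totalE : (∀ x : M, bundleE F E σ x) →ₗ[ℂ]
    (∀ z : (Set.univ : Set (OrthonormalFrame n M)), E z) where
  toFun s z := (s z.1.base).1 ⟨z.1, rfl⟩
  map_add' _ _ := rfl
  map_smul' _ _ := rfl

/-- `Γ(M, E^σ)`. As for every bundle of spaces of fibrewise sections, a section `s` of `E^σ` is
smooth if `s_x(z)` depends smoothly on `x` and `z ∈ p⁻¹(x)`. -/
def sectionsE : Submodule ℂ (∀ x : M, bundleE F E σ x) :=
  (smoothSections F E Set.univ).comap (totalE F E σ)

/-- `Γ(M, E^σ)^ρ`, for the action `(g s)_{gx}(gz) = g • s_x(z)` of `G` on `Γ(M, E^σ)`. -/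
def sectionsETyped {G V : Type*} [Group G] [MulAction G M] [IsometricAction n M G]
    [MulAction G (TotalSpace F E)]
    [NormedAddCommGroup V] [InnerProductSpace ℂ V] [CompleteSpace V]
    (ρ : G →* UnitaryGroup V) : Submodule ℂ (∀ x : M, bundleE F E σ x) :=
  typePart F E ρ (sectionsE F E σ) (totalE F E σ)

/-- The squared `L²`-norm of a section of `E^σ`, where the norm of `E^σ_x` is
the `L²`-norm over the fibre `p⁻¹(x)`. -/
def normSqE [MeasurableSpace M] (s : ∀ x : M, bundleE F E σ x) : ℝ≥0∞ :=
  ∫⁻ x, (∫⁻ z, ‖(s x).1 z‖ₑ ^ 2 ∂(fiberVolume x)) ∂(riemannianVolume n M)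

end OverM

section OverQuotient

variable (d : ℕ) {G : Type*} [TopologicalSpace G] [ChartedSpace (Euc d) G] [Group G]
  [MulAction G M] [IsometricAction n M G] [MulAction G (TotalSpace F E)]
  {V : Type*} [NormedAddCommGroup V] [InnerProductSpace ℂ V] [CompleteSpace V]
  (ρ : G →* UnitaryGroup V)

/-- The fibre `T^ρ_y = Γ(π⁻¹(y), E)^ρ`. -/
def bundleT (y : FrameQuotient n M G) : Submodule ℂ (∀ z : orbitFiber G y, E z) :=
  typePart F E ρ (smoothSections F E (orbitFiber G y)) LinearMap.id

/-- The section `z ↦ t_{π(z)}(z)` of `E` over `F_O` that corresponds to a section `t` of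
`T^ρ → F_O / G`. -/
def totalT : (∀ y : FrameQuotient n M G, bundleT F E ρ y) →ₗ[ℂ]
    (∀ z : (Set.univ : Set (OrthonormalFrame n M)), E z) where
  toFun t z := (t (proj n M G z.1)).1 ⟨z.1, rfl⟩
  map_add' _ _ := rfl
  map_smul' _ _ := rfl

/-- `Γ(F_O / G, T^ρ)`: a section `t` of `T^ρ` is smooth if `t_y(z)` depends smoothly on
`y` and `z ∈ π⁻¹(y)`. -/
def sectionsT : Submodule ℂ (∀ y : FrameQuotient n M G, bundleT F E ρ y) :=
  (smoothSections F E Set.univ).comap (totalT F E ρ)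

/-- `Γ(F_O / G, T^ρ)^σ`, for the action `(k t)_{ky}(kz) = k • t_y(z)` of `O(n)` on
`Γ(F_O / G, T^ρ)`. -/
def sectionsTTyped {W : Type*} [MulAction (OrthGroup n) (TotalSpace F E)]
    [NormedAddCommGroup W] [InnerProductSpace ℂ W] [CompleteSpace W]
    (σ : OrthGroup n →* UnitaryGroup W) :
    Submodule ℂ (∀ y : FrameQuotient n M G, bundleT F E ρ y) :=
  typePart F E σ (sectionsT F E ρ) (totalT F E ρ)

/-- The squared `L²`-norm of a section of `T^ρ`, where the norm of `T^ρ_y` is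
the `L²`-norm over the orbit `π⁻¹(y)`. -/
def normSqT (t : ∀ y : FrameQuotient n M G, bundleT F E ρ y) : ℝ≥0∞ :=
  ∫⁻ y, (∫⁻ z, ‖(t y).1 z‖ₑ ^ 2 ∂(orbitVolume d G y)) ∂(quotientVolume d G)

end OverQuotient

end Bundles

/-! ### Hilbert space completions -/

section Completion

variable {X : Type*} [AddCommGroup X] [Module ℂ X]

/-- The space of the elements of `V` with finite norm (these form a subspace, so that the
span adds nothing, whenever `N` is the square of an `L²`-norm). -/
def squareIntegrable (V : Submodule ℂ X) (N : X → ℝ≥0∞) : Submodule ℂ X :=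
  Submodule.span ℂ {s | s ∈ V ∧ N s < ⊤}

/-- The linear map `ι` exhibits the Hilbert space `H` as the completion of the space of
elements `s` of `V` with finite norm, where `N s` is the square of the norm of `s`. -/
def IsL2Completion (V : Submodule ℂ X) (N : X → ℝ≥0∞) {H : Type*} [NormedAddCommGroup H]
    [InnerProductSpace ℂ H] (ι : squareIntegrable V N →ₗ[ℂ] H) : Prop :=
  CompleteSpace H ∧ DenseRange ι ∧ ∀ s, ‖ι s‖ₑ ^ 2 = N s

end Completion

end FrameBundleSections

end

universe uM uE

open FrameBundleSections FrameBundleSections.OrthonormalFrame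

noncomputable section

set_option linter.unusedSectionVars false
set_option synthInstance.maxHeartbeats 400000

namespace FrameBundleSections

-- Both spaces of sections are descriptions of one space of smooth sections of $E$ over $F_O$, and
-- both iterated integrals are the integral of $\|S\|^2$ over $F_O$.
--
-- Algebra. A section $s$ of $\mathcal E^\sigma$ or $t$ of $\mathcal T^\rho$ is the same as its
-- total section $S$ over $F_O$ (`totalE`, `totalT`). For an irreducible representation $\tau$ of a
-- group $A$, the part of type $\tau$ of a translation invariant space of sections consists of the
-- sections annihilated by every element of the group algebra that acts as zero in $\tau$
-- (`typePart_eq_inf_killed`; this rests on Burnside's theorem). The annihilation condition can be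
-- tested on one orbit at a time. So it does not matter whether the type is imposed on each fibre or
-- on the whole section, and since the actions of $G$ and $O(n)$ commute, nor does it matter which
-- of the two types is imposed first. Both images in $\Gamma(F_O,E)$ are the smooth sections
-- annihilated for $\sigma$ and for $\rho$ (`map_totalE_sectionsETyped`,
-- `map_totalT_sectionsTTyped`), and $\Phi$ is the resulting identification.
--
-- Norms. Both $p$ and $\pi$ are Riemannian submersions, and Fubini's theorem holds for each
-- (`lintegral_fiber`, `lintegral_orbit`). In a local product parametrization whose first factor
-- runs along the fibres, the Gram determinant of the Sasakian metric is the Gram determinant along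
-- the fibre times that of the components orthogonal to the fibre (`gramDensity_split`), and the
-- latter is the density of the base. The volumes are suprema of push-forwards over all
-- parametrizations; the change of variables formula shows that over an open set covered by one
-- parametrization its push-forward alone gives the volume. Such local statements are glued by a
-- countable cover (`lintegral_lintegral_of_local`).
--
-- Product parametrizations. For $p$ they come from a local diffeomorphism of the space of linear
-- maps $\mathbb R^n\to TM$ that straightens $F_O$ (`exists_bundleChart`). For $\pi$ the geometry of
-- $F_O$ is needed. The solder form and the Levi-Civita connection form trivialize the tangent
-- bundle of $F_O$, and $G$ preserves them. A map that preserves a parallelism and fixes a point is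
-- the identity nearby (`exists_rigid_estimate`). As $M$ is connected, an element of $G$ that fixes
-- one frame therefore fixes all frames, and a Killing field of the action that vanishes at one
-- frame vanishes everywhere. So all orbits in $F_O$ have the same dimension, and compactness of $G$
-- yields transversals that meet every orbit at most once (`exists_sliceChart`).
--
-- Completions. The $L^2$-inner product over $F_O$ makes each space of elements of finite norm a
-- semi-inner product space; its completion is the Hilbert space, and $\Phi$, an isometric bijection
-- of dense subspaces, extends by continuity.

local instance (n : ℕ) : ContinuousSMul ℝ (Euc n) := inferInstance

local instance (n : ℕ) : ContinuousSMul ℝ (Euc n →L[ℝ] Euc n) := inferInstance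

local instance (n : ℕ) : ContinuousSMul ℝ (Euc n × (Euc n →L[ℝ] Euc n)) := inferInstance

local instance (n : ℕ) : ContinuousAdd (Euc n) := inferInstance

local instance (n : ℕ) : ContinuousAdd (Euc n →L[ℝ] Euc n) := inferInstance

local instance (n : ℕ) : ContinuousAdd (Euc n × (Euc n →L[ℝ] Euc n)) := inferInstance

/-! ### Differentials in the charts of M -/

section ChartCalculus

variable {n : ℕ} {M : Type*} [TopologicalSpace M] [ChartedSpace (Euc n) M]

/-- The differential at `x` of the chart centred at `x₀`. -/
def chartDeriv (x₀ x : M) : TangentSpace (𝓡 n) x →L[ℝ] Euc n :=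
  mfderiv (𝓡 n) 𝓘(ℝ, Euc n) (extChartAt (𝓡 n) x₀) x

/-- The differential at `y` of the inverse of the chart centred at `x₀`. -/
def chartSymmDeriv (x₀ : M) (y : Euc n) :
    Euc n →L[ℝ] TangentSpace (𝓡 n) ((extChartAt (𝓡 n) x₀).symm y) :=
  mfderiv 𝓘(ℝ, Euc n) (𝓡 n) (extChartAt (𝓡 n) x₀).symm y

variable [IsManifold (𝓡 n) ∞ M]

theorem isOpen_target (x₀ : M) : IsOpen (extChartAt (𝓡 n) x₀).target :=
  isOpen_extChartAt_target x₀

theorem mdifferentiableAt_symm {x₀ : M} {y : Euc n} (hy : y ∈ (extChartAt (𝓡 n) x₀).target) :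
    MDifferentiableAt 𝓘(ℝ, Euc n) (𝓡 n) (extChartAt (𝓡 n) x₀).symm y := by
  have : IsManifold (𝓡 n) 1 M := IsManifold.of_le (n := ∞) (by simp)
  have := mdifferentiableWithinAt_extChartAt_symm (I := 𝓡 n) hy
  rwa [ModelWithCorners.range_eq_univ, mdifferentiableWithinAt_univ] at this

theorem chartDeriv_symm_apply {x₀ : M} {y : Euc n} (hy : y ∈ (extChartAt (𝓡 n) x₀).target)
    (v : Euc n) :
    chartDeriv x₀ ((extChartAt (𝓡 n) x₀).symm y) (chartSymmDeriv x₀ y v) = v := by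
  have : IsManifold (𝓡 n) 1 M := IsManifold.of_le (n := ∞) (by simp)
  have := mfderiv_extChartAt_comp_mfderivWithin_extChartAt_symm (I := 𝓡 n) hy
  rw [ModelWithCorners.range_eq_univ, mfderivWithin_univ] at this
  exact DFunLike.congr_fun this v

theorem chartSymmDeriv_apply' {x₀ : M} {y : Euc n} (hy : y ∈ (extChartAt (𝓡 n) x₀).target)
    (w : TangentSpace (𝓡 n) ((extChartAt (𝓡 n) x₀).symm y)) :
    chartSymmDeriv x₀ y (chartDeriv x₀ ((extChartAt (𝓡 n) x₀).symm y) w) = w := by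
  have : IsManifold (𝓡 n) 1 M := IsManifold.of_le (n := ∞) (by simp)
  have := mfderivWithin_extChartAt_symm_comp_mfderiv_extChartAt (I := 𝓡 n) hy
  rw [ModelWithCorners.range_eq_univ, mfderivWithin_univ] at this
  exact DFunLike.congr_fun this w

theorem mdifferentiableAt_chart {x₀ x : M} (hx : x ∈ (extChartAt (𝓡 n) x₀).source) :
    MDifferentiableAt (𝓡 n) 𝓘(ℝ, Euc n) (extChartAt (𝓡 n) x₀) x := by
  have : IsManifold (𝓡 n) 1 M := IsManifold.of_le (n := ∞) (by simp)
  exact mdifferentiableAt_extChartAt (by simpa using hx)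

theorem chartDeriv_injective {x₀ x : M} (hx : x ∈ (extChartAt (𝓡 n) x₀).source) :
    Function.Injective (chartDeriv (n := n) x₀ x) := by
  obtain ⟨y, hy, rfl⟩ : ∃ y ∈ (extChartAt (𝓡 n) x₀).target, (extChartAt (𝓡 n) x₀).symm y = x :=
    ⟨_, (extChartAt (𝓡 n) x₀).map_source hx, (extChartAt (𝓡 n) x₀).left_inv hx⟩
  exact Function.LeftInverse.injective (chartSymmDeriv_apply' hy)

/-- The expression of the differential of a map `h` of `M` in charts. -/
theorem chartDeriv_mfderiv {h : M → M} {x₀ x₁ x : M} (hh : MDifferentiableAt (𝓡 n) (𝓡 n) h x)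
    (hx : x ∈ (extChartAt (𝓡 n) x₀).source) (hx' : h x ∈ (extChartAt (𝓡 n) x₁).source)
    (w : TangentSpace (𝓡 n) x) :
    chartDeriv x₁ (h x) (mfderiv (𝓡 n) (𝓡 n) h x w) =
      fderiv ℝ (fun y => extChartAt (𝓡 n) x₁ (h ((extChartAt (𝓡 n) x₀).symm y)))
        (extChartAt (𝓡 n) x₀ x) (chartDeriv x₀ x w) := by
  have hy := (extChartAt (𝓡 n) x₀).map_source hx
  have hl := (extChartAt (𝓡 n) x₀).left_inv hx
  have e1 : MDifferentiableAt (𝓡 n) (𝓡 n) h ((extChartAt (𝓡 n) x₀).symm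
      (extChartAt (𝓡 n) x₀ x)) := by rwa [hl]
  have e2 : MDifferentiableAt (𝓡 n) 𝓘(ℝ, Euc n) (extChartAt (𝓡 n) x₁)
      (h ((extChartAt (𝓡 n) x₀).symm (extChartAt (𝓡 n) x₀ x))) := by
    rw [hl]; exact mdifferentiableAt_chart hx'
  have e3 : MDifferentiableAt 𝓘(ℝ, Euc n) 𝓘(ℝ, Euc n)
      (fun y => extChartAt (𝓡 n) x₁ (h ((extChartAt (𝓡 n) x₀).symm y)))
        (extChartAt (𝓡 n) x₀ x) :=
    MDifferentiableAt.comp (g := extChartAt (𝓡 n) x₁)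
      (f := fun y => h ((extChartAt (𝓡 n) x₀).symm y)) _ e2
      (MDifferentiableAt.comp (g := h) _ e1 (mdifferentiableAt_symm hy))
  have key : (fun x' => extChartAt (𝓡 n) x₁ (h x')) =ᶠ[𝓝 x]
      (fun y => extChartAt (𝓡 n) x₁ (h ((extChartAt (𝓡 n) x₀).symm y))) ∘
        extChartAt (𝓡 n) x₀ := by
    filter_upwards [extChartAt_source_mem_nhds' (I := 𝓡 n) hx] with x' hx'
    simp only [Function.comp_apply, (extChartAt (𝓡 n) x₀).left_inv hx']
  have h1 := key.mfderiv_eq (I := 𝓡 n) (I' := 𝓘(ℝ, Euc n))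
  rw [mfderiv_comp x e3 (mdifferentiableAt_chart hx)] at h1
  have h2 := mfderiv_comp x (mdifferentiableAt_chart hx') hh
  have h3 := h2.symm.trans h1
  rw [mfderiv_eq_fderiv] at h3
  exact DFunLike.congr_fun h3 w

end ChartCalculus

/-! ### The metric of M in a chart -/

section Metric

variable {n : ℕ} {M : Type*} [TopologicalSpace M] [ChartedSpace (Euc n) M]
  [RiemannianBundle (fun x : M => TangentSpace (𝓡 n) x)] 

theorem chartMetric_eq (x₀ : M) (y v w : Euc n) :
    chartMetric x₀ y v w = inner ℝ (chartSymmDeriv x₀ y v) (chartSymmDeriv x₀ y w) := rfl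

/-- The metric in a chart, as a continuous bilinear form. -/
def metricForm (x₀ : M) (y : Euc n) : Euc n →L[ℝ] Euc n →L[ℝ] ℝ :=
  LinearMap.toContinuousLinearMap
    ((LinearMap.toContinuousLinearMap (𝕜 := ℝ) (E := Euc n) (F' := ℝ)).toLinearMap ∘ₗ
      LinearMap.mk₂ ℝ (fun v w => chartMetric x₀ y v w)
        (fun v v' w => by simp only [chartMetric_eq, map_add, inner_add_left])
        (fun c v w => by simp only [chartMetric_eq, map_smul, inner_smul_left]; simp)
        (fun v w w' => by simp only [chartMetric_eq, map_add, inner_add_right])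
        (fun c v w => by simp only [chartMetric_eq, map_smul, inner_smul_right]; simp))

theorem metricForm_apply (x₀ : M) (y v w : Euc n) :
    metricForm x₀ y v w = chartMetric x₀ y v w := rfl

theorem metricForm_comm (x₀ : M) (y v w : Euc n) :
    metricForm x₀ y v w = metricForm x₀ y w v := by
  simp only [metricForm_apply, chartMetric_eq]
  exact real_inner_comm _ _

variable [IsManifold (𝓡 n) ∞ M]

theorem inner_eq_metricForm {x₀ x : M} (hx : x ∈ (extChartAt (𝓡 n) x₀).source)
    (v w : TangentSpace (𝓡 n) x) :
    metricForm x₀ (extChartAt (𝓡 n) x₀ x) (chartDeriv x₀ x v) (chartDeriv x₀ x w) =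
      inner ℝ v w := by
  obtain ⟨y, hy, rfl⟩ : ∃ y ∈ (extChartAt (𝓡 n) x₀).target, (extChartAt (𝓡 n) x₀).symm y = x :=
    ⟨_, (extChartAt (𝓡 n) x₀).map_source hx, (extChartAt (𝓡 n) x₀).left_inv hx⟩
  rw [(extChartAt (𝓡 n) x₀).right_inv hy, metricForm_apply, chartMetric_eq,
    chartSymmDeriv_apply' hy, chartSymmDeriv_apply' hy]

theorem metricForm_pos {x₀ : M} {y : Euc n} (hy : y ∈ (extChartAt (𝓡 n) x₀).target) {v : Euc n}
    (hv : v ≠ 0) : 0 < metricForm x₀ y v v := by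
  rw [metricForm_apply, chartMetric_eq, real_inner_self_eq_norm_sq]
  have : chartSymmDeriv x₀ y v ≠ 0 := fun h => hv (by
    rw [← chartDeriv_symm_apply hy v, h, map_zero])
  positivity

theorem metricForm_nondeg {x₀ : M} {y : Euc n} (hy : y ∈ (extChartAt (𝓡 n) x₀).target) {v : Euc n}
    (h : ∀ w, metricForm x₀ y v w = 0) : v = 0 := by
  by_contra hv
  exact (metricForm_pos hy hv).ne' (h v)

variable [IsContMDiffRiemannianBundle (𝓡 n) ∞ (Euc n) (fun x : M => TangentSpace (𝓡 n) x)]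

/-- In the trivialization of the tangent bundle at `x₀` this coordinate field is the constant `v`.
-/
theorem contMDiffAt_chartSymmDeriv {x₀ : M} {y : Euc n} (hy : y ∈ (extChartAt (𝓡 n) x₀).target)
    (v : Euc n) :
    ContMDiffAt 𝓘(ℝ, Euc n) (𝓡 n).tangent ∞
      (fun y => (⟨(extChartAt (𝓡 n) x₀).symm y, chartSymmDeriv x₀ y v⟩ :
        TangentBundle (𝓡 n) M)) y := by
  have h1 : IsManifold (𝓡 n) 1 M := IsManifold.of_le (n := ∞) (by simp)
  have hb : (extChartAt (𝓡 n) x₀).symm y ∈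
      (trivializationAt (Euc n) (TangentSpace (𝓡 n) : M → Type _) x₀).baseSet := by
    have := (extChartAt (𝓡 n) x₀).map_target hy
    rwa [extChartAt_source] at this
  refine (Bundle.Trivialization.contMDiffAt_iff (e := trivializationAt (Euc n) (TangentSpace (𝓡 n)) x₀) ?_).2 ⟨?_, ?_⟩
  · rw [Trivialization.mem_source]; exact hb
  · exact contMDiffOn_extChartAt_symm x₀ |>.contMDiffAt ((isOpen_target x₀).mem_nhds hy)
  · refine (contMDiffAt_const (c := v)).congr_of_eventuallyEq ?_
    filter_upwards [(isOpen_target x₀).mem_nhds hy] with y' hy'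
    have hs := (extChartAt (𝓡 n) x₀).map_target hy'
    rw [extChartAt_source] at hs
    have := TangentBundle.continuousLinearMapAt_trivializationAt (𝕜 := ℝ) (I := 𝓡 n) hs
    rw [← Trivialization.continuousLinearMapAt_apply_of_mem (R := ℝ) _ hs, this]
    exact chartDeriv_symm_apply hy' v

theorem contDiffAt_metricForm {x₀ : M} {y : Euc n} (hy : y ∈ (extChartAt (𝓡 n) x₀).target) :
    ContDiffAt ℝ ∞ (metricForm x₀) y := by
  have key : ∀ v w : Euc n, ContDiffOn ℝ ∞ (fun y => metricForm x₀ y v w)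
      (extChartAt (𝓡 n) x₀).target := by
    intro v w y hy
    rw [← contMDiffWithinAt_iff_contDiffWithinAt]
    exact (ContMDiffAt.inner_bundle (contMDiffAt_chartSymmDeriv hy v) (contMDiffAt_chartSymmDeriv hy w)).contMDiffWithinAt
  exact (contDiffOn_clm_apply.2 fun v => contDiffOn_clm_apply.2 fun w => key v w).contDiffAt
    ((isOpen_target x₀).mem_nhds hy)
end Metric

/-! ### Coordinates and topology of the frame bundle -/

section FrameCoordinates

variable {n : ℕ} {M : Type*} [TopologicalSpace M] [ChartedSpace (Euc n) M]
  [RiemannianBundle (fun x : M => TangentSpace (𝓡 n) x)]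

/-- The ambient space of the local coordinates of the frame bundle. -/
abbrev Amb (n : ℕ) : Type := Euc n × (Euc n →L[ℝ] Euc n)

/-- The frames over the domain of the chart centred at `x₀`. -/
def frameDom (x₀ : M) : Set (OrthonormalFrame n M) := {z | z.base ∈ (extChartAt (𝓡 n) x₀).source}

theorem mem_frameDom_self (z : OrthonormalFrame n M) : z ∈ frameDom z.base :=
  mem_extChartAt_source (I := 𝓡 n) z.base

theorem coord_fst (x₀ : M) (z : OrthonormalFrame n M) :
    (coord x₀ z).1 = extChartAt (𝓡 n) x₀ z.base := rfl

theorem coord_snd_apply (x₀ : M) (z : OrthonormalFrame n M) (v : Euc n) :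
    (coord x₀ z).2 v = chartDeriv x₀ z.base (z.frame v) := rfl

theorem coord_fst_mem_target {x₀ : M} {z : OrthonormalFrame n M} (hz : z ∈ frameDom x₀) :
    (coord x₀ z).1 ∈ (extChartAt (𝓡 n) x₀).target := (extChartAt (𝓡 n) x₀).map_source hz

theorem symm_coord_fst {x₀ : M} {z : OrthonormalFrame n M} (hz : z ∈ frameDom x₀) :
    (extChartAt (𝓡 n) x₀).symm (coord x₀ z).1 = z.base := (extChartAt (𝓡 n) x₀).left_inv hz

variable [IsManifold (𝓡 n) ∞ M]

theorem metricForm_coord {x₀ : M} {z : OrthonormalFrame n M} (hz : z ∈ frameDom x₀)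
    (v w : Euc n) :
    metricForm x₀ (coord x₀ z).1 ((coord x₀ z).2 v) ((coord x₀ z).2 w) = inner ℝ v w := by
  rw [coord_fst, coord_snd_apply, coord_snd_apply, inner_eq_metricForm hz,
    LinearIsometryEquiv.inner_map_map]

theorem coord_snd_injective {x₀ : M} {z : OrthonormalFrame n M} (hz : z ∈ frameDom x₀) :
    Function.Injective (coord x₀ z).2 := fun _ _ h =>
  z.frame.injective (chartDeriv_injective hz h)

theorem coord_snd_surjective {x₀ : M} {z : OrthonormalFrame n M} (hz : z ∈ frameDom x₀) :
    Function.Surjective (coord x₀ z).2 :=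
  LinearMap.injective_iff_surjective.1 (coord_snd_injective hz)

theorem coord_injOn (x₀ : M) : Set.InjOn (coord (n := n) x₀) (frameDom x₀) := by
  intro z hz w hw h
  obtain ⟨x, f⟩ := z
  obtain ⟨x', f'⟩ := w
  have hb : x = x' := (extChartAt (𝓡 n) x₀).injOn hz hw (congrArg Prod.fst h)
  subst hb
  congr 1
  ext1 v
  exact chartDeriv_injective hz (DFunLike.congr_fun (congrArg Prod.snd h) v)

/-- Converse of `metricForm_coord`: over a chart the frame bundle is the set of all pairs $(y,A)$
with $A^*g_yA=1$ in the ambient space. -/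
theorem exists_coord_eq {x₀ : M} {y : Euc n} (hy : y ∈ (extChartAt (𝓡 n) x₀).target)
    (A : Euc n →L[ℝ] Euc n) (hA : ∀ v w, metricForm x₀ y (A v) (A w) = inner ℝ v w) :
    ∃ z : OrthonormalFrame n M, z ∈ frameDom x₀ ∧ coord x₀ z = (y, A) := by
  have : FiniteDimensional ℝ (TangentSpace (𝓡 n) ((extChartAt (𝓡 n) x₀).symm y)) :=
    inferInstanceAs (FiniteDimensional ℝ (Euc n))
  let L : Euc n →ₗᵢ[ℝ] TangentSpace (𝓡 n) ((extChartAt (𝓡 n) x₀).symm y) :=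
    ⟨((chartSymmDeriv x₀ y).toLinearMap ∘ₗ A.toLinearMap), fun v => by
      have := hA v v
      rw [metricForm_apply, chartMetric_eq, real_inner_self_eq_norm_sq,
        real_inner_self_eq_norm_sq] at this
      exact (sq_eq_sq₀ (norm_nonneg _) (norm_nonneg _)).1 this⟩
  have hs := (extChartAt (𝓡 n) x₀).map_target hy
  refine ⟨⟨(extChartAt (𝓡 n) x₀).symm y, L.toLinearIsometryEquiv rfl⟩, hs, Prod.ext ?_ ?_⟩
  · exact (extChartAt (𝓡 n) x₀).right_inv hy
  · ext1 v
    exact chartDeriv_symm_apply hy (A v)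

theorem continuous_base_vec : Continuous (fun z : OrthonormalFrame n M =>
    (z.base, fun j : Fin n => z.vec (EuclideanSpace.single j (1 : ℝ)))) :=
  continuous_induced_dom

theorem continuous_base : Continuous (OrthonormalFrame.base : OrthonormalFrame n M → M) :=
  continuous_fst.comp continuous_base_vec

theorem continuous_vec (j : Fin n) : Continuous
    (fun z : OrthonormalFrame n M => z.vec (EuclideanSpace.single j (1 : ℝ))) :=
  (continuous_apply j).comp (continuous_snd.comp continuous_base_vec)

theorem isOpen_frameDom (x₀ : M) : IsOpen (frameDom (n := n) x₀) :=
  (isOpen_extChartAt_source x₀).preimage continuous_base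

theorem frameDom_mem_nhds {x₀ : M} {z : OrthonormalFrame n M} (hz : z ∈ frameDom x₀) :
    frameDom x₀ ∈ 𝓝 z := (isOpen_frameDom x₀).mem_nhds hz

theorem trivializationAt_vec {x₀ : M} {z : OrthonormalFrame n M} (hz : z ∈ frameDom x₀)
    (v : Euc n) :
    trivializationAt (Euc n) (TangentSpace (𝓡 n)) x₀ (z.vec v) = (z.base, (coord x₀ z).2 v) := by
  have h1 : IsManifold (𝓡 n) 1 M := IsManifold.of_le (n := ∞) (by simp)
  have hs : z.base ∈ (chartAt (Euc n) x₀).source := by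
    have : z.base ∈ (extChartAt (𝓡 n) x₀).source := hz
    rwa [extChartAt_source] at this
  refine Prod.ext (Trivialization.coe_fst' _ hs) ?_
  have := TangentBundle.continuousLinearMapAt_trivializationAt (𝕜 := ℝ) (I := 𝓡 n) hs
  rw [coord_snd_apply, chartDeriv, ← this]
  exact (Trivialization.continuousLinearMapAt_apply_of_mem (R := ℝ) _ hs _).symm

/-- Linear maps on `ℝⁿ` are determined continuously by their values on the standard basis. -/
theorem continuous_clm_of_basis {X : Type*} {l : Filter X} {f : X → Euc n →L[ℝ] Euc n}
    {A : Euc n →L[ℝ] Euc n}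
    (h : ∀ j : Fin n, Filter.Tendsto (fun x => f x (EuclideanSpace.single j (1 : ℝ))) l
      (𝓝 (A (EuclideanSpace.single j (1 : ℝ))))) : Filter.Tendsto f l (𝓝 A) := by
  let b := (EuclideanSpace.basisFun (Fin n) ℝ).toBasis
  let T : (Fin n → Euc n) →ₗ[ℝ] (Euc n →L[ℝ] Euc n) :=
    (LinearMap.toContinuousLinearMap (𝕜 := ℝ) (E := Euc n) (F' := Euc n)).toLinearMap ∘ₗ
      (b.constr ℝ).toLinearMap
  have hT : ∀ B : Euc n →L[ℝ] Euc n, T (fun j => B (EuclideanSpace.single j (1 : ℝ))) = B := by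
    intro B
    ext1 v
    have : b.constr ℝ (fun j => B (EuclideanSpace.single j (1 : ℝ))) = B.toLinearMap := by
      refine b.ext fun j => ?_
      rw [b.constr_basis]
      simp [b]
    exact DFunLike.congr_fun this v
  have hc : Continuous T := LinearMap.continuous_of_finiteDimensional T
  have := (hc.tendsto (fun j => A (EuclideanSpace.single j (1 : ℝ)))).comp
    (tendsto_pi_nhds.2 h)
  rw [hT] at this
  exact this.congr fun x => hT (f x)

theorem continuousAt_coord {x₀ : M} {z : OrthonormalFrame n M} (hz : z ∈ frameDom x₀) :
    ContinuousAt (coord x₀) z := by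
  refine ContinuousAt.prodMk ?_ ?_
  · exact ContinuousAt.comp (g := extChartAt (𝓡 n) x₀) (continuousAt_extChartAt' hz)
      continuous_base.continuousAt
  · refine continuous_clm_of_basis fun j => ?_
    have hs : z.base ∈ (trivializationAt (Euc n) (TangentSpace (𝓡 n) : M → Type _) x₀).baseSet := by
      have : z.base ∈ (extChartAt (𝓡 n) x₀).source := hz
      rwa [extChartAt_source] at this
    have h1 : ContinuousAt (fun w : OrthonormalFrame n M =>
        (trivializationAt (Euc n) (TangentSpace (𝓡 n) : M → Type _) x₀
          (w.vec (EuclideanSpace.single j (1 : ℝ)))).2) z :=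
      continuous_snd.continuousAt.comp (ContinuousAt.comp (g := trivializationAt (Euc n)
        (TangentSpace (𝓡 n) : M → Type _) x₀)
        ((trivializationAt (Euc n) (TangentSpace (𝓡 n) : M → Type _) x₀).continuousAt
          ((Trivialization.mem_source _).2 hs)) (continuous_vec j).continuousAt)
    have h2 := h1.tendsto
    rw [trivializationAt_vec hz] at h2
    refine h2.congr' ?_
    filter_upwards [frameDom_mem_nhds hz] with w hw
    rw [trivializationAt_vec hw]
    rfl

/-- The coordinates induce the topology: the base point is recovered continuously by the inverse
chart, and the vectors of the frame by the inverse of the trivialization of $TM$. -/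
theorem nhds_eq_comap_coord {x₀ : M} {z : OrthonormalFrame n M} (hz : z ∈ frameDom x₀) :
    𝓝 z = Filter.comap (coord x₀) (𝓝 (coord x₀ z)) ⊓ Filter.principal (frameDom x₀) := by
  refine le_antisymm (le_inf (continuousAt_coord hz).tendsto.le_comap
    (Filter.le_principal_iff.2 (frameDom_mem_nhds hz))) ?_
  have hlim : Filter.Tendsto (coord x₀) (Filter.comap (coord x₀) (𝓝 (coord x₀ z)) ⊓
      Filter.principal (frameDom x₀)) (𝓝 (coord x₀ z)) :=
    Filter.tendsto_comap.mono_left inf_le_left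
  have hmem : ∀ᶠ w in Filter.comap (coord x₀) (𝓝 (coord x₀ z)) ⊓
      Filter.principal (frameDom x₀), w ∈ frameDom x₀ :=
    Filter.mem_inf_of_right (Filter.mem_principal_self _)
  have hbase : Filter.Tendsto OrthonormalFrame.base
      (Filter.comap (coord x₀) (𝓝 (coord x₀ z)) ⊓ Filter.principal (frameDom x₀))
      (𝓝 z.base) := by
    have := (continuousAt_extChartAt_symm'' (I := 𝓡 n) (coord_fst_mem_target hz)).tendsto.comp
      (continuous_fst.continuousAt.tendsto.comp hlim)
    rw [symm_coord_fst hz] at this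
    refine this.congr' ?_
    filter_upwards [hmem] with w hw
    exact symm_coord_fst hw
  rw [nhds_induced, ← Filter.tendsto_iff_comap]
  refine hbase.prodMk_nhds (tendsto_pi_nhds.2 fun j => ?_)
  let e := trivializationAt (Euc n) (TangentSpace (𝓡 n) : M → Type _) x₀
  have hsrc : ∀ w ∈ frameDom (n := n) x₀, w.vec (EuclideanSpace.single j (1 : ℝ)) ∈ e.source := by
    intro w hw
    rw [Trivialization.mem_source]
    have : w.base ∈ (extChartAt (𝓡 n) x₀).source := hw
    rwa [extChartAt_source] at this
  have h1 : ContinuousAt e.toOpenPartialHomeomorph.symm (z.base, (coord x₀ z).2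
      (EuclideanSpace.single j (1 : ℝ))) := by
    rw [← trivializationAt_vec hz]
    exact e.toOpenPartialHomeomorph.continuousAt_symm
      (e.toOpenPartialHomeomorph.map_source (hsrc z hz))
  have h2 : Filter.Tendsto (fun w : OrthonormalFrame n M =>
      (w.base, (coord x₀ w).2 (EuclideanSpace.single j (1 : ℝ))))
      (Filter.comap (coord x₀) (𝓝 (coord x₀ z)) ⊓ Filter.principal (frameDom x₀))
      (𝓝 (z.base, (coord x₀ z).2 (EuclideanSpace.single j (1 : ℝ)))) := by
    refine hbase.prodMk_nhds ?_
    have hc : Continuous fun p : Amb n => p.2 (EuclideanSpace.single j (1 : ℝ)) := by fun_prop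
    exact (hc.tendsto _).comp hlim
  have h3 := h1.tendsto.comp h2
  rw [← trivializationAt_vec hz] at h3
  have h4 : ∀ w ∈ frameDom (n := n) x₀, e.toOpenPartialHomeomorph.symm
      (e (w.vec (EuclideanSpace.single j (1 : ℝ)))) = w.vec (EuclideanSpace.single j (1 : ℝ)) :=
    fun w hw => e.toOpenPartialHomeomorph.left_inv (hsrc w hw)
  have h5 := h4 z hz
  change Filter.Tendsto _ _ (𝓝 (e.toOpenPartialHomeomorph.symm (e _))) at h3
  rw [h5] at h3
  refine h3.congr' ?_
  filter_upwards [hmem] with w hw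
  rw [← h4 w hw]
  simp only [Function.comp_apply]
  rw [← trivializationAt_vec hw]

/-- Continuity of maps to the frame bundle can be checked in coordinates. -/
theorem tendsto_of_tendsto_coord {X : Type*} {l : Filter X} {ψ : X → OrthonormalFrame n M}
    {x₀ : M} {z : OrthonormalFrame n M} (hz : z ∈ frameDom x₀)
    (h1 : ∀ᶠ u in l, ψ u ∈ frameDom x₀)
    (h2 : Filter.Tendsto (fun u => coord x₀ (ψ u)) l (𝓝 (coord x₀ z))) :
    Filter.Tendsto ψ l (𝓝 z) := by
  rw [nhds_eq_comap_coord hz, Filter.tendsto_inf, Filter.tendsto_comap_iff,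
    Filter.tendsto_principal]
  exact ⟨h2, h1⟩

instance [T2Space M] : T2Space (OrthonormalFrame n M) := by
  refine t2Space_iff_disjoint_nhds.2 fun z w h => ?_
  by_cases hb : z.base = w.base
  · have hz := mem_frameDom_self z
    have hw : w ∈ frameDom z.base := by rw [hb]; exact mem_frameDom_self w
    have hne : coord z.base z ≠ coord z.base w := fun h' => h (coord_injOn _ hz hw h')
    exact (continuousAt_coord hz).tendsto.disjoint (disjoint_nhds_nhds.2 hne)
      (continuousAt_coord hw).tendsto
  · exact continuous_base.continuousAt.tendsto.disjoint (disjoint_nhds_nhds.2 hb)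
      continuous_base.continuousAt.tendsto

end FrameCoordinates

/-! ### The solder form and the connection form in coordinates, and their invariance -/

section SasakiForm

variable {n : ℕ}

/-- The space in which the solder form and the connection form take their values. -/
abbrev SasakiSpace (n : ℕ) : Type := EuclideanSpace ℝ (Fin n ⊕ Fin n × Fin n)

/-- The `i`-th vector of the standard basis of `ℝⁿ`. -/
abbrev stdVec {k : ℕ} (i : Fin k) : Euc k := EuclideanSpace.single i (1 : ℝ)

/-- Bilinear forms on `ℝⁿ`. -/
abbrev BilForm (n : ℕ) : Type := Euc n →L[ℝ] Euc n →L[ℝ] ℝ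

/-- A shortcut instance. -/
@[reducible] def normedAddCommGroupDual (n : ℕ) : NormedAddCommGroup (Euc n →L[ℝ] ℝ) :=
  ContinuousLinearMap.toNormedAddCommGroup

/-- A shortcut instance. -/
@[reducible] def normedSpaceDual (n : ℕ) : NormedSpace ℝ (Euc n →L[ℝ] ℝ) :=
  ContinuousLinearMap.toNormedSpace

/-- A shortcut instance. -/
@[reducible] def normedAddCommGroupBilForm (n : ℕ) : NormedAddCommGroup (BilForm n) :=
  ContinuousLinearMap.toNormedAddCommGroup

/-- A shortcut instance. -/
@[reducible] def normedSpaceBilForm (n : ℕ) : NormedSpace ℝ (BilForm n) :=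
  ContinuousLinearMap.toNormedSpace

attribute [local instance] normedAddCommGroupDual normedSpaceDual normedAddCommGroupBilForm
  normedSpaceBilForm

/-- The Christoffel symbol of the first kind of the metric `g`. -/
def christoffelForm (g : Euc n → BilForm n) (y a b c : Euc n) : ℝ :=
  (fderiv ℝ g y a b c + fderiv ℝ g y b a c - fderiv ℝ g y c a b) / 2

/-- The solder form and the connection form in coordinates. -/
def sasakiForm (g : Euc n → BilForm n) (p : Amb n) : Amb n →L[ℝ] SasakiSpace n :=
  LinearMap.toContinuousLinearMap
    { toFun := fun D => WithLp.toLp 2 (Sum.elim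
        (fun i => g p.1 D.1 (p.2 (stdVec i)))
        (fun ij => g p.1 (D.2 (stdVec ij.2)) (p.2 (stdVec ij.1))
          + christoffelForm g p.1 D.1 (p.2 (stdVec ij.2)) (p.2 (stdVec ij.1))))
      map_add' := fun D D' => by
        ext i
        rcases i with i | ij
        · simp
        · simp [christoffelForm]; ring
      map_smul' := fun c D => by
        ext i
        rcases i with i | ij
        · simp
        · simp [christoffelForm]; ring }

theorem sasakiForm_inl (g : Euc n → BilForm n) (p D : Amb n) (i : Fin n) :
    sasakiForm g p D (Sum.inl i) = g p.1 D.1 (p.2 (stdVec i)) := rfl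

theorem sasakiForm_inr (g : Euc n → BilForm n) (p D : Amb n) (ij : Fin n × Fin n) :
    sasakiForm g p D (Sum.inr ij) = g p.1 (D.2 (stdVec ij.2)) (p.2 (stdVec ij.1))
          + christoffelForm g p.1 D.1 (p.2 (stdVec ij.2)) (p.2 (stdVec ij.1)) := rfl

/-- The lift to the space of linear maps of a map of coordinates. -/
def frameTrans (τ : Euc n → Euc n) (p : Amb n) : Amb n := (τ p.1, (fderiv ℝ τ p.1).comp p.2)

theorem contDiffAt_frameTrans {τ : Euc n → Euc n} {p : Amb n} (hτ : ContDiffAt ℝ ∞ τ p.1) :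
    ContDiffAt ℝ ∞ (frameTrans τ) p := by
  refine ContDiffAt.prodMk (hτ.comp p contDiffAt_fst) ?_
  exact ContDiffAt.clm_comp ((hτ.fderiv_right (m := ∞) (by simp)).comp p contDiffAt_fst)
    contDiffAt_snd

theorem fderiv_frameTrans {τ : Euc n → Euc n} {p : Amb n} (hτ : ContDiffAt ℝ ∞ τ p.1)
    (D : Amb n) :
    fderiv ℝ (frameTrans τ) p D =
      (fderiv ℝ τ p.1 D.1, (fderiv ℝ (fderiv ℝ τ) p.1 D.1).comp p.2 +
        (fderiv ℝ τ p.1).comp D.2) := by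
  have h1 : HasFDerivAt τ (fderiv ℝ τ p.1) p.1 := (hτ.differentiableAt (by simp)).hasFDerivAt
  have h2 : HasFDerivAt (fderiv ℝ τ) (fderiv ℝ (fderiv ℝ τ) p.1) p.1 :=
    ((hτ.fderiv_right (m := ∞) (by simp)).differentiableAt (by simp)).hasFDerivAt
  have h3 := HasFDerivAt.prodMk (h1.comp p hasFDerivAt_fst)
    ((h2.comp p hasFDerivAt_fst).clm_comp hasFDerivAt_snd)
  have h4 : HasFDerivAt (frameTrans τ) _ p := h3
  rw [h4.fderiv]
  ext v <;> simp [add_comm]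

/-- The transformation law of the Christoffel symbols. -/
theorem christoffelForm_map {g g' : Euc n → BilForm n} {y : Euc n} {τ : Euc n → Euc n}
    (hg : DifferentiableAt ℝ g y) (hg' : DifferentiableAt ℝ g' (τ y))
    (hs : ∀ a b, g' (τ y) a b = g' (τ y) b a) (hτ : ContDiffAt ℝ ∞ τ y)
    (hm : ∀ᶠ y' in 𝓝 y, ∀ a b, g' (τ y') (fderiv ℝ τ y' a) (fderiv ℝ τ y' b) = g y' a b)
    (a b c : Euc n) :
    christoffelForm g' (τ y) (fderiv ℝ τ y a) (fderiv ℝ τ y b) (fderiv ℝ τ y c) +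
      g' (τ y) (fderiv ℝ (fderiv ℝ τ) y a b) (fderiv ℝ τ y c) = christoffelForm g y a b c := by
  have hsym : ∀ a b, fderiv ℝ (fderiv ℝ τ) y a b = fderiv ℝ (fderiv ℝ τ) y b a := by
    have := ContDiffAt.isSymmSndFDerivAt hτ (by simp; norm_cast)
    exact fun a b => this a b
  -- The relation `hm` differentiated in the direction `a`.
  have key : ∀ a b c, fderiv ℝ g' (τ y) (fderiv ℝ τ y a) (fderiv ℝ τ y b)
      (fderiv ℝ τ y c) + g' (τ y) (fderiv ℝ (fderiv ℝ τ) y a b) (fderiv ℝ τ y c)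
      + g' (τ y) (fderiv ℝ (fderiv ℝ τ) y a c) (fderiv ℝ τ y b) = fderiv ℝ g y a b c := by
    intro a b c
    have h1 : HasFDerivAt τ (fderiv ℝ τ y) y := (hτ.differentiableAt (by simp)).hasFDerivAt
    have h2 : HasFDerivAt (fderiv ℝ τ) (fderiv ℝ (fderiv ℝ τ) y) y :=
      ((hτ.fderiv_right (m := ∞) (by simp)).differentiableAt (by simp)).hasFDerivAt
    have h3 := ((hg'.hasFDerivAt.comp y h1).clm_apply
      (h2.clm_apply (hasFDerivAt_const b y))).clm_apply (h2.clm_apply (hasFDerivAt_const c y))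
    have h4 : HasFDerivAt (fun y' => g y' b c) _ y :=
      ((hg.hasFDerivAt.clm_apply (hasFDerivAt_const b y)).clm_apply (hasFDerivAt_const c y))
    have h5 := h3.congr_of_eventuallyEq (f₁ := fun y' => g y' b c) (by
      filter_upwards [hm] with y' h
      exact (h b c).symm)
    have h6 := DFunLike.congr_fun (h5.unique h4) a
    simp at h6
    rw [hs (fderiv ℝ (fderiv ℝ τ) y a c)]
    linarith
  -- Koszul's alternating sum of the three permuted relations: by the symmetry of the second
  -- derivative, four of the six terms with $\tau''$ cancel and the other two coincide.
  have k1 := key a b c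
  have k2 := key b a c
  have k3 := key c a b
  rw [hsym b a] at k2
  rw [hsym c a, hsym c b] at k3
  unfold christoffelForm
  linarith

/-- The invariance of the Sasakian metric under local isometries. -/
theorem sasakiForm_map {g g' : Euc n → BilForm n} {p : Amb n} {τ : Euc n → Euc n}
    (hg : DifferentiableAt ℝ g p.1) (hg' : DifferentiableAt ℝ g' (τ p.1))
    (hs : ∀ a b, g' (τ p.1) a b = g' (τ p.1) b a) (hτ : ContDiffAt ℝ ∞ τ p.1)
    (hm : ∀ᶠ y' in 𝓝 p.1, ∀ a b, g' (τ y') (fderiv ℝ τ y' a) (fderiv ℝ τ y' b) = g y' a b) :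
    (sasakiForm g' (frameTrans τ p)).comp (fderiv ℝ (frameTrans τ) p) = sasakiForm g p := by
  have h0 := hm.self_of_nhds
  refine ContinuousLinearMap.ext fun D => ?_
  ext i
  rw [ContinuousLinearMap.comp_apply, fderiv_frameTrans hτ]
  rcases i with i | ij
  · rw [sasakiForm_inl, sasakiForm_inl]
    exact h0 _ _
  · rw [sasakiForm_inr, sasakiForm_inr]
    simp only [frameTrans, add_apply, ContinuousLinearMap.comp_apply, map_add]
    -- The second derivative of `τ` in the differential of the lift is exactly the inhomogeneous
    -- term in the transformation of the Christoffel symbols.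
    rw [h0, ← christoffelForm_map hg hg' hs hτ hm]
    ring

theorem contDiffAt_sasakiForm {g : Euc n → BilForm n} {U : Set (Euc n)} (hU : IsOpen U)
    (hg : ∀ y ∈ U, ContDiffAt ℝ ∞ g y) {p : Amb n} (hp : p.1 ∈ U) :
    ContDiffAt ℝ ∞ (sasakiForm g) p := by
  have key : ∀ D : Amb n, ContDiffOn ℝ ∞ (fun p => sasakiForm g p D) {p | p.1 ∈ U} := by
    intro D p hp
    refine ContDiffAt.contDiffWithinAt ?_
    have hp' : p.1 ∈ U := hp
    have hg1 : ContDiffAt ℝ ∞ (fun p : Amb n => g p.1) p := (hg _ hp').comp p contDiffAt_fst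
    have hg' : ContDiffAt ℝ ∞ (fun p : Amb n => fderiv ℝ g p.1) p :=
      ((hg _ hp').fderiv_right (m := ∞) (by simp)).comp p contDiffAt_fst
    have hA : ∀ v : Euc n, ContDiffAt ℝ ∞ (fun p : Amb n => p.2 v) p := fun v =>
      contDiffAt_snd.clm_apply contDiffAt_const
    rw [contDiffAt_piLp]
    rintro (i | ij)
    · simp only [sasakiForm_inl]
      exact (hg1.clm_apply contDiffAt_const).clm_apply (hA _)
    · simp only [sasakiForm_inr, christoffelForm]
      refine ContDiffAt.add ((hg1.clm_apply contDiffAt_const).clm_apply (hA _))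
        (ContDiffAt.div_const (ContDiffAt.sub (ContDiffAt.add ?_ ?_) ?_) _)
      · exact ((hg'.clm_apply contDiffAt_const).clm_apply (hA _)).clm_apply (hA _)
      · exact ((hg'.clm_apply (hA _)).clm_apply contDiffAt_const).clm_apply (hA _)
      · exact ((hg'.clm_apply (hA _)).clm_apply contDiffAt_const).clm_apply (hA _)
  have ho : IsOpen {p : Amb n | p.1 ∈ U} := hU.preimage continuous_fst
  exact (contDiffOn_clm_apply.2 key).contDiffAt (ho.mem_nhds hp)

/-- The solder form determines `D.1` because `g` is nondegenerate and the vectors of the frame span.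
Once `D.1 = 0`, the Christoffel term vanishes, and the connection form determines `D.2` for the same
reason. This is what makes the two forms a parallelism on the frame bundle. -/
theorem sasakiForm_injective {g : Euc n → BilForm n} {p : Amb n}
    (hg : ∀ v, (∀ w, g p.1 v w = 0) → v = 0)
    (hA : Function.Surjective p.2) : Function.Injective (sasakiForm g p) := by
  have hbasis : ∀ (l : Euc n →L[ℝ] ℝ), (∀ i, l (p.2 (stdVec i)) = 0) → ∀ w, l w = 0 := by
    intro l hl w
    obtain ⟨v, rfl⟩ := hA w
    have : (l.comp p.2).toLinearMap = 0 :=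
      (EuclideanSpace.basisFun (Fin n) ℝ).toBasis.ext fun i => by simpa using hl i
    exact DFunLike.congr_fun this v
  refine (injective_iff_map_eq_zero (sasakiForm g p)).2 fun D hD => ?_
  have h1 : D.1 = 0 := hg _ (hbasis (g p.1 D.1) fun i => by
    have := congrArg (fun w : SasakiSpace n => w (Sum.inl i)) hD
    simpa [sasakiForm_inl] using this)
  refine Prod.ext h1 ?_
  have h2 : D.2.toLinearMap = 0 := by
    refine (EuclideanSpace.basisFun (Fin n) ℝ).toBasis.ext fun j => ?_
    refine hg _ (hbasis _ fun i => ?_)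
    have := congrArg (fun w : SasakiSpace n => w (Sum.inr (i, j))) hD
    simpa [sasakiForm_inr, h1, christoffelForm] using this
  ext1 v
  exact DFunLike.congr_fun h2 v

/-- On tangent vectors of the manifold of orthonormal frames the connection form is skew. -/
theorem sasakiForm_skew {X : Type*} [NormedAddCommGroup X] [NormedSpace ℝ X]
    {g : Euc n → BilForm n} {c : X → Amb n} {u : X} (hg : DifferentiableAt ℝ g (c u).1)
    (hgs : ∀ᶠ y in 𝓝 (c u).1, ∀ a b, g y a b = g y b a) (hc : DifferentiableAt ℝ c u)
    (h : ∀ᶠ u' in 𝓝 u, ∀ v w, g (c u').1 ((c u').2 v) ((c u').2 w) = inner ℝ v w) (v : X)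
    (i j : Fin n) :
    sasakiForm g (c u) (fderiv ℝ c u v) (Sum.inr (i, j)) =
      -sasakiForm g (c u) (fderiv ℝ c u v) (Sum.inr (j, i)) := by
  have hs := hgs.self_of_nhds
  have hs' : ∀ a b d, fderiv ℝ g (c u).1 a b d = fderiv ℝ g (c u).1 a d b := by
    intro a b d
    have h4 : HasFDerivAt (fun y' => g y' b d) _ (c u).1 :=
      ((hg.hasFDerivAt.clm_apply (hasFDerivAt_const b _)).clm_apply (hasFDerivAt_const d _))
    have h5 : HasFDerivAt (fun y' => g y' d b) _ (c u).1 :=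
      ((hg.hasFDerivAt.clm_apply (hasFDerivAt_const d _)).clm_apply (hasFDerivAt_const b _))
    have h6 := h4.congr_of_eventuallyEq (f₁ := fun y' => g y' d b) (by
      filter_upwards [hgs] with y hy using hy d b)
    have := DFunLike.congr_fun (h6.unique h5) a
    simpa using this
  have h1 : HasFDerivAt (fun u' => (c u').1) ((ContinuousLinearMap.fst ℝ _ _).comp (fderiv ℝ c u))
    u := hc.hasFDerivAt.fst
  have h2 : HasFDerivAt (fun u' => (c u').2) ((ContinuousLinearMap.snd ℝ _ _).comp (fderiv ℝ c u))
    u := hc.hasFDerivAt.snd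
  -- The orthonormality relation `h` differentiated along `v`. The Christoffel terms for $(i,j)$ and
  -- $(j,i)$ add up to the derivative of the metric, that is, the connection is metric.
  have h3 := ((hg.hasFDerivAt.comp u h1).clm_apply (h2.clm_apply
    (hasFDerivAt_const (stdVec i) u))).clm_apply (h2.clm_apply (hasFDerivAt_const (stdVec j) u))
  have h4 := h3.congr_of_eventuallyEq
    (f₁ := fun _ => inner ℝ (stdVec i : Euc n) (stdVec j)) (by
      filter_upwards [h] with u' h
      exact (h _ _).symm)
  have h5 := DFunLike.congr_fun (h4.unique (hasFDerivAt_const _ u)) v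
  simp at h5
  rw [sasakiForm_inr, sasakiForm_inr]
  simp only [christoffelForm]
  have e1 := hs' (fderiv ℝ c u v).1 ((c u).2 (stdVec j)) ((c u).2 (stdVec i))
  have e2 := hs' ((c u).2 (stdVec j)) (fderiv ℝ c u v).1 ((c u).2 (stdVec i))
  have e3 := hs' ((c u).2 (stdVec i)) (fderiv ℝ c u v).1 ((c u).2 (stdVec j))
  have e4 := hs ((c u).2 (stdVec i)) ((fderiv ℝ c u v).2 (stdVec j))
  linarith

end SasakiForm

section Christoffel

attribute [local instance] normedAddCommGroupDual normedSpaceDual normedAddCommGroupBilForm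
  normedSpaceBilForm

variable {n : ℕ} {M : Type*} [TopologicalSpace M] [ChartedSpace (Euc n) M]
  [RiemannianBundle (fun x : M => TangentSpace (𝓡 n) x)] [IsManifold (𝓡 n) ∞ M]
  [IsContMDiffRiemannianBundle (𝓡 n) ∞ (Euc n) (fun x : M => TangentSpace (𝓡 n) x)]

theorem christoffel_eq' {x₀ : M} {y : Euc n} (hy : y ∈ (extChartAt (𝓡 n) x₀).target)
    (a b c : Euc n) : christoffel x₀ y a b c = christoffelForm (metricForm x₀) y a b c := by
  have key : ∀ a b c : Euc n, fderiv ℝ (fun y' => chartMetric x₀ y' b c) y a =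
      fderiv ℝ (metricForm x₀) y a b c := by
    intro a b c
    have h0 : HasFDerivAt (metricForm x₀) (fderiv ℝ (metricForm x₀) y) y :=
      ((contDiffAt_metricForm hy).differentiableAt (by simp)).hasFDerivAt
    have h1 : HasFDerivAt (fun y' => metricForm x₀ y' b c) _ y :=
      ((h0.clm_apply (hasFDerivAt_const b y)).clm_apply (hasFDerivAt_const c y))
    have h2 := h1.fderiv
    simp only [metricForm_apply] at h2
    rw [h2]
    simp
  rw [christoffel, christoffelForm, key, key, key]

end Christoffel

/-! ### Smooth families of frames and their derivatives -/

section SmoothFrames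

variable {n : ℕ} {M : Type*} [TopologicalSpace M] [ChartedSpace (Euc n) M]
  [RiemannianBundle (fun x : M => TangentSpace (𝓡 n) x)] [IsManifold (𝓡 n) ∞ M]

/-- A smooth map of `M` that preserves the metric. -/
structure IsIsometricMap (h : M → M) : Prop where
  contMDiff : ContMDiff (𝓡 n) (𝓡 n) ∞ h
  inner_mfderiv : ∀ (x : M) (v w : TangentSpace (𝓡 n) x),
    inner ℝ (mfderiv (𝓡 n) (𝓡 n) h x v : TangentSpace (𝓡 n) (h x))
      (mfderiv (𝓡 n) (𝓡 n) h x w : TangentSpace (𝓡 n) (h x)) = inner ℝ v w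

theorem isIsometricMap_id : IsIsometricMap (n := n) (id : M → M) :=
  ⟨contMDiff_id, fun x v w => by rw [mfderiv_id]; rfl⟩

theorem isIsometricMap_smul {G : Type*} [Group G] [MulAction G M] [IsometricAction n M G] (g : G) :
    IsIsometricMap (n := n) (fun x : M => g • x) :=
  ⟨IsometricAction.contMDiff_smul g,
    fun x v w => (differential g x).inner_map_map v w⟩

/-- The expression of a map of `M` in charts. -/
def chartMap (x₀ x₁ : M) (h : M → M) (y : Euc n) : Euc n :=
  extChartAt (𝓡 n) x₁ (h ((extChartAt (𝓡 n) x₀).symm y))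

theorem contDiffAt_chartMap_param {X : Type*} [NormedAddCommGroup X] [NormedSpace ℝ X]
    {f : X × M → M} {x₀ x₁ x : M} {u : X}
    (hf : ContMDiffAt (𝓘(ℝ, X).prod (𝓡 n)) (𝓡 n) ∞ f (u, x))
    (hx : x ∈ (extChartAt (𝓡 n) x₀).source) (hx' : f (u, x) ∈ (extChartAt (𝓡 n) x₁).source) :
    ContDiffAt ℝ ∞ (fun q : X × Euc n => extChartAt (𝓡 n) x₁ (f (q.1,
      (extChartAt (𝓡 n) x₀).symm q.2))) (u, extChartAt (𝓡 n) x₀ x) := by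
  rw [← contMDiffAt_iff_contDiffAt]
  have hl := (extChartAt (𝓡 n) x₀).left_inv hx
  have h1 : ContMDiffAt 𝓘(ℝ, Euc n) (𝓡 n) ∞ (extChartAt (𝓡 n) x₀).symm
      (extChartAt (𝓡 n) x₀ x) :=
    (contMDiffOn_extChartAt_symm x₀).contMDiffAt
      ((isOpen_target x₀).mem_nhds ((extChartAt (𝓡 n) x₀).map_source hx))
  have h2 : ContMDiffAt 𝓘(ℝ, X × Euc n) (𝓘(ℝ, X).prod (𝓡 n)) ∞
      (fun q : X × Euc n => (q.1, (extChartAt (𝓡 n) x₀).symm q.2))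
      (u, extChartAt (𝓡 n) x₀ x) := by
    refine ContMDiffAt.prodMk ?_ ?_
    · exact contMDiffAt_iff_contDiffAt.2 contDiffAt_fst
    · exact ContMDiffAt.comp (I' := 𝓘(ℝ, Euc n)) _ h1 (contMDiffAt_iff_contDiffAt.2 contDiffAt_snd)
  have hf' : ContMDiffAt (𝓘(ℝ, X).prod (𝓡 n)) (𝓡 n) ∞ f
      (u, (extChartAt (𝓡 n) x₀).symm (extChartAt (𝓡 n) x₀ x)) := by rwa [hl]
  have h3 : ContMDiffAt (𝓡 n) 𝓘(ℝ, Euc n) ∞ (extChartAt (𝓡 n) x₁)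
      (f (u, (extChartAt (𝓡 n) x₀).symm (extChartAt (𝓡 n) x₀ x))) := by
    rw [hl]
    exact contMDiffAt_extChartAt' (by rwa [extChartAt_source] at hx')
  exact ContMDiffAt.comp (I' := 𝓡 n) (g := extChartAt (𝓡 n) x₁)
    (f := fun q : X × Euc n => f (q.1, (extChartAt (𝓡 n) x₀).symm q.2)) _ h3
    (ContMDiffAt.comp (I' := 𝓘(ℝ, X).prod (𝓡 n)) (g := f)
      (f := fun q : X × Euc n => (q.1, (extChartAt (𝓡 n) x₀).symm q.2)) _ hf' h2)

theorem contDiffAt_chartMap {h : M → M} {x₀ x₁ x : M} (hh : ContMDiffAt (𝓡 n) (𝓡 n) ∞ h x)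
    (hx : x ∈ (extChartAt (𝓡 n) x₀).source) (hx' : h x ∈ (extChartAt (𝓡 n) x₁).source) :
    ContDiffAt ℝ ∞ (chartMap x₀ x₁ h) (extChartAt (𝓡 n) x₀ x) := by
  -- A dummy real parameter reduces this to `contDiffAt_chartMap_param`.
  have h1 : ContMDiffAt (𝓘(ℝ, ℝ).prod (𝓡 n)) (𝓡 n) ∞ (fun q : ℝ × M => h q.2) ((0 : ℝ), x) :=
    ContMDiffAt.comp (g := h) (f := Prod.snd) _ hh contMDiffAt_snd
  exact (contDiffAt_chartMap_param h1 hx hx').comp (f := fun y : Euc n => ((0 : ℝ), y)) _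
    (contDiffAt_const.prodMk contDiffAt_id)

theorem metricForm_chartMap {h : M → M} (hh : IsIsometricMap (n := n) h) {x₀ x₁ : M} {y : Euc n}
    (hy : y ∈ (extChartAt (𝓡 n) x₀).target)
    (hx' : h ((extChartAt (𝓡 n) x₀).symm y) ∈ (extChartAt (𝓡 n) x₁).source) (a b : Euc n) :
    metricForm x₁ (chartMap x₀ x₁ h y) (fderiv ℝ (chartMap x₀ x₁ h) y a)
      (fderiv ℝ (chartMap x₀ x₁ h) y b) = metricForm x₀ y a b := by
  obtain ⟨x, hx, rfl⟩ : ∃ x ∈ (extChartAt (𝓡 n) x₀).source, extChartAt (𝓡 n) x₀ x = y :=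
    ⟨_, (extChartAt (𝓡 n) x₀).map_target hy, (extChartAt (𝓡 n) x₀).right_inv hy⟩
  rw [(extChartAt (𝓡 n) x₀).left_inv hx] at hx'
  have : FiniteDimensional ℝ (TangentSpace (𝓡 n) x) :=
    inferInstanceAs (FiniteDimensional ℝ (Euc n))
  have hsurj : Function.Surjective (chartDeriv (n := n) x₀ x) :=
    LinearMap.injective_iff_surjective_of_finrank_eq_finrank
      (f := (chartDeriv (n := n) x₀ x).toLinearMap) rfl |>.1 (chartDeriv_injective hx)
  obtain ⟨v, rfl⟩ := hsurj a
  obtain ⟨w, rfl⟩ := hsurj b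
  have hd : MDifferentiableAt (𝓡 n) (𝓡 n) h x := hh.contMDiff.mdifferentiable (by simp) x
  have e1 := chartDeriv_mfderiv hd hx hx' v
  have e2 := chartDeriv_mfderiv hd hx hx' w
  unfold chartMap
  rw [(extChartAt (𝓡 n) x₀).left_inv hx, ← e1, ← e2, inner_eq_metricForm hx', inner_eq_metricForm hx,
    hh.inner_mfderiv]

/-- Covers both changes of charts (`h = id`) and the action of a group element, so that independence
of the chart and invariance under $G$ have a common proof. -/
theorem coord_map {h : M → M} (hh : ContMDiff (𝓡 n) (𝓡 n) ∞ h) {x₀ x₁ : M}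
    {z z' : OrthonormalFrame n M} (hz : z ∈ frameDom x₀) (hz' : z' ∈ frameDom x₁)
    (hb : z'.base = h z.base) (hv : ∀ v, z'.vec v = tangentMap (𝓡 n) (𝓡 n) h (z.vec v)) :
    coord x₁ z' = frameTrans (chartMap x₀ x₁ h) (coord x₀ z) := by
  obtain ⟨x, f⟩ := z
  obtain ⟨x', f'⟩ := z'
  obtain rfl : x' = h x := hb
  have hx : x ∈ (extChartAt (𝓡 n) x₀).source := hz
  refine Prod.ext ?_ ?_
  · simp only [coord_fst, frameTrans, chartMap, (extChartAt (𝓡 n) x₀).left_inv hx]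
  · ext1 v
    have hfv : f' v = mfderiv (𝓡 n) (𝓡 n) h x (f v) := by
      exact eq_of_heq (TotalSpace.mk.inj (hv v)).2
    rw [coord_snd_apply]
    change chartDeriv x₁ (h x) (f' v) = _
    rw [hfv, chartDeriv_mfderiv (hh.mdifferentiable (by simp) x) hx hz' (f v)]
    rfl

theorem coord_trans {x₀ x₁ : M} {z : OrthonormalFrame n M} (hz : z ∈ frameDom x₀)
    (hz' : z ∈ frameDom x₁) : coord x₁ z = frameTrans (chartMap x₀ x₁ id) (coord x₀ z) :=
  coord_map contMDiff_id hz hz' rfl fun v => by rw [tangentMap_id]; rfl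

theorem coord_smul {G : Type*} [Group G] [MulAction G M] [IsometricAction n M G] (g : G)
    {x₀ x₁ : M} {z : OrthonormalFrame n M} (hz : z ∈ frameDom x₀) (hz' : g • z ∈ frameDom x₁) :
    coord x₁ (g • z) = frameTrans (chartMap x₀ x₁ (fun x => g • x)) (coord x₀ z) :=
  coord_map (IsometricAction.contMDiff_smul g) hz hz' rfl fun v => smul_vec g z v

theorem coord_orth_smul (k : OrthGroup n) (x₀ : M) (z : OrthonormalFrame n M) :
    coord x₀ (k • z) = ((coord x₀ z).1, (coord x₀ z).2.comp ((k⁻¹ : OrthGroup n) : Euc n →L[ℝ] Euc n)) :=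
  rfl

theorem contDiffAt_frameTrans_coord {h : M → M} (hh : ContMDiff (𝓡 n) (𝓡 n) ∞ h) {x₀ x₁ : M}
    {z : OrthonormalFrame n M} (hz : z ∈ frameDom x₀)
    (hz' : h z.base ∈ (extChartAt (𝓡 n) x₁).source) :
    ContDiffAt ℝ ∞ (frameTrans (chartMap x₀ x₁ h)) (coord x₀ z) :=
  contDiffAt_frameTrans (contDiffAt_chartMap hh.contMDiffAt hz hz')

variable {X : Type*} [NormedAddCommGroup X] [NormedSpace ℝ X]

/-- Smoothness of a map to the frame bundle. -/
def SmoothFrameAt (ψ : X → OrthonormalFrame n M) (u : X) : Prop :=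
  ContinuousAt ψ u ∧ ContDiffAt ℝ ∞ (fun u' => coord (ψ u).base (ψ u')) u

theorem contDiffAt_coord_change {ψ : X → OrthonormalFrame n M} {u : X} {x₀ x₁ : M}
    (hc : ContinuousAt ψ u) (h0 : ψ u ∈ frameDom x₀) (h1 : ψ u ∈ frameDom x₁)
    (h : ContDiffAt ℝ ∞ (fun u' => coord x₀ (ψ u')) u) :
    ContDiffAt ℝ ∞ (fun u' => coord x₁ (ψ u')) u := by
  have := (contDiffAt_frameTrans_coord contMDiff_id h0 h1).comp u h
  refine this.congr_of_eventuallyEq ?_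
  filter_upwards [hc (frameDom_mem_nhds h0), hc (frameDom_mem_nhds h1)] with u' h0' h1'
  exact coord_trans h0' h1'

theorem SmoothFrameAt.coord {ψ : X → OrthonormalFrame n M} {u : X} (h : SmoothFrameAt ψ u) {x₀ : M}
    (h0 : ψ u ∈ frameDom x₀) : ContDiffAt ℝ ∞ (fun u' => coord x₀ (ψ u')) u :=
  contDiffAt_coord_change h.1 (mem_frameDom_self _) h0 h.2

theorem smoothFrameAt_of_coord {ψ : X → OrthonormalFrame n M} {u : X} {x₀ : M}
    (hd : ∀ᶠ u' in 𝓝 u, ψ u' ∈ frameDom x₀)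
    (h : ContDiffAt ℝ ∞ (fun u' => coord x₀ (ψ u')) u) : SmoothFrameAt ψ u := by
  have h0 := hd.self_of_nhds
  have hc : ContinuousAt ψ u := tendsto_of_tendsto_coord h0 hd h.continuousAt
  exact ⟨hc, contDiffAt_coord_change hc h0 (mem_frameDom_self _) h⟩

theorem SmoothFrameAt.comp {Y : Type*} [NormedAddCommGroup Y] [NormedSpace ℝ Y]
    {ψ : X → OrthonormalFrame n M} {θ : Y → X} {y : Y} (h : SmoothFrameAt ψ (θ y))
    (hθ : ContDiffAt ℝ ∞ θ y) : SmoothFrameAt (fun y' => ψ (θ y')) y :=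
  ⟨ContinuousAt.comp (g := ψ) h.1 hθ.continuousAt,
    ContDiffAt.comp (g := fun u' => OrthonormalFrame.coord (ψ (θ y)).base (ψ u')) y h.2 hθ⟩

variable [IsContMDiffRiemannianBundle (𝓡 n) ∞ (Euc n) (fun x : M => TangentSpace (𝓡 n) x)]

theorem sasakiForm_frameTrans {h : M → M} (hh : IsIsometricMap (n := n) h) {x₀ x₁ : M}
    {z : OrthonormalFrame n M} (hz : z ∈ frameDom x₀)
    (hz' : h z.base ∈ (extChartAt (𝓡 n) x₁).source) :
    (sasakiForm (metricForm x₁) (frameTrans (chartMap x₀ x₁ h) (coord x₀ z))).comp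
      (fderiv ℝ (frameTrans (chartMap x₀ x₁ h)) (coord x₀ z)) =
    sasakiForm (metricForm x₀) (coord x₀ z) := by
  have hx : z.base ∈ (extChartAt (𝓡 n) x₀).source := hz
  have ht := coord_fst_mem_target hz
  have hl := symm_coord_fst hz
  have hτ : chartMap x₀ x₁ h (coord x₀ z).1 = extChartAt (𝓡 n) x₁ (h z.base) := by
    rw [chartMap, hl]
  refine sasakiForm_map ((contDiffAt_metricForm ht).differentiableAt (by simp)) ?_
    (fun a b => metricForm_comm _ _ _ _) (contDiffAt_chartMap hh.contMDiff.contMDiffAt hz hz') ?_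
  · rw [hτ]
    exact (contDiffAt_metricForm ((extChartAt (𝓡 n) x₁).map_source hz')).differentiableAt (by simp)
  · have hc : ContinuousAt (fun y => h ((extChartAt (𝓡 n) x₀).symm y)) (coord x₀ z).1 :=
      ContinuousAt.comp hh.contMDiff.continuous.continuousAt (continuousAt_extChartAt_symm'' ht)
    have hn : (extChartAt (𝓡 n) x₁).source ∈ 𝓝 (h ((extChartAt (𝓡 n) x₀).symm (coord x₀ z).1)) := by
      rw [hl]
      exact extChartAt_source_mem_nhds' hz'
    filter_upwards [(isOpen_target x₀).mem_nhds ht, hc hn] with y hy hy' a b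
    exact metricForm_chartMap hh hy hy' a b

/-- The differential of a map to the frame bundle, represented by the values of the solder form
and the connection form. -/
def sasakiDeriv (ψ : X → OrthonormalFrame n M) (u : X) : X →L[ℝ] SasakiSpace n :=
  (sasakiForm (metricForm (ψ u).base) (coord (ψ u).base (ψ u))).comp
    (fderiv ℝ (fun u' => coord (ψ u).base (ψ u')) u)

theorem sasakiVec_eq {k : ℕ} (ψ : Euc k → OrthonormalFrame n M) (u v : Euc k) :
    sasakiVec ψ u v = sasakiDeriv ψ u v := by
  ext i
  rcases i with i | ij
  · rfl
  · have := christoffel_eq' (n := n) (x₀ := (ψ u).base) (coord_fst_mem_target (mem_frameDom_self (ψ u)))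
    simp only [sasakiVec, sasakiDeriv, ContinuousLinearMap.comp_apply, sasakiForm_inr, ← this]
    rfl

/-- A change of charts is a local isometry of the metrics in coordinates, so the forms do not depend
on the chart in which they are computed. A fixed chart can then be used near `u`, whereas the
definition changes it with the base point. -/
theorem sasakiDeriv_eq {ψ : X → OrthonormalFrame n M} {u : X} (h : SmoothFrameAt ψ u) {x₀ : M}
    (h0 : ψ u ∈ frameDom x₀) :
    sasakiDeriv ψ u = (sasakiForm (metricForm x₀) (coord x₀ (ψ u))).comp
      (fderiv ℝ (fun u' => coord x₀ (ψ u')) u) := by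
  have h1 := mem_frameDom_self (ψ u)
  have he : (fun u' => coord (ψ u).base (ψ u')) =ᶠ[𝓝 u]
      (frameTrans (chartMap x₀ (ψ u).base id)) ∘ (fun u' => coord x₀ (ψ u')) := by
    filter_upwards [h.1 (frameDom_mem_nhds h0), h.1 (frameDom_mem_nhds h1)] with u' h0' h1'
    exact coord_trans h0' h1'
  have hd := (contDiffAt_frameTrans_coord contMDiff_id h0 h1).differentiableAt (by simp)
  rw [sasakiDeriv, he.fderiv_eq, fderiv_comp u hd ((h.coord h0).differentiableAt (by simp)),
    ← ContinuousLinearMap.comp_assoc, coord_trans h0 h1, sasakiForm_frameTrans isIsometricMap_id h0 h1]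

theorem sasakiDeriv_comp {Y : Type*} [NormedAddCommGroup Y] [NormedSpace ℝ Y]
    {ψ : X → OrthonormalFrame n M} {θ : Y → X} {y : Y} (h : SmoothFrameAt ψ (θ y))
    (hθ : DifferentiableAt ℝ θ y) :
    sasakiDeriv (fun y' => ψ (θ y')) y = (sasakiDeriv ψ (θ y)).comp (fderiv ℝ θ y) := by
  rw [sasakiDeriv, sasakiDeriv, ContinuousLinearMap.comp_assoc]
  congr 1
  exact fderiv_comp (g := fun u' => coord (ψ (θ y)).base (ψ u')) y
    (h.2.differentiableAt (by simp)) hθ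

theorem sasakiDeriv_congr {ψ ψ' : X → OrthonormalFrame n M} {u : X} (he : ψ' =ᶠ[𝓝 u] ψ) :
    sasakiDeriv ψ' u = sasakiDeriv ψ u := by
  rw [sasakiDeriv, sasakiDeriv, he.self_of_nhds]
  congr 1
  exact Filter.EventuallyEq.fderiv_eq (by filter_upwards [he] with u' hu'; rw [hu'])

theorem continuousAt_smul_frame {G : Type*} [Group G] [MulAction G M] [IsometricAction n M G] (g : G)
    (z : OrthonormalFrame n M) : ContinuousAt (fun z : OrthonormalFrame n M => g • z) z := by
  have h0 := mem_frameDom_self z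
  have h1 := mem_frameDom_self (g • z)
  have hc : ∀ᶠ w in 𝓝 z, g • w ∈ frameDom (g • z).base := by
    have : ContinuousAt (fun w : OrthonormalFrame n M => g • w.base) z :=
      (IsometricAction.contMDiff_smul (n := n) g).continuous.continuousAt.comp
        continuous_base.continuousAt
    exact this (extChartAt_source_mem_nhds' h1)
  refine tendsto_of_tendsto_coord h1 hc ?_
  rw [coord_smul g h0 h1]
  refine ((contDiffAt_frameTrans_coord (IsometricAction.contMDiff_smul g) h0 h1).continuousAt.tendsto.comp
    (continuousAt_coord h0).tendsto).congr' ?_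
  filter_upwards [hc, frameDom_mem_nhds h0] with w hw hw'
  exact (coord_smul g hw' hw).symm

theorem SmoothFrameAt.smul {G : Type*} [Group G] [MulAction G M] [IsometricAction n M G] (g : G)
    {ψ : X → OrthonormalFrame n M} {u : X} (h : SmoothFrameAt ψ u) :
    SmoothFrameAt (fun u' => g • ψ u') u := by
  have h0 := mem_frameDom_self (ψ u)
  have h1 := mem_frameDom_self (g • ψ u)
  have hc : ContinuousAt (fun u' => g • ψ u') u := (continuousAt_smul_frame g (ψ u)).comp h.1
  refine ⟨hc, ?_⟩
  have := (contDiffAt_frameTrans_coord (IsometricAction.contMDiff_smul g) h0 h1).comp u (h.coord h0)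
  refine this.congr_of_eventuallyEq ?_
  filter_upwards [h.1 (frameDom_mem_nhds h0), hc (frameDom_mem_nhds h1)] with u' h0' h1'
  exact coord_smul g h0' h1'

/-- The lift of an isometry preserves the values of the solder and connection forms themselves, not
only lengths: $G$ acts by automorphisms of the parallelism. The rigidity of the action rests on
this. -/
theorem sasakiDeriv_smul {G : Type*} [Group G] [MulAction G M] [IsometricAction n M G] (g : G)
    {ψ : X → OrthonormalFrame n M} {u : X} (h : SmoothFrameAt ψ u) :
    sasakiDeriv (fun u' => g • ψ u') u = sasakiDeriv ψ u := by
  have h0 := mem_frameDom_self (ψ u)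
  have h1 := mem_frameDom_self (g • ψ u)
  have hc : ContinuousAt (fun u' => g • ψ u') u := (continuousAt_smul_frame g (ψ u)).comp h.1
  have he : (fun u' => coord (g • ψ u).base (g • ψ u')) =ᶠ[𝓝 u]
      (frameTrans (chartMap (ψ u).base (g • ψ u).base (fun x => g • x))) ∘
        (fun u' => coord (ψ u).base (ψ u')) := by
    filter_upwards [h.1 (frameDom_mem_nhds h0), hc (frameDom_mem_nhds h1)] with u' h0' h1'
    exact coord_smul g h0' h1'
  have hd := (contDiffAt_frameTrans_coord (IsometricAction.contMDiff_smul g) h0 h1).differentiableAt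
    (by simp)
  rw [sasakiDeriv, he.fderiv_eq, fderiv_comp u hd ((h.coord h0).differentiableAt (by simp)),
    ← ContinuousLinearMap.comp_assoc, coord_smul g h0 h1,
    sasakiForm_frameTrans (isIsometricMap_smul g) h0 h1]
  rfl

theorem sasakiForm_coord_injective {x₀ : M} {z : OrthonormalFrame n M} (hz : z ∈ frameDom x₀) :
    Function.Injective (sasakiForm (metricForm x₀) (coord x₀ z)) :=
  sasakiForm_injective (fun _ h => metricForm_nondeg (coord_fst_mem_target hz) h)
    (coord_snd_surjective hz)

theorem sasakiDeriv_eq_zero_iff {ψ : X → OrthonormalFrame n M} {u : X} (h : SmoothFrameAt ψ u)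
    {x₀ : M} (h0 : ψ u ∈ frameDom x₀) (v : X) :
    sasakiDeriv ψ u v = 0 ↔ fderiv ℝ (fun u' => coord x₀ (ψ u')) u v = 0 := by
  rw [sasakiDeriv_eq h h0, ContinuousLinearMap.comp_apply]
  exact map_eq_zero_iff _ (sasakiForm_coord_injective h0)

theorem sasakiDeriv_skew {ψ : X → OrthonormalFrame n M} {u : X} (h : SmoothFrameAt ψ u) (v : X)
    (i j : Fin n) :
    sasakiDeriv ψ u v (Sum.inr (i, j)) = -sasakiDeriv ψ u v (Sum.inr (j, i)) := by
  have h0 := mem_frameDom_self (ψ u)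
  refine sasakiForm_skew (c := fun u' => coord (ψ u).base (ψ u')) ?_ ?_
    (h.2.differentiableAt (by simp)) ?_ v i j
  · exact (contDiffAt_metricForm (coord_fst_mem_target h0)).differentiableAt (by simp)
  · exact Filter.Eventually.of_forall fun y a b => metricForm_comm _ _ _ _
  · filter_upwards [h.1 (frameDom_mem_nhds h0)] with u' hu' v w
    exact metricForm_coord hu' v w

end SmoothFrames

/-! ### The inverse function theorem and skew matrices -/

section InverseFunction

/-- The inverse function theorem, with smoothness on a whole neighbourhood. -/
theorem exists_localDiffeo {E F : Type*} [NormedAddCommGroup E] [NormedSpace ℝ E]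
    [FiniteDimensional ℝ E] [NormedAddCommGroup F] [NormedSpace ℝ F] [FiniteDimensional ℝ F]
    {f : E → F} {a : E} (hf : ∀ᶠ x in 𝓝 a, ContDiffAt ℝ ∞ f x)
    (hd : Module.finrank ℝ E = Module.finrank ℝ F) (hinj : Function.Injective (fderiv ℝ f a)) :
    ∃ e : OpenPartialHomeomorph E F, a ∈ e.source ∧ (∀ x, e x = f x) ∧
      (∀ x ∈ e.source, ContDiffAt ℝ ∞ f x) ∧ ∀ y ∈ e.target, ContDiffAt ℝ ∞ e.symm y := by
  have : CompleteSpace E := FiniteDimensional.complete ℝ E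
  let L : E ≃L[ℝ] F :=
    (LinearEquiv.ofInjectiveOfFinrankEq (fderiv ℝ f a).toLinearMap hinj hd).toContinuousLinearEquiv
  have hL : (L : E →L[ℝ] F) = fderiv ℝ f a := by ext v; rfl
  have hfa : ContDiffAt ℝ ∞ f a := hf.self_of_nhds
  have hda : HasFDerivAt f (L : E →L[ℝ] F) a := by
    rw [hL]; exact (hfa.differentiableAt (by simp)).hasFDerivAt
  let e₀ := hfa.toOpenPartialHomeomorph f hda (by simp)
  have hcont : ContinuousAt (fderiv ℝ f) a :=
    (hfa.fderiv_right (m := ∞) (by simp)).continuousAt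
  -- Invertibility of the derivative is an open condition; restricting the source to where it holds
  -- makes the inverse smooth on the whole target.
  have hinv : ∀ᶠ x in 𝓝 a, fderiv ℝ f x ∈ Set.range ((↑) : (E ≃L[ℝ] F) → E →L[ℝ] F) := by
    refine hcont ?_
    rw [← hL]
    exact ContinuousLinearEquiv.nhds L
  obtain ⟨s, hs, hso, has⟩ := eventually_nhds_iff.1 (hf.and hinv)
  refine ⟨e₀.restrOpen s hso, ⟨hfa.mem_toOpenPartialHomeomorph_source hda (by simp), has⟩,
    fun x => rfl, fun x hx => (hs x hx.2).1, fun y hy => ?_⟩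
  have hy' := (e₀.restrOpen s hso).map_target hy
  obtain ⟨h1, L', hL'⟩ := hs _ hy'.2
  refine OpenPartialHomeomorph.contDiffAt_symm (e₀.restrOpen s hso) (f₀' := L') hy ?_ h1
  rw [hL']
  exact (h1.differentiableAt (by simp)).hasFDerivAt

end InverseFunction

section Skew

variable {n : ℕ}

theorem card_lt_pairs : Fintype.card {p : Fin n × Fin n // p.1 < p.2} = n.choose 2 := by
  rw [Fintype.card_subtype, Finset.card_filter, Fintype.sum_prod_type_right]
  simp_rw [← Finset.card_filter]
  have : ∀ j : Fin n, (Finset.univ.filter fun i : Fin n => i < j).card = j := by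
    intro j
    rw [← Fin.card_Iio j]
    congr 1
    ext i
    simp
  simp_rw [this]
  rw [Fin.sum_univ_eq_sum_range (fun i => i) n, Finset.sum_range_id, Nat.choose_two_right]

/-- A numbering of the pairs `i < j`. -/
def pairEquiv (n : ℕ) : {p : Fin n × Fin n // p.1 < p.2} ≃ Fin (n.choose 2) :=
  Fintype.equivFinOfCardEq card_lt_pairs

/-- The skew matrix with the entries `s` above the diagonal. -/
def skewOf : Euc (n.choose 2) →ₗ[ℝ] (Fin n → Fin n → ℝ) where
  toFun s i j := if h : i < j then s (pairEquiv n ⟨(i, j), h⟩) else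
    if h : j < i then -s (pairEquiv n ⟨(j, i), h⟩) else 0
  map_add' s t := by
    ext i j
    simp only [Pi.add_apply]
    split_ifs <;> simp [add_comm]
  map_smul' c s := by
    ext i j
    simp only [Pi.smul_apply]
    split_ifs <;> simp

/-- The entries above the diagonal. -/
def upperOf : (Fin n → Fin n → ℝ) →ₗ[ℝ] Euc (n.choose 2) where
  toFun Q := WithLp.toLp 2 fun a => Q ((pairEquiv n).symm a).1.1 ((pairEquiv n).symm a).1.2
  map_add' Q R := by ext; simp
  map_smul' c Q := by ext; simp

theorem skewOf_skew (s : Euc (n.choose 2)) (i j : Fin n) : skewOf s i j = -skewOf s j i := by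
  simp only [skewOf, LinearMap.coe_mk, AddHom.coe_mk]
  rcases lt_trichotomy i j with h | h | h
  · simp [h, h.not_gt]
  · subst h; simp
  · simp [h, h.not_gt]

theorem upperOf_skewOf (s : Euc (n.choose 2)) : upperOf (skewOf s) = s := by
  ext a
  have h := ((pairEquiv n).symm a).2
  simp [upperOf, skewOf, h]

theorem skewOf_upperOf {Q : Fin n → Fin n → ℝ} (hQ : ∀ i j, Q i j = -Q j i) :
    skewOf (upperOf Q) = Q := by
  ext i j
  simp only [skewOf, upperOf, LinearMap.coe_mk, AddHom.coe_mk]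
  rcases lt_trichotomy i j with h | h | h
  · simp [h]
  · subst h
    have := hQ i i
    simp; linarith
  · simp [h, h.not_gt, hQ i j]

theorem upperOf_one : upperOf (fun i j : Fin n => inner ℝ (stdVec i : Euc n) (stdVec j)) = 0 := by
  ext a
  have h := ((pairEquiv n).symm a).2
  simp [upperOf, EuclideanSpace.inner_single_left, h.ne]

end Skew

/-! ### Local product parametrizations of the frame bundle -/

section ProductChart

variable {n : ℕ} {M : Type*} [TopologicalSpace M] [ChartedSpace (Euc n) M]
  [RiemannianBundle (fun x : M => TangentSpace (𝓡 n) x)] [IsManifold (𝓡 n) ∞ M]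

theorem SmoothAtIn.contDiffAt {X V : Type*} [NormedAddCommGroup X] [NormedSpace ℝ X]
    [NormedAddCommGroup V] [NormedSpace ℝ V] {f : OrthonormalFrame n M → V}
    {ψ : X → OrthonormalFrame n M} {u : X} (hf : SmoothAtIn (coord (ψ u).base) f (ψ u))
    (hψ : SmoothFrameAt ψ u) : ContDiffAt ℝ ∞ (fun u' => f (ψ u')) u := by
  obtain ⟨H, hH, he⟩ := hf
  exact (ContDiffAt.comp (f := fun u' => coord (ψ u).base (ψ u')) u hH hψ.2).congr_of_eventuallyEq
    (hψ.1.tendsto.eventually he)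

theorem SmoothAtIn.continuousAt {V : Type*} [NormedAddCommGroup V] [NormedSpace ℝ V]
    {f : OrthonormalFrame n M → V} {z : OrthonormalFrame n M}
    (hf : SmoothAtIn (coord z.base) f z) : ContinuousAt f z := by
  obtain ⟨H, hH, he⟩ := hf
  exact (ContinuousAt.comp hH.continuousAt (continuousAt_coord (mem_frameDom_self z))).congr
    (Filter.EventuallyEq.symm he)

theorem smoothAtIn_of_coord {V : Type*} [NormedAddCommGroup V] [NormedSpace ℝ V]
    {f : OrthonormalFrame n M → V} {z : OrthonormalFrame n M} {x₀ : M} (hz : z ∈ frameDom x₀)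
    (hf : SmoothAtIn (coord x₀) f z) : SmoothAtIn (coord z.base) f z := by
  obtain ⟨H, hH, he⟩ := hf
  have h1 := mem_frameDom_self z
  refine ⟨H ∘ frameTrans (chartMap z.base x₀ id), ?_, ?_⟩
  · refine ContDiffAt.comp _ ?_ (contDiffAt_frameTrans_coord contMDiff_id h1 hz)
    rwa [← coord_trans h1 hz]
  · filter_upwards [he, frameDom_mem_nhds hz, frameDom_mem_nhds h1] with w hw hw0 hw1
    rw [hw, coord_trans hw1 hw0]; rfl

variable (n M) in
/-- A local parametrization of the frame bundle by a product of open sets. -/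
structure ProductChart (k q : ℕ) where
  toFun : Euc k × Euc q → OrthonormalFrame n M
  inv : OrthonormalFrame n M → Euc k × Euc q
  fst : Set (Euc k)
  snd : Set (Euc q)
  target : Set (OrthonormalFrame n M)
  isOpen_fst : IsOpen fst
  isOpen_snd : IsOpen snd
  isOpen_target : IsOpen target
  map_mem : ∀ p ∈ fst ×ˢ snd, toFun p ∈ target
  inv_mem : ∀ z ∈ target, inv z ∈ fst ×ˢ snd
  left_inv : ∀ p ∈ fst ×ˢ snd, inv (toFun p) = p
  right_inv : ∀ z ∈ target, toFun (inv z) = z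
  smooth_toFun : ∀ p ∈ fst ×ˢ snd, SmoothFrameAt toFun p
  smooth_inv : ∀ z ∈ target, SmoothAtIn (coord z.base) inv z

/-- Restriction of a chart to smaller open sets. -/
def ProductChart.restrict {k q : ℕ} (C : ProductChart n M k q) (A : Set (Euc k)) (B : Set (Euc q))
    (hA : IsOpen A) (hB : IsOpen B) (hAC : A ⊆ C.fst) (hBC : B ⊆ C.snd) :
    ProductChart n M k q where
  toFun := C.toFun
  inv := C.inv
  fst := A
  snd := B
  target := C.target ∩ C.inv ⁻¹' (A ×ˢ B)
  isOpen_fst := hA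
  isOpen_snd := hB
  isOpen_target := by
    have : ContinuousOn C.inv C.target := fun z hz =>
      (C.smooth_inv z hz).continuousAt.continuousWithinAt
    exact this.isOpen_inter_preimage C.isOpen_target (hA.prod hB)
  map_mem p hp := by
    have hp' : p ∈ C.fst ×ˢ C.snd := ⟨hAC hp.1, hBC hp.2⟩
    refine ⟨C.map_mem p hp', ?_⟩
    rw [Set.mem_preimage, C.left_inv p hp']; exact hp
  inv_mem z hz := hz.2
  left_inv p hp := C.left_inv p ⟨hAC hp.1, hBC hp.2⟩
  right_inv z hz := C.right_inv z hz.1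
  smooth_toFun p hp := C.smooth_toFun p ⟨hAC hp.1, hBC hp.2⟩
  smooth_inv z hz := C.smooth_inv z hz.1

variable [IsContMDiffRiemannianBundle (𝓡 n) ∞ (Euc n) (fun x : M => TangentSpace (𝓡 n) x)]

attribute [local instance] normedAddCommGroupDual normedSpaceDual normedAddCommGroupBilForm
  normedSpaceBilForm

/-- A map of the ambient space which straightens the manifold of orthonormal frames near `p₀`. -/
def straighten (g : Euc n → BilForm n) (p₀ p : Amb n) : Euc n × (Fin n → Fin n → ℝ) :=
  (p.1, fun i j => g p₀.1 (p.2 (stdVec i)) (p₀.2 (stdVec j))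
    - g p₀.1 (p.2 (stdVec j)) (p₀.2 (stdVec i)) + g p.1 (p.2 (stdVec i)) (p.2 (stdVec j)))

theorem contDiffAt_straighten {g : Euc n → BilForm n} {p₀ p : Amb n} (hg : ContDiffAt ℝ ∞ g p.1) :
    ContDiffAt ℝ ∞ (straighten g p₀) p := by
  have hA : ∀ v : Euc n, ContDiffAt ℝ ∞ (fun p : Amb n => p.2 v) p := fun v =>
    contDiffAt_snd.clm_apply contDiffAt_const
  refine contDiffAt_fst.prodMk (contDiffAt_pi.2 fun i => contDiffAt_pi.2 fun j => ?_)
  refine ContDiffAt.add (ContDiffAt.sub ?_ ?_) ?_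
  · exact (contDiffAt_const.clm_apply (hA _)).clm_apply contDiffAt_const
  · exact (contDiffAt_const.clm_apply (hA _)).clm_apply contDiffAt_const
  · exact ((hg.comp p contDiffAt_fst).clm_apply (hA _)).clm_apply (hA _)

/-- For `D.1 = 0` put $b_{ij}=g(D_2e_i,f_j)$. The first two terms of `straighten` contribute
$b_{ij}-b_{ji}$ to the derivative at `p₀`, the Gram matrix contributes $b_{ij}+b_{ji}$, and the sum
$2b_{ij}$ determines `D.2`. -/
theorem fderiv_straighten_injective {g : Euc n → BilForm n} {p₀ : Amb n}
    (hg : ContDiffAt ℝ ∞ g p₀.1) (hs : ∀ a b, g p₀.1 a b = g p₀.1 b a)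
    (hn : ∀ v, (∀ w, g p₀.1 v w = 0) → v = 0) (hA : Function.Surjective p₀.2) :
    Function.Injective (fderiv ℝ (straighten g p₀) p₀) := by
  refine (injective_iff_map_eq_zero _).2 fun D hD => ?_
  have hd := (contDiffAt_straighten (p₀ := p₀) hg).differentiableAt (by simp)
  have h1 : HasFDerivAt (fun p : Amb n => p.2) (ContinuousLinearMap.snd ℝ _ _) p₀ :=
    hasFDerivAt_snd
  have h0 : HasFDerivAt (fun p : Amb n => g p.1) _ p₀ :=
    ((hg.differentiableAt (by simp)).hasFDerivAt).comp p₀ hasFDerivAt_fst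
  have e1 : D.1 = 0 := by
    have := (hd.hasFDerivAt.fst).unique (hasFDerivAt_fst (p := p₀))
    have := DFunLike.congr_fun this D
    simpa [hD] using this.symm
  have e2 : ∀ i j, g p₀.1 (D.2 (stdVec i)) (p₀.2 (stdVec j)) = 0 := by
    intro i j
    have hl := hasFDerivAt_pi'.1 (hasFDerivAt_pi'.1 hd.hasFDerivAt.snd i) j
    have hA' : ∀ i, HasFDerivAt (fun p : Amb n => p.2 (stdVec i)) _ p₀ := fun i =>
      h1.clm_apply (hasFDerivAt_const (stdVec i) p₀)
    have hr := ((((hasFDerivAt_const (g p₀.1) p₀).clm_apply (hA' i)).clm_apply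
      (hasFDerivAt_const (p₀.2 (stdVec j)) p₀)).sub
      (((hasFDerivAt_const (g p₀.1) p₀).clm_apply (hA' j)).clm_apply
      (hasFDerivAt_const (p₀.2 (stdVec i)) p₀))).add ((h0.clm_apply (hA' i)).clm_apply (hA' j))
    have := DFunLike.congr_fun (hl.unique hr) D
    simp [hD, e1] at this
    rw [hs (p₀.2 (stdVec i)) (D.2 (stdVec j))] at this
    linarith
  refine Prod.ext e1 ?_
  have h2 : D.2.toLinearMap = 0 := by
    refine (EuclideanSpace.basisFun (Fin n) ℝ).toBasis.ext fun i => ?_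
    refine hn _ fun w => ?_
    obtain ⟨v, rfl⟩ := hA w
    have : ((g p₀.1 (D.2 (stdVec i))).comp p₀.2).toLinearMap = 0 :=
      (EuclideanSpace.basisFun (Fin n) ℝ).toBasis.ext fun j => by simpa using e2 i j
    simpa using DFunLike.congr_fun this v
  ext1 v
  exact DFunLike.congr_fun h2 v

/-- On orthonormal frames the Gram matrix is the identity and the remaining terms are skew, so the
frame bundle is mapped into an affine subspace, with the skew matrices as coordinates along the
fibres. -/
theorem straighten_coord {x₀ : M} {z : OrthonormalFrame n M} (hz : z ∈ frameDom x₀) (p₀ : Amb n) :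
    straighten (metricForm x₀) p₀ (coord x₀ z) = ((coord x₀ z).1,
      fun i j => inner ℝ (stdVec i : Euc n) (stdVec j) + skewOf (upperOf
        (straighten (metricForm x₀) p₀ (coord x₀ z)).2) i j) := by
  refine Prod.ext rfl ?_
  let Q : Fin n → Fin n → ℝ := fun i j => metricForm x₀ p₀.1 ((coord x₀ z).2 (stdVec i)) (p₀.2 (stdVec j))
    - metricForm x₀ p₀.1 ((coord x₀ z).2 (stdVec j)) (p₀.2 (stdVec i))
  have hQ : (straighten (metricForm x₀) p₀ (coord x₀ z)).2 =
      Q + fun i j : Fin n => inner ℝ (stdVec i : Euc n) (stdVec j) := by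
    funext i j
    simp only [straighten, Pi.add_apply, Q, metricForm_coord hz]
  rw [hQ, map_add, upperOf_one, add_zero, skewOf_upperOf (fun i j => by simp [Q])]
  funext i j
  rw [Pi.add_apply, Pi.add_apply, add_comm]

/-- The map `straighten` is a local diffeomorphism of the ambient space near `z₀` and carries the
frame bundle onto an open piece of the affine subspace parametrized by `κ`. The second coordinate of
the chart is the coordinate of the base point, so the slices `y = const` lie in fibres of $p$. -/
theorem exists_bundleChart (z₀ : OrthonormalFrame n M) :
    ∃ C : ProductChart n M (n.choose 2) n, z₀ ∈ C.target ∧ ∀ s ∈ C.fst, ∀ y ∈ C.snd,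
      y ∈ (extChartAt (𝓡 n) z₀.base).target ∧
      (C.toFun (s, y)).base = (extChartAt (𝓡 n) z₀.base).symm y := by
  set x₀ := z₀.base with hx₀
  have hz₀ : z₀ ∈ frameDom x₀ := mem_frameDom_self z₀
  set p₀ := coord x₀ z₀ with hp₀
  have ht := coord_fst_mem_target hz₀
  have hsm : ∀ᶠ p in 𝓝 p₀, ContDiffAt ℝ ∞ (straighten (metricForm x₀) p₀) p := by
    have : ∀ᶠ p in 𝓝 p₀, p.1 ∈ (extChartAt (𝓡 n) x₀).target :=
      continuous_fst.continuousAt ((isOpen_target x₀).mem_nhds ht)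
    filter_upwards [this] with p hp using contDiffAt_straighten (contDiffAt_metricForm hp)
  have hfr : Module.finrank ℝ (Amb n) = Module.finrank ℝ (Euc n × (Fin n → Fin n → ℝ)) := by
    have h1 : Module.finrank ℝ (Euc n →L[ℝ] Euc n) = n * n := by
      rw [← (LinearMap.toContinuousLinearMap (𝕜 := ℝ) (E := Euc n) (F' := Euc n)).finrank_eq,
        Module.finrank_linearMap]
      simp
    rw [Module.finrank_prod, Module.finrank_prod, h1, Module.finrank_pi_fintype]
    simp
  obtain ⟨e, he0, hef, hes, het⟩ := exists_localDiffeo hsm hfr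
    (fderiv_straighten_injective (contDiffAt_metricForm ht) (metricForm_comm _ _)
      (fun _ => metricForm_nondeg ht) (coord_snd_surjective hz₀))
  let κ : Euc (n.choose 2) × Euc n → Euc n × (Fin n → Fin n → ℝ) := fun p =>
    (p.2, (fun i j => inner ℝ (stdVec i : Euc n) (stdVec j)) + skewOf p.1)
  have hκ : ContDiff ℝ ∞ κ := by
    refine contDiff_snd.prodMk (contDiff_const.add ?_)
    exact (LinearMap.toContinuousLinearMap (skewOf (n := n))).contDiff.comp contDiff_fst
  let inv : OrthonormalFrame n M → Euc (n.choose 2) × Euc n := fun z =>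
    (upperOf (straighten (metricForm x₀) p₀ (coord x₀ z)).2, (coord x₀ z).1)
  have hκinv : ∀ z ∈ frameDom x₀, κ (inv z) = straighten (metricForm x₀) p₀ (coord x₀ z) := by
    intro z hz
    rw [straighten_coord hz]
    refine Prod.ext rfl ?_
    funext i j
    simp only [κ, inv, Pi.add_apply]
  have hskew0 : upperOf (straighten (metricForm x₀) p₀ p₀).2 = 0 := by
    have : (straighten (metricForm x₀) p₀ p₀).2 =
        fun i j : Fin n => inner ℝ (stdVec i : Euc n) (stdVec j) := by
      funext i j
      simp only [straighten, p₀]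
      rw [metricForm_coord hz₀, metricForm_coord hz₀, real_inner_comm]
      ring
    rw [this, upperOf_one]
  have h0 : inv z₀ = (0, p₀.1) := Prod.ext hskew0 rfl
  have hκ0 : κ (0, p₀.1) ∈ e.target := by
    rw [← h0, hκinv z₀ hz₀, ← hef]
    exact e.map_source he0
  have hnhds : κ ⁻¹' e.target ∩ {p | p.2 ∈ (extChartAt (𝓡 n) x₀).target} ∈
      𝓝 ((0 : Euc (n.choose 2)), p₀.1) :=
    Filter.inter_mem (hκ.continuous.continuousAt (e.open_target.mem_nhds hκ0))
      (continuous_snd.continuousAt ((isOpen_target x₀).mem_nhds ht))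
  obtain ⟨A, B, hAo, hA0, hBo, hB0, hAB⟩ := mem_nhds_prod_iff'.1 hnhds
  -- The preimage of a point of the affine subspace is a frame: the symmetric part of the second
  -- component of `straighten` is the Gram matrix, so this matrix is the identity.
  have hex : ∀ p ∈ A ×ˢ B, ∃ z, z ∈ frameDom x₀ ∧ coord x₀ z = e.symm (κ p) := by
    intro p hp
    have hp' := hAB hp
    have hs : straighten (metricForm x₀) p₀ (e.symm (κ p)) = κ p := by
      rw [← hef]; exact e.right_inv hp'.1
    have h1 : (e.symm (κ p)).1 = p.2 := congrArg Prod.fst hs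
    have h2 : ∀ i j, metricForm x₀ p.2 ((e.symm (κ p)).2 (stdVec i)) ((e.symm (κ p)).2 (stdVec j))
        = inner ℝ (stdVec i : Euc n) (stdVec j) := by
      intro i j
      have e1 := congrFun (congrFun (congrArg Prod.snd hs) i) j
      have e2 := congrFun (congrFun (congrArg Prod.snd hs) j) i
      simp only [straighten, κ, Pi.add_apply, h1] at e1 e2
      rw [metricForm_comm x₀ p.2 ((e.symm (κ p)).2 (stdVec j)),
        real_inner_comm (stdVec i) (stdVec j), skewOf_skew p.1 j i] at e2
      linarith
    have h3 : ∀ v w, metricForm x₀ p.2 ((e.symm (κ p)).2 v) ((e.symm (κ p)).2 w) = inner ℝ v w := by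
      let b := (EuclideanSpace.basisFun (Fin n) ℝ).toBasis
      have : ((metricForm x₀ p.2).bilinearComp (e.symm (κ p)).2 (e.symm (κ p)).2).toLinearMap₁₂ =
          innerₗ (Euc n) := by
        refine b.ext fun i => b.ext fun j => ?_
        simpa [b] using h2 i j
      intro v w
      exact DFunLike.congr_fun (DFunLike.congr_fun this v) w
    obtain ⟨z, hz, hz'⟩ := exists_coord_eq hp'.2 _ h3
    refine ⟨z, hz, hz'.trans (Prod.ext h1.symm rfl)⟩
  classical
  let f : Euc (n.choose 2) × Euc n → OrthonormalFrame n M := fun p =>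
    if h : p ∈ A ×ˢ B then (hex p h).choose else z₀
  have hf : ∀ p ∈ A ×ˢ B, f p ∈ frameDom x₀ ∧ coord x₀ (f p) = e.symm (κ p) := by
    intro p hp
    simp only [f, dif_pos hp]
    exact (hex p hp).choose_spec
  have hinvc : ∀ z ∈ frameDom x₀, SmoothAtIn (coord x₀) inv z := by
    intro z hz
    have hs := contDiffAt_straighten (p₀ := p₀) (contDiffAt_metricForm (coord_fst_mem_target hz))
    refine ⟨fun p => (upperOf (straighten (metricForm x₀) p₀ p).2, p.1), ?_,
      Filter.Eventually.of_forall fun _ => rfl⟩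
    refine ContDiffAt.prodMk ?_ contDiffAt_fst
    exact (LinearMap.toContinuousLinearMap (upperOf (n := n))).contDiff.contDiffAt.comp _ hs.snd
  have hinvf : ∀ p ∈ A ×ˢ B, inv (f p) = p := by
    intro p hp
    have hs : straighten (metricForm x₀) p₀ (e.symm (κ p)) = κ p := by
      rw [← hef]; exact e.right_inv (hAB hp).1
    simp only [inv, (hf p hp).2, hs]
    refine Prod.ext ?_ (congrArg Prod.fst hs)
    simp only [κ, map_add, upperOf_one, zero_add, upperOf_skewOf]
  have hsrc : ∀ p ∈ A ×ˢ B, coord x₀ (f p) ∈ e.source := by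
    intro p hp
    rw [(hf p hp).2]
    exact e.map_target (hAB hp).1
  refine ⟨{ toFun := f, inv := inv, fst := A, snd := B
            target := (frameDom x₀ ∩ coord x₀ ⁻¹' e.source) ∩ inv ⁻¹' (A ×ˢ B)
            isOpen_fst := hAo, isOpen_snd := hBo
            isOpen_target := ?_
            map_mem := fun p hp => ⟨⟨(hf p hp).1, hsrc p hp⟩, ?_⟩
            inv_mem := fun z hz => hz.2
            left_inv := hinvf
            right_inv := fun z hz => coord_injOn x₀ (hf _ hz.2).1 hz.1.1 ?_
            smooth_toFun := fun p hp => ?_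
            smooth_inv := fun z hz => smoothAtIn_of_coord hz.1.1 (hinvc z hz.1.1) }, ?_, ?_⟩
  · have h1 : IsOpen (frameDom x₀ ∩ coord x₀ ⁻¹' e.source) :=
      ContinuousOn.isOpen_inter_preimage (fun z hz => (continuousAt_coord hz).continuousWithinAt)
        (isOpen_frameDom x₀) e.open_source
    refine ContinuousOn.isOpen_inter_preimage (fun z hz => ?_) h1 (hAo.prod hBo)
    exact (smoothAtIn_of_coord hz.1 (hinvc z hz.1)).continuousAt.continuousWithinAt
  · rw [Set.mem_preimage, hinvf p hp]; exact hp
  · rw [(hf _ hz.2).2, hκinv z hz.1.1, ← hef]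
    exact e.left_inv hz.1.2
  · have hn : A ×ˢ B ∈ 𝓝 p := (hAo.prod hBo).mem_nhds hp
    refine smoothFrameAt_of_coord (x₀ := x₀) ?_ ?_
    · filter_upwards [hn] with p' hp' using (hf p' hp').1
    · refine ContDiffAt.congr_of_eventuallyEq ?_
        (Filter.eventually_of_mem hn fun p' hp' => (hf p' hp').2)
      exact (het _ (hAB hp).1).comp p hκ.contDiffAt
  · refine ⟨⟨hz₀, he0⟩, ?_⟩
    rw [Set.mem_preimage, h0]
    exact ⟨hA0, hB0⟩
  · intro s hs y hy
    have hp : (s, y) ∈ A ×ˢ B := ⟨hs, hy⟩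
    refine ⟨(hAB hp).2, ?_⟩
    have h1 : (coord x₀ (f (s, y))).1 = y := congrArg Prod.snd (hinvf _ hp)
    rw [← symm_coord_fst (hf _ hp).1, h1]

end ProductChart

/-! ### Gram determinants -/

section Gram

variable {T : Type*} [NormedAddCommGroup T] [InnerProductSpace ℝ T]

/-- The Gram determinant of a family that is split into two orthogonal parts up to a shear. -/
theorem det_gram_sumElim {ι κ : Type*} [Fintype ι] [Fintype κ] [DecidableEq ι] [DecidableEq κ]
    (v : ι → T) (w w' : κ → T) (c : κ → ι → ℝ) (h : ∀ b, w b = w' b + ∑ a, c b a • v a)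
    (ho : ∀ a b, inner ℝ (v a) (w' b) = 0) :
    (Matrix.gram ℝ (Sum.elim v w)).det = (Matrix.gram ℝ v).det * (Matrix.gram ℝ w').det := by
  have ho' : ∀ a b, inner ℝ (w' b) (v a) = 0 := fun a b => by rw [real_inner_comm, ho]
  -- The shear acts by congruence with a unipotent matrix and does not change the determinant; what
  -- remains is block diagonal.
  have key : Matrix.gram ℝ (Sum.elim v w) =
      Matrix.fromBlocks 1 0 (Matrix.of c) 1 *
        Matrix.fromBlocks (Matrix.gram ℝ v) 0 0 (Matrix.gram ℝ w') *
        Matrix.fromBlocks 1 (Matrix.of c).transpose 0 1 := by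
    rw [Matrix.fromBlocks_multiply, Matrix.fromBlocks_multiply]
    simp only [Matrix.one_mul, Matrix.mul_one, Matrix.zero_mul, Matrix.mul_zero, add_zero, zero_add]
    ext (i | i) (j | j)
    · simp [Matrix.gram]
    · simp [Matrix.gram, h, inner_add_right, ho, Matrix.mul_apply, inner_sum, inner_smul_right,
        mul_comm]
    · simp [Matrix.gram, h, inner_add_left, ho', Matrix.mul_apply, sum_inner, inner_smul_left]
    · simp only [Matrix.gram_apply, Sum.elim_inr, h, inner_add_left, inner_add_right, ho', ho,
        sum_inner, inner_sum, inner_smul_left, inner_smul_right, Matrix.fromBlocks_apply₂₂,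
        Matrix.add_apply, Matrix.mul_apply, Matrix.of_apply, Matrix.transpose_apply]
      simp [Finset.sum_mul, Finset.mul_sum]
      rw [add_comm]
      congr 1
      refine Finset.sum_congr rfl fun a _ => Finset.sum_congr rfl fun b _ => ?_
      ring
  rw [key, Matrix.det_mul, Matrix.det_mul, Matrix.det_fromBlocks_zero₁₂,
    Matrix.det_fromBlocks_zero₁₂, Matrix.det_fromBlocks_zero₂₁]
  simp

theorem det_gram_nonneg {ι : Type*} [Fintype ι] [DecidableEq ι] (v : ι → T) :
    0 ≤ (Matrix.gram ℝ v).det := (Matrix.posSemidef_gram ℝ v).det_nonneg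

/-- The volume of a parallelepiped is that of its base times that of the projection of the other
edges to the orthogonal complement of the base. -/
theorem gramDensity_eq_mul {k q r : ℕ} (e : Fin k ⊕ Fin q ≃ Fin r) (u : Fin r → T) (v : Fin k → T)
    (w w' : Fin q → T) (hv : ∀ a, u (e (Sum.inl a)) = v a) (hw : ∀ b, u (e (Sum.inr b)) = w b)
    (hs : ∀ b, w b - w' b ∈ Submodule.span ℝ (Set.range v)) (ho : ∀ a b, inner ℝ (v a) (w' b) = 0) :
    gramDensity u = gramDensity v * gramDensity w' := by
  have hc : ∀ b, ∃ c : Fin k → ℝ, ∑ a, c a • v a = w b - w' b := fun b =>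
    (Submodule.mem_span_range_iff_exists_fun ℝ).1 (hs b)
  choose c hc using hc
  have h1 : (Matrix.gram ℝ u).det = (Matrix.gram ℝ (Sum.elim v w)).det := by
    rw [← Matrix.det_submatrix_equiv_self e]
    congr 1
    ext (i | i) (j | j) <;> simp [Matrix.gram, hv, hw]
  rw [gramDensity, gramDensity, gramDensity, h1,
    det_gram_sumElim v w w' c (fun b => by rw [hc]; abel) ho, Real.sqrt_mul (det_gram_nonneg v),
    ENNReal.ofReal_mul (Real.sqrt_nonneg _)]

/-- The Gram matrix changes to $A^{T}\Gamma A$. The factor $|\det L|$ is the Jacobian in the change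
of variables, which makes the push-forwards of different parametrizations agree. -/
theorem gramDensity_comp {k : ℕ} (P : Euc k →L[ℝ] T) (L : Euc k →L[ℝ] Euc k) :
    gramDensity (fun a => P (L (stdVec a))) =
      gramDensity (fun a => P (stdVec a)) * ENNReal.ofReal |L.det| := by
  let b := (EuclideanSpace.basisFun (Fin k) ℝ).toBasis
  let A := LinearMap.toMatrix b b L.toLinearMap
  have hL : ∀ a, L (stdVec a) = ∑ i, A i a • stdVec i := by
    intro a
    have := (b.sum_repr (L (stdVec a))).symm
    simpa [A, LinearMap.toMatrix_apply, b] using this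
  have h1 : Matrix.gram ℝ (fun a => P (L (stdVec a))) =
      A.transpose * Matrix.gram ℝ (fun a => P (stdVec a)) * A := by
    ext i j
    simp only [Matrix.gram_apply, hL, map_sum, map_smul, sum_inner, inner_sum, inner_smul_left,
      inner_smul_right, Matrix.mul_apply, Matrix.transpose_apply]
    simp only [Finset.sum_mul, Finset.mul_sum]
    refine Finset.sum_congr rfl fun a _ => Finset.sum_congr rfl fun b _ => ?_
    simp; ring
  have h2 : A.det = L.det := LinearMap.det_toMatrix b L.toLinearMap
  rw [gramDensity, gramDensity, h1, Matrix.det_mul, Matrix.det_mul, Matrix.det_transpose, h2,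
    ← ENNReal.ofReal_mul (Real.sqrt_nonneg _)]
  congr 1
  rw [show L.det * (Matrix.gram ℝ fun a => P (stdVec a)).det * L.det =
    (Matrix.gram ℝ fun a => P (stdVec a)).det * L.det ^ 2 by ring, Real.sqrt_mul (det_gram_nonneg _),
    Real.sqrt_sq_eq_abs]

theorem continuousAt_gramDensity {X : Type*} [TopologicalSpace X] {k : ℕ} {v : X → Fin k → T} {x : X}
    (h : ∀ a, ContinuousAt (fun x => v x a) x) : ContinuousAt (fun x => gramDensity (v x)) x := by
  have hm : ContinuousAt (fun x => Matrix.gram ℝ (v x)) x := by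
    refine continuousAt_pi.2 fun i => continuousAt_pi.2 fun j => ?_
    exact (h i).inner (h j)
  have hd : ContinuousAt (fun x => (Matrix.gram ℝ (v x)).det) x :=
    ContinuousAt.comp (g := Matrix.det) (Continuous.matrix_det continuous_id).continuousAt hm
  exact ENNReal.continuous_ofReal.continuousAt.comp (Real.continuous_sqrt.continuousAt.comp hd)

end Gram

/-! ### Measures defined as suprema over parametrizations -/

section Measure

variable {X : Type*} [MeasurableSpace X]

/-- A parametrization is a total function with arbitrary values off `U`, so it is only almost
everywhere measurable for the restricted measure. -/
theorem map_withDensity_apply {Y : Type*} [MeasurableSpace Y] {μ : Measure Y} [SFinite μ] {ψ : Y → X}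
    {U : Set Y} (hU : MeasurableSet U) (hψ : Measurable fun u : U => ψ u) (δ : Y → ℝ≥0∞) {A : Set X}
    (hA : MeasurableSet A) :
    (((μ.restrict U).withDensity δ).map ψ) A = ∫⁻ u in U ∩ ψ ⁻¹' A, δ u ∂μ := by
  have h1 : AEMeasurable ψ (μ.restrict U) := aemeasurable_restrict_of_measurable_subtype hU hψ
  have h2 : AEMeasurable ψ ((μ.restrict U).withDensity δ) :=
    h1.mono_ac (withDensity_absolutelyContinuous _ _)
  rw [Measure.map_apply_of_aemeasurable h2 hA, withDensity_apply', Measure.restrict_restrict' hU,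
    Set.inter_comm]

theorem measurable_indicator_of_subtype {Y : Type*} [MeasurableSpace Y] {f : Y → ℝ≥0∞} {U : Set Y}
    (hU : MeasurableSet U) (hf : Measurable fun u : U => f u) : Measurable (U.indicator f) := by
  refine measurable_of_restrict_of_restrict_compl hU ?_ ?_
  · convert hf using 1
    ext u; simp
  · convert measurable_const (a := (0 : ℝ≥0∞)) using 1
    ext u
    exact Set.indicator_of_notMem u.2 f

theorem measurableSet_inter_preimage {Y : Type*} [MeasurableSpace Y] {ψ : Y → X}
    {U : Set Y} (hU : MeasurableSet U) (hψ : Measurable fun u : U => ψ u) {A : Set X}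
    (hA : MeasurableSet A) : MeasurableSet (U ∩ ψ ⁻¹' A) := by
  have := hU.subtype_image (hψ hA)
  convert this using 1
  ext u
  simp [and_comm]

/-- Change of variables between two parametrizations. -/
theorem map_withDensity_restrict_le {k : ℕ} {ψ ψ₀ : Euc k → X} {U U₀ : Set (Euc k)}
    {δ δ₀ : Euc k → ℝ≥0∞} {V : Set X} {θ : Euc k → Euc k} {θ' : Euc k → Euc k →L[ℝ] Euc k}
    (hU : MeasurableSet U) (hU₀ : MeasurableSet U₀) (hV : MeasurableSet V)
    (hψ : Measurable fun u : U => ψ u) (hψ₀ : Measurable fun u : U₀ => ψ₀ u)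
    (hθ' : ∀ u ∈ U, ψ u ∈ V → HasFDerivAt θ (θ' u) u)
    (hinj : Set.InjOn θ (U ∩ ψ ⁻¹' V)) (hmem : ∀ u ∈ U, ψ u ∈ V → θ u ∈ U₀)
    (heq : ∀ u ∈ U, ψ u ∈ V → ψ u = ψ₀ (θ u))
    (hδ : ∀ u ∈ U, ψ u ∈ V → δ u = δ₀ (θ u) * ENNReal.ofReal |(θ' u).det|) :
    (((volume.restrict U).withDensity δ).map ψ).restrict V ≤
      ((volume.restrict U₀).withDensity δ₀).map ψ₀ := by
  refine Measure.le_iff.2 fun A hA => ?_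
  rw [Measure.restrict_apply hA, map_withDensity_apply hU hψ δ (hA.inter hV),
    map_withDensity_apply hU₀ hψ₀ δ₀ hA]
  set S := U ∩ ψ ⁻¹' (A ∩ V)
  have hS : MeasurableSet S := measurableSet_inter_preimage hU hψ (hA.inter hV)
  calc ∫⁻ u in S, δ u = ∫⁻ u in S, ENNReal.ofReal |(θ' u).det| * δ₀ (θ u) := by
        refine setLIntegral_congr_fun hS fun u hu => ?_
        rw [hδ u hu.1 hu.2.2, mul_comm]
    _ = ∫⁻ u in θ '' S, δ₀ u :=
        (lintegral_image_eq_lintegral_abs_det_fderiv_mul volume hS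
          (fun u hu => (hθ' u hu.1 hu.2.2).hasFDerivWithinAt)
          (hinj.mono (show S ⊆ U ∩ ψ ⁻¹' V from fun u hu => ⟨hu.1, hu.2.2⟩)) δ₀).symm
    -- Only an inequality, because `ψ` need not reach all of `ψ₀ '' U₀`.
    _ ≤ ∫⁻ u in U₀ ∩ ψ₀ ⁻¹' A, δ₀ u := by
        refine lintegral_mono_set ?_
        rintro _ ⟨u, hu, rfl⟩
        refine ⟨hmem u hu.1 hu.2.2, ?_⟩
        rw [Set.mem_preimage, ← heq u hu.1 hu.2.2]
        exact hu.2.1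

/-- The bound on `V` is put into a form with no restriction on the left, so that it passes to the
supremum over all `m`; `restrict_eq_of_le` then restricts to `V`. This is how each volume is
identified with the push-forward of a single parametrization. -/
theorem le_add_restrict_compl {m μ μ₀ : Measure X} {V : Set X} (hV : MeasurableSet V)
    (h : m.restrict V ≤ μ₀) (hm : m ≤ μ) : m ≤ μ₀ + μ.restrict Vᶜ := by
  rw [← Measure.restrict_add_restrict_compl (μ := m) hV]
  exact add_le_add h (Measure.restrict_mono subset_rfl hm)

theorem restrict_eq_of_le {μ μ₀ : Measure X} {V : Set X} (hV : MeasurableSet V)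
    (h : μ ≤ μ₀ + μ.restrict Vᶜ) (h0 : μ₀ ≤ μ) (hV0 : μ₀ Vᶜ = 0) : μ.restrict V = μ₀ := by
  refine le_antisymm ?_ ?_
  · refine Measure.le_iff.2 fun A hA => ?_
    rw [Measure.restrict_apply hA]
    refine (h (A ∩ V)).trans ?_
    rw [Measure.add_apply, Measure.restrict_apply (hA.inter hV)]
    simp only [Set.inter_assoc, Set.inter_compl_self, Set.inter_empty, measure_empty, add_zero]
    exact measure_mono Set.inter_subset_left
  · have : μ₀.restrict V = μ₀ := Measure.restrict_eq_self_of_ae_mem (by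
      rw [ae_iff]; exact hV0)
    rw [← this]
    exact Measure.restrict_mono subset_rfl h0

end Measure

/-! ### Disintegration of measures, local and global -/

section Coarea

variable {Z B : Type*} [MeasurableSpace Z] [MeasurableSpace B]

/-- Globalization of the disintegration of a measure. -/
theorem lintegral_lintegral_of_local [TopologicalSpace Z] [SecondCountableTopology Z]
    {β : Measure B} {ν : B → Measure Z} {μ : Measure Z}
    (h : ∀ z, ∃ V ∈ 𝓝 z, MeasurableSet V ∧ ∀ A, MeasurableSet A → A ⊆ V →
      Measurable (fun b => ν b A) ∧ ∫⁻ b, ν b A ∂β = μ A) {f : Z → ℝ≥0∞} (hf : Measurable f) :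
    ∫⁻ b, (∫⁻ z, f z ∂(ν b)) ∂β = ∫⁻ z, f z ∂μ := by
  choose V hV hVm hVA using h
  obtain ⟨s, hs, hcov⟩ := TopologicalSpace.countable_cover_nhds hV
  rcases s.eq_empty_or_nonempty with rfl | hne
  · have : IsEmpty Z := by
      rw [← Set.univ_eq_empty_iff, ← hcov]; simp
    have h1 : ∀ m : Measure Z, m = 0 := fun m => Measure.eq_zero_of_isEmpty m
    simp [h1]
  -- The countable cover is made disjoint; measurability of `ν` and the identity of measures then
  -- follow by summation over the pieces, and the integral of `f` is one against `β.bind ν`.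
  obtain ⟨z, rfl⟩ := hs.exists_eq_range hne
  have hcov' : ⋃ i, V (z i) = Set.univ := by rw [← hcov, Set.biUnion_range]
  have hdm : ∀ i, MeasurableSet (disjointed (fun i => V (z i)) i) := fun i =>
    MeasurableSet.disjointed (fun i => hVm (z i)) i
  have hsum : ∀ (m : Measure Z) (A : Set Z), MeasurableSet A →
      m A = ∑' i, m (A ∩ disjointed (fun i => V (z i)) i) := by
    intro m A hA
    rw [← measure_iUnion, ← Set.inter_iUnion, iUnion_disjointed, hcov', Set.inter_univ]
    · exact fun i j hij => ((disjoint_disjointed _) hij).mono Set.inter_subset_right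
        Set.inter_subset_right
    · exact fun i => hA.inter (hdm i)
  have hsub : ∀ i (A : Set Z), A ∩ disjointed (fun i => V (z i)) i ⊆ V (z i) := fun i A =>
    Set.inter_subset_right.trans (disjointed_subset _ _)
  have hmeas : Measurable ν := by
    refine Measure.measurable_of_measurable_coe _ fun A hA => ?_
    simp_rw [hsum _ A hA]
    exact Measurable.tsum fun i => (hVA (z i) _ (hA.inter (hdm i)) (hsub i A)).1
  have hbind : β.bind ν = μ := by
    refine Measure.ext fun A hA => ?_
    rw [Measure.bind_apply hA hmeas.aemeasurable]
    simp_rw [hsum _ A hA]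
    rw [lintegral_tsum fun i => (hVA (z i) _ (hA.inter (hdm i)) (hsub i A)).1.aemeasurable]
    exact tsum_congr fun i => (hVA (z i) _ (hA.inter (hdm i)) (hsub i A)).2
  rw [← hbind, Measure.lintegral_bind hmeas.aemeasurable hf.aemeasurable]

/-- Disintegration of a measure in a local product parametrization. -/
theorem disintegration_of_product {Y₁ Y₂ : Type*} [MeasurableSpace Y₁] [MeasurableSpace Y₂]
    {m₁ : Measure Y₁} {m₂ : Measure Y₂} [SFinite m₁] [SFinite m₂] {W₁ : Set Y₁} {W₂ : Set Y₂}
    (hW₁ : MeasurableSet W₁) (hW₂ : MeasurableSet W₂) {Ψ : Y₁ × Y₂ → Z}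
    (hΨ : Measurable fun p : (W₁ ×ˢ W₂ : Set (Y₁ × Y₂)) => Ψ p) {δ : Y₁ × Y₂ → ℝ≥0∞} {δ₁ : Y₁ × Y₂ → ℝ≥0∞}
    {δ₂ : Y₂ → ℝ≥0∞} (hδ₁ : Measurable fun p : (W₁ ×ˢ W₂ : Set (Y₁ × Y₂)) => δ₁ p) (hδ₂ : Measurable fun y : W₂ => δ₂ y)
    (hδ : ∀ p ∈ W₁ ×ˢ W₂, δ p = δ₁ p * δ₂ p.2)
    {μ : Measure Z} {β : Measure B} {ν : B → Measure Z} {V : Set Z} {P : Y₂ → B} {Q : B → Y₂}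
    (hμ : μ.restrict V = (((m₁.prod m₂).restrict (W₁ ×ˢ W₂)).withDensity δ).map Ψ)
    (hP : Measurable fun y : W₂ => P y) (hPW : MeasurableSet (P '' W₂))
    (hQ : Measurable fun b : (P '' W₂ : Set B) => Q b) (hQP : ∀ y ∈ W₂, Q (P y) = y)
    (hβ : β.restrict (P '' W₂) = ((m₂.restrict W₂).withDensity δ₂).map P)
    (hν : ∀ y ∈ W₂, (ν (P y)).restrict V =
      ((m₁.restrict W₁).withDensity (fun s => δ₁ (s, y))).map (fun s => Ψ (s, y)))
    (hν0 : ∀ b ∉ P '' W₂, ν b V = 0) {A : Set Z} (hA : MeasurableSet A) (hAV : A ⊆ V) :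
    Measurable (fun b => ν b A) ∧ ∫⁻ b, ν b A ∂β = μ A := by
  classical
  -- Extension by zero gives a globally measurable density, to which Tonelli's theorem applies.
  set g : Y₁ × Y₂ → ℝ≥0∞ := ((W₁ ×ˢ W₂) ∩ Ψ ⁻¹' A).indicator δ₁ with hg
  have hSm : MeasurableSet ((W₁ ×ˢ W₂) ∩ Ψ ⁻¹' A) :=
    measurableSet_inter_preimage (hW₁.prod hW₂) hΨ hA
  have hgm : Measurable g := by
    have h1 : Measurable ((W₁ ×ˢ W₂).indicator δ₁) :=
      measurable_indicator_of_subtype (hW₁.prod hW₂) hδ₁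
    have : g = ((W₁ ×ˢ W₂) ∩ Ψ ⁻¹' A).indicator ((W₁ ×ˢ W₂).indicator δ₁) := by
      rw [Set.indicator_indicator, Set.inter_right_comm, Set.inter_self]
    rw [this]
    exact h1.indicator hSm
  let G : Y₂ → ℝ≥0∞ := fun y => ∫⁻ s, g (s, y) ∂m₁
  have hG : Measurable G := hgm.lintegral_prod_left'
  have hνA : ∀ b, ν b A = (ν b).restrict V A := fun b => by
    rw [Measure.restrict_apply hA, Set.inter_eq_left.2 hAV]
  have hνP : ∀ y ∈ W₂, ν (P y) A = G y := by
    intro y hy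
    have hm : Measurable fun s : W₁ => Ψ (s.1, y) :=
      hΨ.comp (f := fun s : W₁ => (⟨(s.1, y), s.2, hy⟩ : (W₁ ×ˢ W₂ : Set (Y₁ × Y₂))))
        (by fun_prop)
    rw [hνA, hν y hy, map_withDensity_apply hW₁ hm _ hA,
      ← lintegral_indicator (measurableSet_inter_preimage hW₁ hm hA)]
    refine lintegral_congr fun s => ?_
    simp only [hg, Set.indicator, Set.mem_inter_iff, Set.mem_prod, Set.mem_preimage, hy, and_true]
  -- Measurability in `b` is transported from `Y₂` by the inverse `Q` of the parametrization `P` of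
  -- the base; outside the image of `P` the measures do not charge `A`.
  have hν' : (fun b => ν b A) = (P '' W₂).indicator (fun b => G (Q b)) := by
    ext b
    by_cases hb : b ∈ P '' W₂
    · rw [Set.indicator_of_mem hb]
      obtain ⟨y, hy, rfl⟩ := hb
      rw [hνP y hy, hQP y hy]
    · rw [Set.indicator_of_notMem hb]
      exact measure_mono_null hAV (hν0 b hb)
  have hind : Measurable ((P '' W₂).indicator (fun b => G (Q b))) :=
    measurable_indicator_of_subtype hPW (hG.comp hQ)
  refine ⟨?_, ?_⟩
  · rw [hν']
    exact hind
  · have hPae : AEMeasurable P ((m₂.restrict W₂).withDensity δ₂) :=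
      (aemeasurable_restrict_of_measurable_subtype hW₂ hP).mono_ac
        (withDensity_absolutelyContinuous _ _)
    have hδ₂' : AEMeasurable δ₂ (m₂.restrict W₂) :=
      aemeasurable_restrict_of_measurable_subtype hW₂ hδ₂
    have hW : ∀ᵐ y ∂(m₂.restrict W₂), y ∈ W₂ := ae_restrict_mem hW₂
    have e1 : ∫⁻ b, ν b A ∂β = ∫⁻ y in W₂, δ₂ y * G y ∂m₂ := by
      have : ∫⁻ b, ν b A ∂β = ∫⁻ b in P '' W₂, (P '' W₂).indicator (fun b => G (Q b)) b ∂β := by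
        rw [hν', ← lintegral_indicator hPW, Set.indicator_indicator, Set.inter_self]
      rw [this, hβ, lintegral_map' hind.aemeasurable hPae,
        lintegral_withDensity_eq_lintegral_mul₀' hδ₂' ]
      · refine lintegral_congr_ae ?_
        filter_upwards [hW] with y hy
        simp only [Pi.mul_apply]
        rw [Set.indicator_of_mem (show P y ∈ P '' W₂ from ⟨y, hy, rfl⟩), hQP y hy]
      · exact hind.comp_aemeasurable hPae
    have e2 : μ A = ∫⁻ p in (W₁ ×ˢ W₂) ∩ Ψ ⁻¹' A, δ p ∂(m₁.prod m₂) := by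
      have : μ A = μ.restrict V A := by rw [Measure.restrict_apply hA, Set.inter_eq_left.2 hAV]
      rw [this, hμ, map_withDensity_apply (hW₁.prod hW₂) hΨ _ hA]
    let d : Y₂ → ℝ≥0∞ := W₂.indicator δ₂
    have hd : Measurable d := measurable_indicator_of_subtype hW₂ hδ₂
    -- The factorization `hδ` of the density separates the variables; the integral over `Y₁` can
    -- then be carried out first.
    have e3 : ∫⁻ p in (W₁ ×ˢ W₂) ∩ Ψ ⁻¹' A, δ p ∂(m₁.prod m₂) =
        ∫⁻ p, g p * d p.2 ∂(m₁.prod m₂) := by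
      rw [← lintegral_indicator hSm]
      refine lintegral_congr fun p => ?_
      by_cases hp : p ∈ (W₁ ×ˢ W₂) ∩ Ψ ⁻¹' A
      · simp only [hg, d]
        rw [Set.indicator_of_mem hp, Set.indicator_of_mem hp, Set.indicator_of_mem hp.1.2, hδ p hp.1]
      · simp only [hg]
        rw [Set.indicator_of_notMem hp, Set.indicator_of_notMem hp, zero_mul]
    rw [e1, e2, e3, lintegral_prod_symm' (fun p : Y₁ × Y₂ => g p * d p.2) (hgm.mul (hd.comp measurable_snd)),
      ← lintegral_indicator hW₂]
    refine lintegral_congr fun y => ?_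
    simp only [d]
    rw [lintegral_mul_const (f := fun s => g (s, y)) _ (hgm.comp measurable_prodMk_right)]
    by_cases hy : y ∈ W₂
    · rw [Set.indicator_of_mem hy, Set.indicator_of_mem hy, mul_comm]
    · rw [Set.indicator_of_notMem hy, Set.indicator_of_notMem hy, mul_zero]

end Coarea

/-! ### Euclidean splittings and second countability of the frame bundle -/

section EuclideanSplit

/-- The splitting of a Euclidean space into a product. -/
def splitEquiv {k q r : ℕ} (h : k + q = r) : Euc r ≃L[ℝ] Euc k × Euc q :=
  ((LinearIsometryEquiv.piLpCongrLeft 2 ℝ ℝ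
    ((finSumFinEquiv.trans (finCongr h)).symm)).toContinuousLinearEquiv).trans
    (EuclideanSpace.sumEquivProd (𝕜 := ℝ) (ι := Fin k) (κ := Fin q))

theorem splitEquiv_inl {k q r : ℕ} (h : k + q = r) (a : Fin k) :
    splitEquiv h (stdVec (finCongr h (finSumFinEquiv (Sum.inl a)))) = (stdVec a, 0) := by
  subst h
  ext i <;> simp [splitEquiv, PiLp.single_apply]

theorem splitEquiv_inr {k q r : ℕ} (h : k + q = r) (a : Fin q) :
    splitEquiv h (stdVec (finCongr h (finSumFinEquiv (Sum.inr a)))) = (0, stdVec a) := by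
  subst h
  ext i <;> simp [splitEquiv, PiLp.single_apply]

theorem measurePreserving_splitEquiv {k q r : ℕ} (h : k + q = r) :
    MeasurePreserving (splitEquiv h) := by
  have h1 := (LinearIsometryEquiv.piLpCongrLeft 2 ℝ ℝ
    ((finSumFinEquiv.trans (finCongr h)).symm)).measurePreserving
  have h2 := (PiLp.sumPiLpEquivProdLpPiLp 2 (fun _ : Fin k ⊕ Fin q => ℝ)).measurePreserving
  have h3 := WithLp.volume_preserving_ofLp (Euc k) (Euc q)
  exact h3.comp (h2.comp h1)

end EuclideanSplit

section Topology

variable {n : ℕ} {M : Type*} [TopologicalSpace M] [ChartedSpace (Euc n) M]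
  [RiemannianBundle (fun x : M => TangentSpace (𝓡 n) x)] [IsManifold (𝓡 n) ∞ M]

theorem isInducing_coord_frameDom (x₀ : M) :
    Topology.IsInducing (fun z : frameDom (n := n) x₀ => coord x₀ z.1) := by
  refine Topology.isInducing_iff_nhds.2 fun z => ?_
  rw [nhds_subtype_eq_comap, nhds_eq_comap_coord z.2, Filter.comap_inf, Filter.comap_comap,
    Filter.comap_principal]
  simp [Function.comp_def]

instance [SecondCountableTopology M] : SecondCountableTopology (OrthonormalFrame n M) := by
  obtain ⟨s, hs, hcov⟩ := TopologicalSpace.countable_cover_nhds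
    (fun x : M => extChartAt_source_mem_nhds (I := 𝓡 n) x)
  have : Countable s := hs
  have h1 : ∀ x : s, SecondCountableTopology (frameDom (n := n) x.1) := fun x =>
    (isInducing_coord_frameDom x.1).secondCountableTopology
  refine TopologicalSpace.secondCountableTopology_of_countable_cover
    (U := fun x : s => frameDom (n := n) x.1) (fun x => isOpen_frameDom x.1) ?_
  refine Set.eq_univ_of_forall fun z => ?_
  have hz : z.base ∈ ⋃ x ∈ s, (extChartAt (𝓡 n) x).source := by rw [hcov]; trivial
  obtain ⟨x, hx, hz⟩ := Set.mem_iUnion₂.1 hz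
  exact Set.mem_iUnion.2 ⟨⟨x, hx⟩, hz⟩

end Topology

/-! ### The volume of submanifolds of the frame bundle in local parametrizations -/

section Volume

variable {n : ℕ} {M : Type*} [TopologicalSpace M] [ChartedSpace (Euc n) M]
  [RiemannianBundle (fun x : M => TangentSpace (𝓡 n) x)] [IsManifold (𝓡 n) ∞ M]
  [IsContMDiffRiemannianBundle (𝓡 n) ∞ (Euc n) (fun x : M => TangentSpace (𝓡 n) x)]

theorem contDiffAt_sasakiDeriv {X : Type*} [NormedAddCommGroup X] [NormedSpace ℝ X]
    {ψ : X → OrthonormalFrame n M} {u : X} (h : ∀ᶠ u' in 𝓝 u, SmoothFrameAt ψ u') :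
    ContDiffAt ℝ ∞ (sasakiDeriv ψ) u := by
  have h0 := mem_frameDom_self (ψ u)
  have hd : ∀ᶠ u' in 𝓝 u, ψ u' ∈ frameDom (ψ u).base :=
    h.self_of_nhds.1 (frameDom_mem_nhds h0)
  have he : sasakiDeriv ψ =ᶠ[𝓝 u] fun u' =>
      (sasakiForm (metricForm (ψ u).base) (coord (ψ u).base (ψ u'))).comp
        (fderiv ℝ (fun u' => coord (ψ u).base (ψ u')) u') := by
    filter_upwards [h, hd] with u' hu' hd' using sasakiDeriv_eq hu' hd'
  refine ContDiffAt.congr_of_eventuallyEq ?_ he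
  have h1 : ContDiffAt ℝ ∞
      (fun u' => sasakiForm (metricForm (ψ u).base) (coord (ψ u).base (ψ u'))) u :=
    ContDiffAt.comp (g := sasakiForm (metricForm (ψ u).base)) u
      (contDiffAt_sasakiForm (isOpen_target (ψ u).base) (fun y hy => contDiffAt_metricForm hy)
      (coord_fst_mem_target h0)) h.self_of_nhds.2
  exact h1.clm_comp (h.self_of_nhds.2.fderiv_right (m := ∞) (by simp))

theorem continuousAt_sasakiDeriv {X : Type*} [NormedAddCommGroup X] [NormedSpace ℝ X]
    {ψ : X → OrthonormalFrame n M} {u : X} (h : ∀ᶠ u' in 𝓝 u, SmoothFrameAt ψ u') :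
    ContinuousAt (sasakiDeriv ψ) u := (contDiffAt_sasakiDeriv h).continuousAt

theorem measurable_subtype_of_continuousAt {X Y : Type*} [TopologicalSpace X] [MeasurableSpace X]
    [OpensMeasurableSpace X] [TopologicalSpace Y] [MeasurableSpace Y] [BorelSpace Y] {f : X → Y}
    {U : Set X} (h : ∀ u ∈ U, ContinuousAt f u) : Measurable fun u : U => f u :=
  (continuousOn_iff_continuous_domRestrict.1 fun u hu => (h u hu).continuousWithinAt).measurable

theorem IsSmoothParam.smoothFrameAt {k : ℕ} {ψ : Euc k → OrthonormalFrame n M} {U : Set (Euc k)}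
    (h : IsSmoothParam ψ U) {u : Euc k} (hu : u ∈ U) : SmoothFrameAt ψ u :=
  ⟨h.2.1.continuousAt (h.1.mem_nhds hu), h.2.2 u hu⟩

theorem isSmoothParam_of_smoothFrameAt {k : ℕ} {ψ : Euc k → OrthonormalFrame n M} {U : Set (Euc k)}
    (hU : IsOpen U) (h : ∀ u ∈ U, SmoothFrameAt ψ u) : IsSmoothParam ψ U :=
  ⟨hU, fun u hu => (h u hu).1.continuousWithinAt, fun u hu => (h u hu).2⟩

/-- The volume of a submanifold in one parametrization. -/
theorem submanifoldVolume_restrict {k : ℕ} {S V : Set (OrthonormalFrame n M)} (hV : IsOpen V)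
    {ψ₀ : Euc k → OrthonormalFrame n M} {U₀ : Set (Euc k)} (hU₀ : IsOpen U₀)
    (hψ₀ : ∀ u ∈ U₀, SmoothFrameAt ψ₀ u) {χ : OrthonormalFrame n M → Euc k}
    (hχ : ∀ z ∈ V, SmoothAtIn (coord z.base) χ z) (hm : ∀ u ∈ U₀, ψ₀ u ∈ S ∩ V ∧ χ (ψ₀ u) = u)
    (hr : ∀ z ∈ S ∩ V, χ z ∈ U₀ ∧ ψ₀ (χ z) = z) :
    (submanifoldVolume k S).restrict V =
      ((volume.restrict U₀).withDensity
        (fun u => gramDensity fun a => sasakiDeriv ψ₀ u (stdVec a))).map ψ₀ := by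
  have hmψ : ∀ {ψ : Euc k → OrthonormalFrame n M} {U : Set (Euc k)},
      (∀ u ∈ U, SmoothFrameAt ψ u) → Measurable fun u : U => ψ u := fun h =>
    measurable_subtype_of_continuousAt fun u hu => (h u hu).1
  refine restrict_eq_of_le hV.measurableSet ?_ ?_ ?_
  · refine iSup_le fun ψ => iSup_le fun U => iSup_le fun h => ?_
    have hs : ∀ u ∈ U, SmoothFrameAt ψ u := fun u hu => h.1.smoothFrameAt hu
    refine le_add_restrict_compl hV.measurableSet ?_ ?_
    -- Over `V` an arbitrary parametrization factors as `ψ = ψ₀ ∘ (χ ∘ ψ)` through a smooth map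
    -- between open sets, so the change of variables formula bounds its push-forward by that of
    -- `ψ₀`.
    · have hcd : ∀ u ∈ U, ψ u ∈ V → ContDiffAt ℝ ∞ (fun u' => χ (ψ u')) u := fun u hu huV =>
        (hχ _ huV).contDiffAt (hs u hu)
      refine map_withDensity_restrict_le h.1.1.measurableSet hU₀.measurableSet hV.measurableSet
        (hmψ hs) (hmψ hψ₀) (θ := fun u => χ (ψ u)) (θ' := fun u => fderiv ℝ (fun u' => χ (ψ u')) u)
        (fun u hu huV => ((hcd u hu huV).differentiableAt (by simp)).hasFDerivAt) ?_ ?_ ?_ ?_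
      · intro u hu u' hu' he
        refine h.2.2 hu.1 hu'.1 ?_
        rw [← (hr _ ⟨h.2.1 hu.1, hu.2⟩).2, ← (hr _ ⟨h.2.1 hu'.1, hu'.2⟩).2]
        exact congrArg ψ₀ he
      · exact fun u hu huV => (hr _ ⟨h.2.1 hu, huV⟩).1
      · exact fun u hu huV => (hr _ ⟨h.2.1 hu, huV⟩).2.symm
      · intro u hu huV
        have hu₀ := hr _ ⟨h.2.1 hu, huV⟩
        have he : ψ =ᶠ[𝓝 u] fun u' => ψ₀ (χ (ψ u')) := by
          filter_upwards [h.1.1.mem_nhds hu, (hs u hu).1 (hV.mem_nhds huV)] with u' h1 h2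
          exact (hr _ ⟨h.2.1 h1, h2⟩).2.symm
        simp only [sasakiVec_eq]
        rw [sasakiDeriv_congr he, sasakiDeriv_comp (ψ := ψ₀) (θ := fun u => χ (ψ u)) (hψ₀ _ hu₀.1)
          ((hcd u hu huV).differentiableAt (by simp)), ← gramDensity_comp]
        rfl
    · exact le_iSup_of_le ψ (le_iSup_of_le U (le_iSup_of_le h le_rfl))
  · refine le_iSup_of_le ψ₀ (le_iSup_of_le U₀ (le_iSup_of_le
      ⟨isSmoothParam_of_smoothFrameAt hU₀ hψ₀, fun u hu => (hm u hu).1.1, fun u hu u' hu' he => ?_⟩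
      ?_))
    · rw [← (hm u hu).2, ← (hm u' hu').2, he]
    · simp only [sasakiVec_eq]; rfl
  · rw [map_withDensity_apply hU₀.measurableSet (hmψ hψ₀) _ hV.measurableSet.compl]
    have : U₀ ∩ ψ₀ ⁻¹' Vᶜ = ∅ := by
      ext u
      simp only [Set.mem_inter_iff, Set.mem_preimage, Set.mem_compl_iff, Set.mem_empty_iff_false,
        iff_false, not_and, not_not]
      exact fun hu => (hm u hu).1.2
    rw [this]; simp

/-- The empty parametrization covers `S ∩ V`. -/
theorem submanifoldVolume_of_disjoint {k : ℕ} {S V : Set (OrthonormalFrame n M)} (hV : IsOpen V)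
    (h : S ∩ V = ∅) : submanifoldVolume k S V = 0 := by
  rcases isEmpty_or_nonempty (OrthonormalFrame n M) with hE | ⟨⟨z₀⟩⟩
  · rw [Set.eq_empty_of_isEmpty V]; simp
  · have := submanifoldVolume_restrict (k := k) (S := S) hV (ψ₀ := fun _ => z₀) (U₀ := ∅)
      isOpen_empty (by simp) (χ := fun _ => 0)
      (fun z _ => ⟨fun _ => 0, contDiffAt_const, Filter.Eventually.of_forall fun _ => rfl⟩) (by simp)
      (by simp [h])
    rw [← Measure.restrict_apply_self, this]
    simp

end Volume

section Volume

variable {n : ℕ} {M : Type*} [TopologicalSpace M] [ChartedSpace (Euc n) M]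
  [RiemannianBundle (fun x : M => TangentSpace (𝓡 n) x)] [IsManifold (𝓡 n) ∞ M]
  [IsContMDiffRiemannianBundle (𝓡 n) ∞ (Euc n) (fun x : M => TangentSpace (𝓡 n) x)]

theorem map_withDensity_comp {X Y Y' : Type*} [MeasurableSpace X] [MeasurableSpace Y]
    [MeasurableSpace Y'] {μ : Measure Y} {μ' : Measure Y'} [SFinite μ] [SFinite μ'] {e : Y → Y'}
    (he : MeasurePreserving e μ μ') (hee : MeasurableEmbedding e) {U : Set Y'}
    (hU : MeasurableSet U) {Ψ : Y' → X} (hΨ : Measurable fun u : U => Ψ u) (δ : Y' → ℝ≥0∞) :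
    ((μ.restrict (e ⁻¹' U)).withDensity (fun u => δ (e u))).map (fun u => Ψ (e u)) =
      ((μ'.restrict U).withDensity δ).map Ψ := by
  refine Measure.ext fun A hA => ?_
  have hU' : MeasurableSet (e ⁻¹' U) := he.measurable hU
  have hm : Measurable fun u : (e ⁻¹' U : Set Y) => Ψ (e u) :=
    hΨ.comp (f := fun u : (e ⁻¹' U : Set Y) => (⟨e u, u.2⟩ : U))
      ((he.measurable.comp measurable_subtype_coe).subtype_mk)
  rw [map_withDensity_apply hU' hm _ hA, map_withDensity_apply hU hΨ _ hA,
    ← he.setLIntegral_comp_preimage_emb hee]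
  rfl

/-- The volume of the frame bundle in a product chart. -/
theorem ProductChart.volume_restrict {k q r : ℕ} (C : ProductChart n M k q) (h : k + q = r) :
    (submanifoldVolume r Set.univ).restrict C.target =
      (((volume.prod volume).restrict (C.fst ×ˢ C.snd)).withDensity
        (fun p => gramDensity fun a => sasakiDeriv C.toFun p (splitEquiv h (stdVec a)))).map
          C.toFun := by
  let e := splitEquiv h
  have hop : IsOpen (C.fst ×ˢ C.snd) := C.isOpen_fst.prod C.isOpen_snd
  have hΨ : Measurable fun p : (C.fst ×ˢ C.snd : Set (Euc k × Euc q)) => C.toFun p :=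
    measurable_subtype_of_continuousAt fun p hp => (C.smooth_toFun p hp).1
  have he : MeasurePreserving e volume (volume.prod volume) := measurePreserving_splitEquiv h
  rw [← map_withDensity_comp he e.toHomeomorph.measurableEmbedding hop.measurableSet hΨ]
  have hs : ∀ u ∈ e ⁻¹' (C.fst ×ˢ C.snd), SmoothFrameAt (fun u => C.toFun (e u)) u := fun u hu =>
    (C.smooth_toFun _ hu).comp e.contDiff.contDiffAt
  rw [submanifoldVolume_restrict (S := Set.univ) C.isOpen_target (ψ₀ := fun u => C.toFun (e u))
    (hop.preimage e.continuous) hs (χ := fun z => e.symm (C.inv z))]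
  · have hU' : MeasurableSet (e ⁻¹' (C.fst ×ˢ C.snd)) := (hop.preimage e.continuous).measurableSet
    congr 1
    refine withDensity_congr_ae ?_
    filter_upwards [ae_restrict_mem hU'] with u hu
    rw [sasakiDeriv_comp (C.smooth_toFun _ hu) e.differentiableAt]
    congr 1
    ext1 a
    rw [ContinuousLinearMap.comp_apply, e.fderiv]
    rfl
  · intro z hz
    obtain ⟨H, hH, hHe⟩ := C.smooth_inv z hz
    exact ⟨fun p => e.symm (H p), e.symm.contDiff.contDiffAt.comp _ hH,
      hHe.mono fun w hw => congrArg e.symm hw⟩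
  · intro u hu
    refine ⟨⟨trivial, C.map_mem _ hu⟩, ?_⟩
    rw [C.left_inv _ hu, e.symm_apply_apply]
  · intro z hz
    refine ⟨?_, ?_⟩
    · rw [Set.mem_preimage, e.apply_symm_apply]; exact C.inv_mem z hz.2
    · rw [e.apply_symm_apply]; exact C.right_inv z hz.2

theorem gramDensity_split {T : Type*} [NormedAddCommGroup T] [InnerProductSpace ℝ T] {k q r : ℕ}
    (h : k + q = r) (L : Euc k × Euc q →L[ℝ] T) (w' : Fin q → T)
    (hs : ∀ b, L (0, stdVec b) - w' b ∈
      Submodule.span ℝ (Set.range fun a : Fin k => L (stdVec a, 0)))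
    (ho : ∀ a b, inner ℝ (L (stdVec a, 0)) (w' b) = 0) :
    (gramDensity fun a => L (splitEquiv h (stdVec a))) =
      (gramDensity fun a : Fin k => L (stdVec a, 0)) * gramDensity w' := by
  refine gramDensity_eq_mul (finSumFinEquiv.trans (finCongr h)) _ _
    (fun b => L (0, stdVec b)) _ (fun a => ?_) (fun b => ?_) hs ho
  · exact congrArg L (splitEquiv_inl h a)
  · exact congrArg L (splitEquiv_inr h b)

/-- Disintegration of the volume of the frame bundle in a product chart. -/
theorem ProductChart.disintegration {k q r : ℕ} (C : ProductChart n M k q) (h : k + q = r)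
    {B : Type*} [MeasurableSpace B] {β : Measure B} {ν : B → Measure (OrthonormalFrame n M)}
    {P : Euc q → B} {Q : B → Euc q} {δ₂ : Euc q → ℝ≥0∞}
    (w' : Euc k × Euc q → Fin q → SasakiSpace n)
    (hδ₂m : Measurable fun y : C.snd => δ₂ y)
    (hδ₂ : ∀ p ∈ C.fst ×ˢ C.snd, gramDensity (w' p) = δ₂ p.2)
    (hs : ∀ p ∈ C.fst ×ˢ C.snd, ∀ b, sasakiDeriv C.toFun p (0, stdVec b) - w' p b ∈
      Submodule.span ℝ (Set.range fun a : Fin k => sasakiDeriv C.toFun p (stdVec a, 0)))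
    (ho : ∀ p ∈ C.fst ×ˢ C.snd, ∀ a b,
      inner ℝ (sasakiDeriv C.toFun p (stdVec a, 0)) (w' p b) = 0)
    (hP : Measurable fun y : C.snd => P y) (hPW : MeasurableSet (P '' C.snd))
    (hQ : Measurable fun b : (P '' C.snd : Set B) => Q b) (hQP : ∀ y ∈ C.snd, Q (P y) = y)
    (hβ : β.restrict (P '' C.snd) = ((volume.restrict C.snd).withDensity δ₂).map P)
    (hν : ∀ y ∈ C.snd, (ν (P y)).restrict C.target =
      ((volume.restrict C.fst).withDensity (fun s => gramDensity fun a : Fin k =>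
        sasakiDeriv C.toFun (s, y) (stdVec a, 0))).map (fun s => C.toFun (s, y)))
    (hν0 : ∀ b ∉ P '' C.snd, ν b C.target = 0) {A : Set (OrthonormalFrame n M)}
    (hA : MeasurableSet A) (hAV : A ⊆ C.target) :
    Measurable (fun b => ν b A) ∧ ∫⁻ b, ν b A ∂β = submanifoldVolume r Set.univ A := by
  have hop : IsOpen (C.fst ×ˢ C.snd) := C.isOpen_fst.prod C.isOpen_snd
  have h1 : Measurable fun p : (C.fst ×ˢ C.snd : Set (Euc k × Euc q)) =>
      gramDensity fun a : Fin k => sasakiDeriv C.toFun p.1 (stdVec a, 0) := by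
    refine measurable_subtype_of_continuousAt
      (f := fun p => gramDensity fun a : Fin k => sasakiDeriv C.toFun p (stdVec a, 0))
      fun p hp => continuousAt_gramDensity fun a => ?_
    refine ContinuousAt.clm_apply (continuousAt_sasakiDeriv ?_) continuousAt_const
    filter_upwards [hop.mem_nhds hp] with p' hp' using C.smooth_toFun p' hp'
  -- By `hs` and `ho` the vectors `w'` are the components orthogonal to the slice of the derivatives
  -- in the second factor, so the Gram density splits; by `hδ₂` the second factor depends on the
  -- base coordinate only.
  have h2 : ∀ p ∈ C.fst ×ˢ C.snd,
      (gramDensity fun a => sasakiDeriv C.toFun p (splitEquiv h (stdVec a))) =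
        (fun p => gramDensity fun a : Fin k => sasakiDeriv C.toFun p (stdVec a, 0)) p * δ₂ p.2 := by
    intro p hp
    rw [← hδ₂ p hp]
    exact gramDensity_split h (sasakiDeriv C.toFun p) (w' p) (hs p hp) (ho p hp)
  have h3 : Measurable fun p : (C.fst ×ˢ C.snd : Set (Euc k × Euc q)) => C.toFun p :=
    measurable_subtype_of_continuousAt fun p hp => (C.smooth_toFun p hp).1
  have h4 := C.volume_restrict h
  exact disintegration_of_product (Ψ := C.toFun)
    (δ := fun p => gramDensity fun a => sasakiDeriv C.toFun p (splitEquiv h (stdVec a)))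
    (δ₁ := fun p => gramDensity fun a : Fin k => sasakiDeriv C.toFun p (stdVec a, 0)) (δ₂ := δ₂)
    C.isOpen_fst.measurableSet C.isOpen_snd.measurableSet h3 h1 hδ₂m h2 h4 hP hPW hQ hQP hβ hν hν0
    hA hAV

end Volume

section Volume

theorem gramDensity_congr {k : ℕ} {T T' : Type*} [NormedAddCommGroup T] [InnerProductSpace ℝ T]
    [NormedAddCommGroup T'] [InnerProductSpace ℝ T'] {v : Fin k → T} {w : Fin k → T'}
    (h : ∀ a b, inner ℝ (v a) (v b) = inner ℝ (w a) (w b)) : gramDensity v = gramDensity w := by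
  have : Matrix.gram ℝ v = Matrix.gram ℝ w := by
    ext a b; exact h a b
  rw [gramDensity, gramDensity, this]

variable {n : ℕ} {M : Type*} [TopologicalSpace M] [ChartedSpace (Euc n) M]
  [RiemannianBundle (fun x : M => TangentSpace (𝓡 n) x)] [IsManifold (𝓡 n) ∞ M]
  [IsContMDiffRiemannianBundle (𝓡 n) ∞ (Euc n) (fun x : M => TangentSpace (𝓡 n) x)]

/-- The volume of a submanifold is concentrated on it. -/
theorem submanifoldVolume_restrict_self {k : ℕ} {S : Set (OrthonormalFrame n M)}
    (hS : MeasurableSet S) : (submanifoldVolume k S).restrict S = submanifoldVolume k S := by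
  refine le_antisymm Measure.restrict_le_self ?_
  refine iSup_le fun ψ => iSup_le fun U => iSup_le fun h => ?_
  have hm : Measurable fun u : U => ψ u :=
    measurable_subtype_of_continuousAt fun u hu => (h.1.smoothFrameAt hu).1
  have h0 : ∀ δ : Euc k → ℝ≥0∞, (((volume.restrict U).withDensity δ).map ψ).restrict S =
      ((volume.restrict U).withDensity δ).map ψ := by
    intro δ
    refine Measure.restrict_eq_self_of_ae_mem ?_
    rw [ae_iff]
    change (((volume.restrict U).withDensity δ).map ψ) Sᶜ = 0
    rw [map_withDensity_apply h.1.1.measurableSet hm _ hS.compl]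
    have : U ∩ ψ ⁻¹' Sᶜ = ∅ := by
      ext u
      simp only [Set.mem_inter_iff, Set.mem_preimage, Set.mem_compl_iff, Set.mem_empty_iff_false,
        iff_false, not_and, not_not]
      exact fun hu => h.2.1 hu
    rw [this]; simp
  rw [← h0]
  exact Measure.restrict_mono subset_rfl
    (le_iSup_of_le ψ (le_iSup_of_le U (le_iSup_of_le h le_rfl)))

theorem lintegral_comap_submanifoldVolume {k : ℕ} {S : Set (OrthonormalFrame n M)}
    (hS : MeasurableSet S) (f : OrthonormalFrame n M → ℝ≥0∞) :
    ∫⁻ z : S, f z ∂((submanifoldVolume k S).comap Subtype.val) =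
      ∫⁻ z, f z ∂(submanifoldVolume k S) := by
  rw [← (MeasurableEmbedding.subtype_coe hS).lintegral_map f, map_comap_subtype_coe hS,
    submanifoldVolume_restrict_self hS]

/-- The chart has the smooth left inverse `C.inv`, so its differential in coordinates is injective,
and the forms are injective on the ambient space. -/
theorem ProductChart.sasakiDeriv_injective {k q : ℕ} (C : ProductChart n M k q) {p : Euc k × Euc q}
    (hp : p ∈ C.fst ×ˢ C.snd) : Function.Injective (sasakiDeriv C.toFun p) := by
  refine (injective_iff_map_eq_zero _).2 fun v hv => ?_
  have hs := C.smooth_toFun p hp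
  rw [sasakiDeriv_eq_zero_iff hs (mem_frameDom_self _)] at hv
  obtain ⟨H, hH, he⟩ := C.smooth_inv _ (C.map_mem p hp)
  have h1 : (fun p => p) =ᶠ[𝓝 p] fun p' => H (coord (C.toFun p).base (C.toFun p')) := by
    filter_upwards [hs.1 he, (C.isOpen_fst.prod C.isOpen_snd).mem_nhds hp] with p' h1 h2
    have h1' : C.inv (C.toFun p') = H (coord (C.toFun p).base (C.toFun p')) := h1
    rw [← h1', C.left_inv _ h2]
  have h2 := fderiv_comp (g := H) p (hH.differentiableAt (by simp)) (hs.2.differentiableAt (by simp))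
  have h3 := h1.fderiv_eq (𝕜 := ℝ)
  have h4 : fderiv ℝ (H ∘ fun u' => coord (C.toFun p).base (C.toFun u')) p v = v := by
    have : fderiv ℝ (fun p : Euc k × Euc q => p) p v = v := by simp
    rw [h3] at this
    exact this
  rw [h2, ContinuousLinearMap.comp_apply, hv, map_zero] at h4
  exact h4.symm

/-- The volume of a slice of a product chart. -/
theorem ProductChart.submanifoldVolume_slice {k q : ℕ} (C : ProductChart n M k q)
    {S : Set (OrthonormalFrame n M)} {y : Euc q} (hy : y ∈ C.snd)
    (hS : ∀ z ∈ C.target, z ∈ S ↔ (C.inv z).2 = y) :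
    (submanifoldVolume k S).restrict C.target =
      ((volume.restrict C.fst).withDensity (fun s => gramDensity fun a : Fin k =>
        sasakiDeriv C.toFun (s, y) (stdVec a, 0))).map (fun s => C.toFun (s, y)) := by
  have hs : ∀ s ∈ C.fst, SmoothFrameAt (fun s => C.toFun (s, y)) s := fun s hs =>
    SmoothFrameAt.comp (ψ := C.toFun) (θ := fun s => (s, y)) (C.smooth_toFun (s, y) ⟨hs, hy⟩)
      (contDiffAt_id.prodMk contDiffAt_const)
  rw [submanifoldVolume_restrict C.isOpen_target C.isOpen_fst hs (χ := fun z => (C.inv z).1)]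
  · congr 1
    refine withDensity_congr_ae ?_
    filter_upwards [ae_restrict_mem C.isOpen_fst.measurableSet] with s hs
    rw [sasakiDeriv_comp (ψ := C.toFun) (θ := fun s => (s, y)) (C.smooth_toFun (s, y) ⟨hs, hy⟩)
      (differentiableAt_id.prodMk (differentiableAt_const y))]
    have : HasFDerivAt (𝕜 := ℝ) (fun s : Euc k => (s, y)) _ s :=
      (hasFDerivAt_id s).prodMk (hasFDerivAt_const y s)
    rw [this.fderiv]
    rfl
  · intro z hz
    obtain ⟨H, hH, hHe⟩ := C.smooth_inv z hz
    exact ⟨fun p => (H p).1, hH.fst, hHe.mono fun w hw => congrArg Prod.fst hw⟩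
  · intro s hs
    have h1 := C.map_mem _ (Set.mk_mem_prod hs hy)
    have h2 := C.left_inv _ (Set.mk_mem_prod hs hy)
    exact ⟨⟨(hS _ h1).2 (by rw [h2]), h1⟩, by rw [h2]⟩
  · intro z hz
    refine ⟨(C.inv_mem z hz.2).1, ?_⟩
    rw [← (hS z hz.2).1 hz.1]; exact C.right_inv z hz.2

end Volume

/-! ### The volume of M in a chart -/

section Base

variable {n : ℕ} {M : Type*} [TopologicalSpace M] [ChartedSpace (Euc n) M]
  [RiemannianBundle (fun x : M => TangentSpace (𝓡 n) x)] [IsManifold (𝓡 n) ∞ M]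

theorem chartDeriv_mfderiv_param {k : ℕ} {ψ : Euc k → M} {u : Euc k} {x₀ : M}
    (hψ : MDifferentiableAt 𝓘(ℝ, Euc k) (𝓡 n) ψ u) (hu : ψ u ∈ (extChartAt (𝓡 n) x₀).source)
    (v : Euc k) :
    chartDeriv x₀ (ψ u) (mfderiv 𝓘(ℝ, Euc k) (𝓡 n) ψ u v) =
      fderiv ℝ (fun u' => extChartAt (𝓡 n) x₀ (ψ u')) u v := by
  have := mfderiv_comp u (mdifferentiableAt_chart hu) hψ
  rw [← mfderiv_eq_fderiv]
  exact (DFunLike.congr_fun this v).symm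

theorem isOpen_symm_image {x₀ : M} {B : Set (Euc n)} (hB : IsOpen B)
    (hBt : B ⊆ (extChartAt (𝓡 n) x₀).target) : IsOpen ((extChartAt (𝓡 n) x₀).symm '' B) := by
  have : (extChartAt (𝓡 n) x₀).symm '' B =
      (extChartAt (𝓡 n) x₀).source ∩ extChartAt (𝓡 n) x₀ ⁻¹' B :=
    (extChartAt (𝓡 n) x₀).symm.image_eq_target_inter_inv_preimage hBt
  rw [this]
  exact (continuousOn_extChartAt x₀).isOpen_inter_preimage (isOpen_extChartAt_source x₀) hB

variable [MeasurableSpace M] [BorelSpace M]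

/-- The Riemannian volume in a chart. -/
theorem riemannianVolume_restrict {x₀ : M} {B : Set (Euc n)} (hB : IsOpen B)
    (hBt : B ⊆ (extChartAt (𝓡 n) x₀).target) :
    (riemannianVolume n M).restrict ((extChartAt (𝓡 n) x₀).symm '' B) =
      ((volume.restrict B).withDensity
        (fun y => gramDensity fun a => chartSymmDeriv x₀ y (stdVec a))).map
        (extChartAt (𝓡 n) x₀).symm := by
  have hV := isOpen_symm_image hB hBt
  have hχ : ∀ z ∈ (extChartAt (𝓡 n) x₀).symm '' B, z ∈ (extChartAt (𝓡 n) x₀).source ∧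
      extChartAt (𝓡 n) x₀ z ∈ B ∧ (extChartAt (𝓡 n) x₀).symm (extChartAt (𝓡 n) x₀ z) = z := by
    rintro _ ⟨y, hy, rfl⟩
    refine ⟨(extChartAt (𝓡 n) x₀).map_target (hBt hy), ?_⟩
    rw [(extChartAt (𝓡 n) x₀).right_inv (hBt hy)]
    exact ⟨hy, rfl⟩
  have hm₀ : Measurable fun u : B => (extChartAt (𝓡 n) x₀).symm u :=
    measurable_subtype_of_continuousAt fun u hu => continuousAt_extChartAt_symm'' (hBt hu)
  refine restrict_eq_of_le hV.measurableSet ?_ ?_ ?_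
  · refine iSup_le fun ψ => iSup_le fun U => iSup_le fun h => ?_
    have hs : ∀ u ∈ U, ContMDiffAt 𝓘(ℝ, Euc n) (𝓡 n) ∞ ψ u := fun u hu =>
      h.2.1.contMDiffAt (h.1.mem_nhds hu)
    refine le_add_restrict_compl hV.measurableSet ?_ ?_
    · have hcd : ∀ u ∈ U, ψ u ∈ (extChartAt (𝓡 n) x₀).symm '' B →
          ContDiffAt ℝ ∞ (fun u' => extChartAt (𝓡 n) x₀ (ψ u')) u := fun u hu huV => by
        have h1 : ContMDiffAt (𝓡 n) 𝓘(ℝ, Euc n) ∞ (extChartAt (𝓡 n) x₀) (ψ u) :=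
          contMDiffAt_extChartAt' (by simpa using (hχ _ huV).1)
        exact (h1.comp u (hs u hu)).contDiffAt
      refine map_withDensity_restrict_le h.1.measurableSet hB.measurableSet hV.measurableSet
        (measurable_subtype_of_continuousAt fun u hu => (hs u hu).continuousAt) hm₀
        (θ := fun u => extChartAt (𝓡 n) x₀ (ψ u))
        (θ' := fun u => fderiv ℝ (fun u' => extChartAt (𝓡 n) x₀ (ψ u')) u)
        (fun u hu huV => ((hcd u hu huV).differentiableAt (by simp)).hasFDerivAt) ?_ ?_ ?_ ?_
      · intro u hu u' hu' he
        refine h.2.2 hu.1 hu'.1 ?_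
        rw [← (hχ _ hu.2).2.2, ← (hχ _ hu'.2).2.2]
        exact congrArg (extChartAt (𝓡 n) x₀).symm he
      · exact fun u hu huV => (hχ _ huV).2.1
      · exact fun u hu huV => (hχ _ huV).2.2.symm
      · intro u hu huV
        -- The parametrization differs from the inverse chart by `θ`, and the inner products of its
        -- derivatives are computed by the metric in the chart.
        rw [← gramDensity_comp]
        refine gramDensity_congr fun a b => ?_
        have hmd := (hs u hu).mdifferentiableAt (by simp)
        rw [← chartMetric_eq, ← metricForm_apply, ← chartDeriv_mfderiv_param hmd (hχ _ huV).1,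
          ← chartDeriv_mfderiv_param hmd (hχ _ huV).1, inner_eq_metricForm (hχ _ huV).1]
    · exact le_iSup_of_le ψ (le_iSup_of_le U (le_iSup_of_le h le_rfl))
  · refine le_iSup_of_le _ (le_iSup_of_le B (le_iSup_of_le
      ⟨hB, (contMDiffOn_extChartAt_symm x₀).mono hBt,
        (extChartAt (𝓡 n) x₀).symm.injOn.mono hBt⟩ le_rfl))
  · rw [map_withDensity_apply hB.measurableSet hm₀ _ hV.measurableSet.compl]
    have : B ∩ (extChartAt (𝓡 n) x₀).symm ⁻¹' ((extChartAt (𝓡 n) x₀).symm '' B)ᶜ = ∅ := by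
      ext u
      simp only [Set.mem_inter_iff, Set.mem_preimage, Set.mem_compl_iff, Set.mem_empty_iff_false,
        iff_false, not_and, not_not]
      exact fun hu => ⟨u, hu, rfl⟩
    rw [this]; simp

end Base

/-! ### Integration along the fibres over M -/

section Fibre

variable {n : ℕ}

/-- The values of the solder and connection forms on vertical vectors. -/
def verticalSpace (n : ℕ) : Submodule ℝ (SasakiSpace n) where
  carrier := {x | (∀ i, x (Sum.inl i) = 0) ∧ ∀ i j, x (Sum.inr (i, j)) = -x (Sum.inr (j, i))}
  zero_mem' := by simp
  add_mem' {x y} hx hy := ⟨fun i => by simp [hx.1, hy.1], fun i j => by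
    rw [PiLp.add_apply, PiLp.add_apply, hx.2 i j, hy.2 i j]; ring⟩
  smul_mem' c x hx := ⟨fun i => by simp [hx.1], fun i j => by
    rw [PiLp.smul_apply, PiLp.smul_apply, hx.2 i j]; simp⟩

theorem finrank_verticalSpace_le : Module.finrank ℝ (verticalSpace n) ≤ n.choose 2 := by
  let L : verticalSpace n →ₗ[ℝ] Euc (n.choose 2) :=
    { toFun := fun x => upperOf fun i j => x.1 (Sum.inr (i, j))
      map_add' := fun x y => by rw [← map_add]; rfl
      map_smul' := fun c x => by rw [← map_smul]; rfl }
  have hL : Function.Injective L := by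
    refine (injective_iff_map_eq_zero _).2 fun x hx => ?_
    have h1 := skewOf_upperOf (Q := fun i j => x.1 (Sum.inr (i, j))) x.2.2
    have h2 : upperOf (fun i j => x.1 (Sum.inr (i, j))) = 0 := hx
    rw [h2, map_zero] at h1
    refine Subtype.ext ?_
    ext i
    rcases i with i | ⟨i, j⟩
    · exact x.2.1 i
    · exact (congrFun (congrFun h1 i) j).symm
  simpa using LinearMap.finrank_le_finrank_of_injective hL

/-- Dimension count: a vertical value is determined by the entries of the connection form above the
diagonal, so an injective map from dimension $\binom n2$ into the vertical space fills it. -/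
theorem mem_range_of_verticalSpace {L : Euc (n.choose 2) →ₗ[ℝ] SasakiSpace n}
    (hL : Function.Injective L) (hv : ∀ v, L v ∈ verticalSpace n) {x : SasakiSpace n}
    (hx : x ∈ verticalSpace n) : x ∈ Submodule.span ℝ (Set.range fun a => L (stdVec a)) := by
  have h1 : LinearMap.range L ≤ verticalSpace n := by
    rintro _ ⟨v, rfl⟩; exact hv v
  have h2 : LinearMap.range L = verticalSpace n := by
    refine Submodule.eq_of_le_of_finrank_le h1 ?_
    rw [LinearMap.finrank_range_of_inj hL]
    simpa using finrank_verticalSpace_le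
  have h3 : Submodule.span ℝ (Set.range fun a => L (stdVec a)) = LinearMap.range L := by
    have : (Set.range fun a => L (stdVec a)) = L '' Set.range (EuclideanSpace.basisFun (Fin (n.choose 2)) ℝ).toBasis := by
      rw [← Set.range_comp]; congr 1; ext1 a; simp
    rw [this, Submodule.span_image, Module.Basis.span_eq, Submodule.map_top]
  rw [h3, h2]; exact hx

variable {M : Type*} [TopologicalSpace M] [ChartedSpace (Euc n) M]
  [RiemannianBundle (fun x : M => TangentSpace (𝓡 n) x)] [IsManifold (𝓡 n) ∞ M]

/-- The values of the solder form on the horizontal lifts of the coordinate fields. -/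
def horizontalPart (x₀ : M) (z : OrthonormalFrame n M) (b : Fin n) : SasakiSpace n :=
  WithLp.toLp 2 (Sum.elim (fun i => metricForm x₀ (coord x₀ z).1 (stdVec b)
    ((coord x₀ z).2 (stdVec i))) 0)

/-- This says that $p$ is a Riemannian submersion: the components of a tangent vector of $M$ in an
orthonormal frame compute its length. -/
theorem inner_horizontalPart {x₀ : M} {z : OrthonormalFrame n M} (hz : z ∈ frameDom x₀)
    (b c : Fin n) : inner ℝ (horizontalPart x₀ z b) (horizontalPart x₀ z c) =
      metricForm x₀ (coord x₀ z).1 (stdVec b) (stdVec c) := by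
  obtain ⟨v, hv⟩ := coord_snd_surjective hz (stdVec b)
  obtain ⟨w, hw⟩ := coord_snd_surjective hz (stdVec c)
  simp only [horizontalPart, ← hv, ← hw, metricForm_coord hz, PiLp.inner_apply, Fintype.sum_sum_type]
  simp

theorem measurableSet_fiber [T2Space M] (x : M) : MeasurableSet (fiber (n := n) x) :=
  (isClosed_singleton.preimage continuous_base).measurableSet

variable [IsContMDiffRiemannianBundle (𝓡 n) ∞ (Euc n) (fun x : M => TangentSpace (𝓡 n) x)]

/-- The base point depends on the second coordinate only. Hence derivatives in the first factor have
vanishing solder form, and their connection form is skew. A derivative in the second factor has the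
same solder form as the horizontal lift of the coordinate field, so the difference is vertical, and
the first factor spans all vertical values. -/
theorem ProductChart.sub_horizontalPart_mem {x₀ : M} (C : ProductChart n M (n.choose 2) n)
    (hC : ∀ s ∈ C.fst, ∀ y ∈ C.snd, y ∈ (extChartAt (𝓡 n) x₀).target ∧
      (C.toFun (s, y)).base = (extChartAt (𝓡 n) x₀).symm y)
    {p : Euc (n.choose 2) × Euc n} (hp : p ∈ C.fst ×ˢ C.snd) :
    (∀ a, sasakiDeriv C.toFun p (stdVec a, 0) ∈ verticalSpace n) ∧
    ∀ b, sasakiDeriv C.toFun p (0, stdVec b) - horizontalPart x₀ (C.toFun p) b ∈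
      Submodule.span ℝ (Set.range fun a => sasakiDeriv C.toFun p (stdVec a, 0)) := by
  have hb : ∀ p ∈ C.fst ×ˢ C.snd, C.toFun p ∈ frameDom x₀ ∧ (coord x₀ (C.toFun p)).1 = p.2 := by
    intro p hp
    have := hC _ hp.1 _ hp.2
    have h1 : (C.toFun p).base = (extChartAt (𝓡 n) x₀).symm p.2 := this.2
    refine ⟨?_, ?_⟩
    · rw [frameDom, Set.mem_ofPred_eq, h1]
      exact (extChartAt (𝓡 n) x₀).map_target this.1
    · rw [coord_fst, h1, (extChartAt (𝓡 n) x₀).right_inv this.1]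
  have hs := C.smooth_toFun p hp
  have hd := (hs.coord (hb p hp).1).differentiableAt (by simp)
  have h1 : ∀ v, (fderiv ℝ (fun p => coord x₀ (C.toFun p)) p v).1 = v.2 := by
    intro v
    have h2 : (fun p => (coord x₀ (C.toFun p)).1) =ᶠ[𝓝 p] fun p => p.2 := by
      filter_upwards [(C.isOpen_fst.prod C.isOpen_snd).mem_nhds hp] with p' hp' using (hb p' hp').2
    have h3 := (hd.hasFDerivAt.fst.congr_of_eventuallyEq h2.symm).unique hasFDerivAt_snd
    exact DFunLike.congr_fun h3 v
  have hinl : ∀ v i, sasakiDeriv C.toFun p v (Sum.inl i) =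
      metricForm x₀ (coord x₀ (C.toFun p)).1 v.2 ((coord x₀ (C.toFun p)).2 (stdVec i)) := by
    intro v i
    rw [sasakiDeriv_eq hs (hb p hp).1, ContinuousLinearMap.comp_apply, sasakiForm_inl, h1]
  have hskew := sasakiDeriv_skew hs
  have hvert : ∀ s, sasakiDeriv C.toFun p (s, 0) ∈ verticalSpace n := fun s =>
    ⟨fun i => by rw [hinl]; simp, fun i j => hskew _ i j⟩
  refine ⟨fun a => hvert _, fun b => ?_⟩
  have := mem_range_of_verticalSpace (n := n)
    (L := (sasakiDeriv C.toFun p).toLinearMap ∘ₗ LinearMap.inl ℝ _ _) ?_ hvert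
    (x := sasakiDeriv C.toFun p (0, stdVec b) - horizontalPart x₀ (C.toFun p) b) ?_
  · exact this
  · exact (C.sasakiDeriv_injective hp).comp (fun s t h => congrArg Prod.fst h)
  · refine ⟨fun i => ?_, fun i j => ?_⟩
    · rw [PiLp.sub_apply, hinl]
      simp [horizontalPart]
    · rw [PiLp.sub_apply, PiLp.sub_apply, hskew _ i j]
      simp [horizontalPart]

/-- Integration over the frame bundle, along the fibres over `M`. -/
theorem lintegral_fiber [T2Space M] [SecondCountableTopology M] [MeasurableSpace M] [BorelSpace M]
    {f : OrthonormalFrame n M → ℝ≥0∞} (hf : Measurable f) :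
    ∫⁻ x, (∫⁻ z, f z ∂(submanifoldVolume (n.choose 2) (fiber x))) ∂(riemannianVolume n M) =
      ∫⁻ z, f z ∂(submanifoldVolume (n + n.choose 2) Set.univ) := by
  refine lintegral_lintegral_of_local (fun z₀ => ?_) hf
  obtain ⟨C, hz₀, hC⟩ := exists_bundleChart z₀
  by_cases hne : C.fst.Nonempty
  swap
  · exact absurd (C.inv_mem _ hz₀).1 fun h => hne ⟨_, h⟩
  obtain ⟨s₀, hs₀⟩ := hne
  have hBt : C.snd ⊆ (extChartAt (𝓡 n) z₀.base).target := fun y hy => (hC s₀ hs₀ y hy).1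
  have hbase : ∀ z ∈ C.target, z.base = (extChartAt (𝓡 n) z₀.base).symm (C.inv z).2 := by
    intro z hz
    have h1 := C.inv_mem z hz
    conv_lhs => rw [← C.right_inv z hz]
    exact (hC _ h1.1 _ h1.2).2
  refine ⟨C.target, C.isOpen_target.mem_nhds hz₀, C.isOpen_target.measurableSet,
    fun A hA hAC => ?_⟩
  -- The horizontal parts are orthogonal to the vertical vectors and have the Gram matrix of the
  -- coordinate fields of $M$, so `δ₂` is the Riemannian density in the chart.
  refine C.disintegration (add_comm _ _) (P := (extChartAt (𝓡 n) z₀.base).symm)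
    (Q := extChartAt (𝓡 n) z₀.base)
    (δ₂ := fun y => gramDensity fun a => chartSymmDeriv z₀.base y (stdVec a))
    (fun p => horizontalPart z₀.base (C.toFun p)) ?_ ?_
    (fun p hp => (C.sub_horizontalPart_mem hC hp).2) ?_ ?_ ?_ ?_ ?_
    (riemannianVolume_restrict C.isOpen_snd hBt) ?_ ?_ hA hAC
  · refine measurable_subtype_of_continuousAt
      (f := fun y => gramDensity fun a => chartSymmDeriv z₀.base y (stdVec a)) fun y hy => ?_
    have hm : ContinuousAt (fun y => Matrix.of fun a b =>
        metricForm z₀.base y (stdVec a) (stdVec b)) y := by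
      refine continuousAt_pi.2 fun a => continuousAt_pi.2 fun b => ?_
      exact ((contDiffAt_metricForm (hBt hy)).continuousAt.clm_apply continuousAt_const).clm_apply
        continuousAt_const
    exact ENNReal.continuous_ofReal.continuousAt.comp (Real.continuous_sqrt.continuousAt.comp
      (ContinuousAt.comp (g := Matrix.det) (Continuous.matrix_det continuous_id).continuousAt hm))
  · intro p hp
    have h1 := hC _ hp.1 _ hp.2
    have h2 : (C.toFun p).base = (extChartAt (𝓡 n) z₀.base).symm p.2 := h1.2
    refine gramDensity_congr fun a b => ?_
    rw [inner_horizontalPart, ← chartMetric_eq, ← metricForm_apply, coord_fst, h2, (extChartAt (𝓡 n) z₀.base).right_inv h1.1]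
    rw [frameDom, Set.mem_ofPred_eq, h2]
    exact (extChartAt (𝓡 n) z₀.base).map_target h1.1
  · intro p hp a b
    have h1 := (C.sub_horizontalPart_mem hC hp).1 a
    rw [PiLp.inner_apply, Fintype.sum_sum_type]
    simp [horizontalPart, h1.1]
  · exact measurable_subtype_of_continuousAt fun u hu => continuousAt_extChartAt_symm'' (hBt hu)
  · exact (isOpen_symm_image C.isOpen_snd hBt).measurableSet
  · refine measurable_subtype_of_continuousAt fun x hx => continuousAt_extChartAt' ?_
    obtain ⟨y, hy, rfl⟩ := hx
    exact (extChartAt (𝓡 n) z₀.base).map_target (hBt hy)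
  · exact fun y hy => (extChartAt (𝓡 n) z₀.base).right_inv (hBt hy)
  · intro y hy
    refine C.submanifoldVolume_slice hy fun z hz => ?_
    rw [fiber, Set.mem_ofPred_eq, hbase z hz]
    exact (extChartAt (𝓡 n) z₀.base).symm.injOn.eq_iff (hBt (C.inv_mem z hz).2) (hBt hy)
  · intro x hx
    refine submanifoldVolume_of_disjoint C.isOpen_target ?_
    ext z
    simp only [Set.mem_inter_iff, Set.mem_empty_iff_false, iff_false, not_and]
    intro hz hzC
    refine hx ⟨(C.inv z).2, (C.inv_mem z hzC).2, ?_⟩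
    rw [← hbase z hzC]; exact hz

end Fibre

/-! ### Smoothness of the action on the frame bundle -/

section SmoothAction

variable {n : ℕ} {M : Type*} [TopologicalSpace M] [ChartedSpace (Euc n) M]
  [RiemannianBundle (fun x : M => TangentSpace (𝓡 n) x)] [IsManifold (𝓡 n) ∞ M]

theorem contDiffAt_frameTrans_param {X : Type*} [NormedAddCommGroup X] [NormedSpace ℝ X]
    {f : X × M → M} {x₀ x₁ x : M} {u : X}
    (hf : ContMDiffAt (𝓘(ℝ, X).prod (𝓡 n)) (𝓡 n) ∞ f (u, x))
    (hx : x ∈ (extChartAt (𝓡 n) x₀).source) (hx' : f (u, x) ∈ (extChartAt (𝓡 n) x₁).source)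
    {p : Amb n} (hp : p.1 = extChartAt (𝓡 n) x₀ x) :
    ContDiffAt ℝ ∞ (fun q : X × Amb n => frameTrans (chartMap x₀ x₁ (fun x => f (q.1, x))) q.2)
      (u, p) := by
  have h0 := contDiffAt_chartMap_param hf hx hx'
  rw [← hp] at h0
  have hl : ContDiffAt ℝ ∞ (fun q : X × Amb n => (q.1, q.2.1)) (u, p) :=
    contDiffAt_fst.prodMk (contDiffAt_fst.comp _ contDiffAt_snd)
  refine ContDiffAt.prodMk (ContDiffAt.comp (f := fun q : X × Amb n => (q.1, q.2.1)) (u, p) h0 hl)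
    (ContDiffAt.clm_comp ?_ (contDiffAt_snd.comp _ contDiffAt_snd))
  refine ContDiffAt.fderiv (f := fun q : X × Amb n => chartMap x₀ x₁ (fun x => f (q.1, x)))
    (g := fun q : X × Amb n => q.2.1) (n := ∞) (m := ∞) ?_ (contDiffAt_fst.comp _ contDiffAt_snd)
    (by simp)
  exact ContDiffAt.comp (f := fun q : (X × Amb n) × Euc n => (q.1.1, q.2)) ((u, p), p.1) h0
    ((contDiffAt_fst.comp _ contDiffAt_fst).prodMk contDiffAt_snd)

variable {d : ℕ} {G : Type*} [TopologicalSpace G] [ChartedSpace (Euc d) G] [Group G]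
  [LieGroup (𝓡 d) ∞ G] [MulAction G M] [ContMDiffSMul (𝓡 d) (𝓡 n) ∞ G M] [IsometricAction n M G]

theorem smoothFrameAt_smul_param {X : Type*} [NormedAddCommGroup X] [NormedSpace ℝ X]
    {α : X → G} {ψ : X → OrthonormalFrame n M} {u : X} (hα : ContMDiffAt 𝓘(ℝ, X) (𝓡 d) ∞ α u)
    (hψ : SmoothFrameAt ψ u) : SmoothFrameAt (fun u' => α u' • ψ u') u := by
  have h0 := mem_frameDom_self (ψ u)
  have h1 := mem_frameDom_self (α u • ψ u)
  have hcs : ContinuousSMul G M := ContMDiffSMul.continuousSMul (I := 𝓡 d) (I' := 𝓡 n) ∞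
  have hd : ∀ᶠ u' in 𝓝 u, α u' • ψ u' ∈ frameDom (α u • ψ u).base := by
    have : ContinuousAt (fun u' => α u' • (ψ u').base) u :=
      hα.continuousAt.smul (continuous_base.continuousAt.comp hψ.1)
    exact this (extChartAt_source_mem_nhds (I := 𝓡 n) _)
  refine smoothFrameAt_of_coord hd ?_
  have hf : ContMDiffAt (𝓘(ℝ, X).prod (𝓡 n)) (𝓡 n) ∞ (fun q : X × M => α q.1 • q.2)
      (u, (ψ u).base) :=
    ContMDiffAt.smul (I := 𝓡 d) (I' := 𝓡 n)
      (ContMDiffAt.comp (I' := 𝓘(ℝ, X)) (g := α) (f := Prod.fst) (u, (ψ u).base) hα contMDiffAt_fst)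
      contMDiffAt_snd
  have h2 := contDiffAt_frameTrans_param hf h0 h1 (p := coord (ψ u).base (ψ u)) rfl
  refine (ContDiffAt.comp (f := fun u' => (u', coord (ψ u).base (ψ u'))) u h2
    (contDiffAt_id.prodMk hψ.2)).congr_of_eventuallyEq ?_
  filter_upwards [hd, hψ.1 (frameDom_mem_nhds h0)] with u' hu' hu''
  exact coord_smul (α u') hu'' hu'

theorem contMDiffAt_extChartAt_symm {g₀ : G} {a : Euc d} (ha : a ∈ (extChartAt (𝓡 d) g₀).target) :
    ContMDiffAt 𝓘(ℝ, Euc d) (𝓡 d) ∞ (extChartAt (𝓡 d) g₀).symm a :=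
  (contMDiffOn_extChartAt_symm g₀).contMDiffAt ((isOpen_extChartAt_target g₀).mem_nhds ha)

theorem smoothFrameAt_orbit {g₀ : G} {a : Euc d} (ha : a ∈ (extChartAt (𝓡 d) g₀).target)
    (z : OrthonormalFrame n M) :
    SmoothFrameAt (fun a => (extChartAt (𝓡 d) g₀).symm a • z) a :=
  smoothFrameAt_smul_param (contMDiffAt_extChartAt_symm ha)
    ⟨continuousAt_const, contDiffAt_const⟩

/-- The action on the frame bundle is jointly continuous. -/
theorem continuousSMul_frame (d : ℕ) (G : Type*) [TopologicalSpace G] [ChartedSpace (Euc d) G]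
    [Group G] [LieGroup (𝓡 d) ∞ G] [MulAction G M] [ContMDiffSMul (𝓡 d) (𝓡 n) ∞ G M]
    [IsometricAction n M G] : ContinuousSMul G (OrthonormalFrame n M) := by
  refine ⟨continuous_iff_continuousAt.2 fun ⟨g₀, z₀⟩ => ?_⟩
  have h0 := mem_frameDom_self z₀
  have h1 := mem_frameDom_self (g₀ • z₀)
  have hcs : ContinuousSMul G M := ContMDiffSMul.continuousSMul (I := 𝓡 d) (I' := 𝓡 n) ∞
  have hg₀ := mem_extChartAt_source (I := 𝓡 d) g₀
  have hd : ∀ᶠ q : G × OrthonormalFrame n M in 𝓝 (g₀, z₀), q.1 • q.2 ∈ frameDom (g₀ • z₀).base := by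
    have : ContinuousAt (fun q : G × OrthonormalFrame n M => q.1 • q.2.base) (g₀, z₀) :=
      continuousAt_fst.smul (continuous_base.continuousAt.comp continuousAt_snd)
    exact this (extChartAt_source_mem_nhds (I := 𝓡 n) _)
  refine tendsto_of_tendsto_coord h1 hd ?_
  have hl := (extChartAt (𝓡 d) g₀).left_inv hg₀
  have hf : ContMDiffAt (𝓘(ℝ, Euc d).prod (𝓡 n)) (𝓡 n) ∞
      (fun q : Euc d × M => (extChartAt (𝓡 d) g₀).symm q.1 • q.2)
      (extChartAt (𝓡 d) g₀ g₀, z₀.base) :=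
    ContMDiffAt.smul (I := 𝓡 d) (I' := 𝓡 n)
      (ContMDiffAt.comp (I' := 𝓘(ℝ, Euc d)) (g := (extChartAt (𝓡 d) g₀).symm) (f := Prod.fst)
        (extChartAt (𝓡 d) g₀ g₀, z₀.base)
        (contMDiffAt_extChartAt_symm ((extChartAt (𝓡 d) g₀).map_source hg₀)) contMDiffAt_fst)
      contMDiffAt_snd
  have h2 := contDiffAt_frameTrans_param hf h0 (x₁ := (g₀ • z₀).base)
    (show (extChartAt (𝓡 d) g₀).symm (extChartAt (𝓡 d) g₀ g₀) • z₀.base ∈ _ by rw [hl]; exact h1)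
    (p := coord z₀.base z₀) rfl
  have h3 : ContinuousAt (fun q : G × OrthonormalFrame n M =>
      (extChartAt (𝓡 d) g₀ q.1, coord z₀.base q.2)) (g₀, z₀) :=
    (ContinuousAt.comp (g := extChartAt (𝓡 d) g₀) (f := Prod.fst) (x := (g₀, z₀))
      (continuousAt_extChartAt g₀) continuousAt_fst).prodMk
      (ContinuousAt.comp (g := coord z₀.base) (f := Prod.snd) (x := (g₀, z₀))
        (continuousAt_coord h0) continuousAt_snd)
  have h4 := ContinuousAt.comp (f := fun q : G × OrthonormalFrame n M =>
      (extChartAt (𝓡 d) g₀ q.1, coord z₀.base q.2)) h2.continuousAt h3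
  have h5 : (fun q : G × OrthonormalFrame n M => coord (g₀ • z₀).base (q.1 • q.2)) =ᶠ[𝓝 (g₀, z₀)]
      (fun q : Euc d × Amb n => frameTrans (chartMap z₀.base (g₀ • z₀).base
        (fun x => (extChartAt (𝓡 d) g₀).symm q.1 • x)) q.2) ∘
        fun q : G × OrthonormalFrame n M => (extChartAt (𝓡 d) g₀ q.1, coord z₀.base q.2) := by
    filter_upwards [hd, continuousAt_fst (extChartAt_source_mem_nhds (I := 𝓡 d) g₀),
      continuousAt_snd (frameDom_mem_nhds h0)] with q hq hq1 hq2
    have h6 : (extChartAt (𝓡 d) g₀).symm (extChartAt (𝓡 d) g₀ q.1) = q.1 :=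
      (extChartAt (𝓡 d) g₀).left_inv hq1
    simp only [Function.comp_apply, h6]
    exact coord_smul q.1 hq2 hq
  exact (h4.congr h5.symm).tendsto

end SmoothAction

/-! ### Tangent spaces of the orbits -/

section OrbitTangent

variable {n : ℕ} {M : Type*} [TopologicalSpace M] [ChartedSpace (Euc n) M]
  [RiemannianBundle (fun x : M => TangentSpace (𝓡 n) x)] [IsManifold (𝓡 n) ∞ M]
  [IsContMDiffRiemannianBundle (𝓡 n) ∞ (Euc n) (fun x : M => TangentSpace (𝓡 n) x)]
  (d : ℕ) (G : Type*) [TopologicalSpace G] [ChartedSpace (Euc d) G] [Group G]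
  [LieGroup (𝓡 d) ∞ G] [MulAction G M] [ContMDiffSMul (𝓡 d) (𝓡 n) ∞ G M] [IsometricAction n M G]

/-- The differential at `1` of the orbit map. -/
def orbitDeriv (z : OrthonormalFrame n M) : Euc d →L[ℝ] SasakiSpace n :=
  sasakiDeriv (fun u : Euc d => (extChartAt (𝓡 d) (1 : G)).symm u • z) (extChartAt (𝓡 d) (1 : G) 1)

theorem orbitTangent_eq_range (z : OrthonormalFrame n M) :
    orbitTangent d G z = LinearMap.range (orbitDeriv d G z).toLinearMap := by
  rw [orbitTangent]
  simp only [sasakiVec_eq]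
  refine le_antisymm (Submodule.span_le.2 ?_) ?_
  · rintro _ ⟨v, rfl⟩
    exact ⟨v, rfl⟩
  · rintro _ ⟨v, rfl⟩
    exact Submodule.subset_span ⟨v, rfl⟩

variable {d G}

/-- Velocities of curves in the orbits. -/
theorem exists_sasakiDeriv_orbit {X : Type*} [NormedAddCommGroup X] [NormedSpace ℝ X]
    {α : X → G} {u : X} (hα : ContMDiffAt 𝓘(ℝ, X) (𝓡 d) ∞ α u) :
    ∃ L : X →L[ℝ] Euc d, ∀ z : OrthonormalFrame n M,
      sasakiDeriv (fun u' => α u' • z) u = (orbitDeriv d G z).comp L := by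
  set φ := extChartAt (𝓡 d) (1 : G) with hφ
  have h1 := mem_extChartAt_source (I := 𝓡 d) (1 : G)
  have hβ : ContMDiffAt 𝓘(ℝ, X) (𝓡 d) ∞ (fun u' => (α u)⁻¹ * α u') u :=
    contMDiffAt_const.mul hα
  have hβ1 : (α u)⁻¹ * α u = 1 := inv_mul_cancel _
  have hθ : ContDiffAt ℝ ∞ (fun u' => φ ((α u)⁻¹ * α u')) u := by
    rw [← contMDiffAt_iff_contDiffAt]
    have : ContMDiffAt (𝓡 d) 𝓘(ℝ, Euc d) ∞ φ ((α u)⁻¹ * α u) := by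
      rw [hβ1]; exact contMDiffAt_extChartAt
    exact ContMDiffAt.comp (I' := 𝓡 d) (g := φ) u this hβ
  have hev : ∀ᶠ u' in 𝓝 u, (α u)⁻¹ * α u' ∈ φ.source := by
    refine hβ.continuousAt ?_
    rw [hβ1]
    exact extChartAt_source_mem_nhds (I := 𝓡 d) (1 : G)
  refine ⟨fderiv ℝ (fun u' => φ ((α u)⁻¹ * α u')) u, fun z => ?_⟩
  -- Left translation by `α u` brings the curve to the identity of the group and leaves the values
  -- of the forms unchanged. The resulting `L` does not involve `z`.
  have he : (fun u' => α u' • z) =ᶠ[𝓝 u]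
      fun u' => α u • (φ.symm (φ ((α u)⁻¹ * α u')) • z) := by
    filter_upwards [hev] with u' hu'
    rw [φ.left_inv hu', smul_smul, mul_inv_cancel_left]
  have hs : SmoothFrameAt (fun a => φ.symm a • z) (φ ((α u)⁻¹ * α u)) := by
    refine smoothFrameAt_orbit ?_ z
    rw [hβ1]; exact φ.map_source h1
  rw [sasakiDeriv_congr he, sasakiDeriv_smul (α u) (hs.comp (θ := fun u' => φ ((α u)⁻¹ * α u')) hθ),
    sasakiDeriv_comp (ψ := fun a => φ.symm a • z) (θ := fun u' => φ ((α u)⁻¹ * α u')) hs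
      (hθ.differentiableAt (by simp)), hβ1]
  rfl

theorem sasakiDeriv_orbit_mem {X : Type*} [NormedAddCommGroup X] [NormedSpace ℝ X]
    {α : X → G} {u : X} (hα : ContMDiffAt 𝓘(ℝ, X) (𝓡 d) ∞ α u) (z : OrthonormalFrame n M) (v : X) :
    sasakiDeriv (fun u' => α u' • z) u v ∈ orbitTangent d G z := by
  obtain ⟨L, hL⟩ := exists_sasakiDeriv_orbit (n := n) (M := M) hα
  rw [hL, orbitTangent_eq_range]
  exact ⟨L v, rfl⟩

/-- The orbit map of `g • z` is the orbit map of `z` along the curves $a\mapsto\varphi^{-1}(a)g$,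
and all velocities in an orbit have the same values as velocities at the identity. The tangent
spaces at the two frames can be compared because both are given through the invariant parallelism.
-/
theorem orbitTangent_smul_le (g : G) (z : OrthonormalFrame n M) :
    orbitTangent d G (g • z) ≤ orbitTangent d G z := by
  rw [orbitTangent_eq_range]
  rintro _ ⟨v, rfl⟩
  set φ := extChartAt (𝓡 d) (1 : G) with hφ
  have h1 : φ 1 ∈ φ.target := φ.map_source (mem_extChartAt_source (I := 𝓡 d) (1 : G))
  have hα : ContMDiffAt 𝓘(ℝ, Euc d) (𝓡 d) ∞ (fun a => φ.symm a * g) (φ 1) :=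
    (contMDiffAt_extChartAt_symm h1).mul contMDiffAt_const
  have := sasakiDeriv_orbit_mem hα z v
  simp only [mul_smul] at this
  exact this

theorem orbitTangent_smul (g : G) (z : OrthonormalFrame n M) :
    orbitTangent d G (g • z) = orbitTangent d G z := by
  refine le_antisymm (orbitTangent_smul_le g z) ?_
  have := orbitTangent_smul_le (d := d) g⁻¹ (g • z)
  rwa [inv_smul_smul] at this

end OrbitTangent

/-! ### Rigidity of maps that preserve a parallelism -/

section RigidEstimate

/-- Maps that preserve a parallelism are close to the identity on a ball if they are
close to it at one point. -/
theorem exists_rigid_estimate {X N : Type*} [NormedAddCommGroup X] [NormedSpace ℝ X]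
    [FiniteDimensional ℝ X] [NormedAddCommGroup N] [NormedSpace ℝ N] {P : X → X →L[ℝ] N} {p₀ : X}
    (hP : ContDiffAt ℝ 1 P p₀) (hinj : Function.Injective (P p₀)) :
    ∃ R ∈ 𝓝 p₀, ∃ ε₀ > 0, ∀ ε ≤ ε₀, ∀ F : X → X, (∀ p ∈ Metric.ball p₀ ε, F p ∈ R) →
      (∀ p ∈ Metric.ball p₀ ε, ∃ F' : X →L[ℝ] X, HasFDerivAt F F' p ∧ (P (F p)).comp F' = P p) →
      ∀ p ∈ Metric.ball p₀ ε, ∀ p' ∈ Metric.ball p₀ ε, ‖F p - p‖ ≤ 2 * ‖F p' - p'‖ := by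
  obtain ⟨K, t, ht, hK⟩ := hP.exists_lipschitzOnWith
  obtain ⟨C, hC0, hC⟩ := (P p₀).toLinearMap.exists_antilipschitzWith
    (LinearMap.ker_eq_bot.2 hinj)
  have hC' : ∀ v, ‖v‖ ≤ C * ‖P p₀ v‖ := fun v => by
    simpa using hC.le_mul_dist v 0
  have hc : (0 : ℝ) < C := hC0
  -- A perturbation of `P p₀` by less than $1/(2C)$ costs at most a factor 2 in the lower bound.
  have hnear : ∀ᶠ p in 𝓝 p₀, ∀ v, ‖v‖ ≤ 2 * C * ‖P p v‖ := by
    have h1 : ∀ᶠ p in 𝓝 p₀, ‖P p - P p₀‖ < 1 / (2 * C) := by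
      have := hP.continuousAt.sub (continuousAt_const (y := P p₀))
      have h2 := this.norm.tendsto
      simp only [Pi.sub_apply, sub_self, norm_zero] at h2
      exact h2.eventually (gt_mem_nhds (by positivity))
    filter_upwards [h1] with p hp v
    have h2 : ‖P p₀ v‖ ≤ ‖P p v‖ + 1 / (2 * C) * ‖v‖ := by
      have e : P p₀ v = P p v - (P p - P p₀) v := by simp
      rw [e]
      refine (norm_sub_le _ _).trans (add_le_add le_rfl ?_)
      exact ((P p - P p₀).le_opNorm v).trans (by gcongr)
    have h3 := (hC' v).trans (mul_le_mul_of_nonneg_left h2 hc.le)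
    have h4 : C * (‖P p v‖ + 1 / (2 * C) * ‖v‖) = C * ‖P p v‖ + ‖v‖ / 2 := by
      field_simp
    rw [h4] at h3
    linarith
  obtain ⟨ε₁, hε₁, hball⟩ := Metric.mem_nhds_iff.1 (Filter.inter_mem ht hnear)
  -- The radius $1/(8C(K+1))$ makes the mean value inequality below gain a factor $1/2$.
  have hL : 0 < 8 * C * (K + 1) := by positivity
  refine ⟨Metric.ball p₀ ε₁, Metric.ball_mem_nhds p₀ hε₁, min ε₁ (1 / (8 * C * (K + 1))),
    lt_min hε₁ (by positivity), fun ε hε F hFR hF p hp p' hp' => ?_⟩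
  set B := Metric.ball p₀ ε with hB
  have hBs : B ⊆ Metric.ball p₀ ε₁ := Metric.ball_subset_ball (hε.trans (min_le_left _ _))
  choose! F' hF' hPF using hF
  -- As $P_{F(p)}F'=P_p$, one has $P_{F(p)}(F'-1)=P_p-P_{F(p)}$, which the Lipschitz bound for $P$
  -- controls by the displacement.
  have hd : ∀ p ∈ B, ‖F' p - ContinuousLinearMap.id ℝ X‖ ≤ 2 * C * K * ‖F p - p‖ := by
    intro p hp
    refine ContinuousLinearMap.opNorm_le_bound _ (by positivity) fun v => ?_
    have h1 := (hball (hFR p hp)).2 ((F' p - ContinuousLinearMap.id ℝ X) v)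
    have h2 : P (F p) ((F' p - ContinuousLinearMap.id ℝ X) v) = (P p - P (F p)) v := by
      have := DFunLike.congr_fun (hPF p hp) v
      simp only [ContinuousLinearMap.comp_apply] at this
      simp [this]
    rw [h2] at h1
    have h3 : ‖P p - P (F p)‖ ≤ K * ‖F p - p‖ := by
      have := hK.norm_sub_le (hball (hBs hp)).1 (hball (hFR p hp)).1
      rwa [norm_sub_rev p] at this
    have h4 := ((P p - P (F p)).le_opNorm v).trans (mul_le_mul_of_nonneg_right h3 (norm_nonneg v))
    calc _ ≤ 2 * C * ‖(P p - P (F p)) v‖ := h1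
      _ ≤ 2 * C * (K * ‖F p - p‖ * ‖v‖) := by gcongr
      _ = 2 * C * K * ‖F p - p‖ * ‖v‖ := by ring
  -- The derivative of the displacement is bounded by its supremum $S$, so $S\le\|F(p')-p'\|+S/2$ on
  -- the small ball; $S$ is finite because `F` maps the ball into a bounded set.
  set T : Set ℝ := (fun p => ‖F p - p‖) '' B with hT
  have hTb : BddAbove T := by
    refine ⟨2 * ε₁, ?_⟩
    rintro _ ⟨p, hp, rfl⟩
    have h1 := hFR p hp
    have h2 := hBs hp
    rw [mem_ball_iff_norm] at h1 h2
    have : F p - p = (F p - p₀) - (p - p₀) := by abel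
    simp only
    rw [this]
    exact (norm_sub_le _ _).trans (by linarith)
  set S := sSup T with hS
  have hle : ∀ p ∈ B, ‖F p - p‖ ≤ S := fun p hp => le_csSup hTb ⟨p, hp, rfl⟩
  have hS0 : 0 ≤ S := (norm_nonneg _).trans (hle p hp)
  have hmv : ∀ p ∈ B, ‖F p - p‖ ≤ ‖F p' - p'‖ + S / 2 := by
    intro p hp
    have h1 := (convex_ball p₀ ε).norm_image_sub_le_of_norm_hasFDerivWithin_le
      (f := fun p => F p - p) (f' := fun p => F' p - ContinuousLinearMap.id ℝ X)
      (C := 2 * C * K * S)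
      (fun p hp => ((hF' p hp).sub (hasFDerivAt_id p)).hasFDerivWithinAt)
      (fun p hp => (hd p hp).trans (by gcongr; exact hle p hp)) hp' hp
    have h2 : ‖p - p'‖ ≤ 2 * ε := by
      have h1 := mem_ball_iff_norm.1 hp
      have h2 := mem_ball_iff_norm.1 hp'
      have : p - p' = (p - p₀) - (p' - p₀) := by abel
      rw [this]
      exact (norm_sub_le _ _).trans (by linarith)
    have h3 : ε ≤ 1 / (8 * C * (K + 1)) := hε.trans (min_le_right _ _)
    have h4 : 2 * C * K * S * ‖p - p'‖ ≤ S / 2 := by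
      calc 2 * C * K * S * ‖p - p'‖ ≤ 2 * C * K * S * (2 * (1 / (8 * C * (K + 1)))) := by
            gcongr
            linarith
        _ = S / 2 * (K / (K + 1)) := by field_simp; ring
        _ ≤ S / 2 * 1 := by
            gcongr
            rw [div_le_one (by positivity)]
            linarith
        _ = S / 2 := mul_one _
    have h5 : ‖F p - p‖ ≤ ‖F p' - p'‖ + ‖(F p - p) - (F p' - p')‖ := by
      have : F p - p = (F p' - p') + ((F p - p) - (F p' - p')) := by abel
      conv_lhs => rw [this]
      exact norm_add_le _ _
    linarith
  have hS2 : S ≤ ‖F p' - p'‖ + S / 2 := by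
    refine csSup_le ⟨_, ⟨p, hp, rfl⟩⟩ ?_
    rintro _ ⟨p, hp, rfl⟩
    exact hmv p hp
  linarith [hle p hp]

end RigidEstimate

/-! ### Fixed points and zeros of Killing fields form open sets of frames -/

section Rigidity

variable {n : ℕ} {M : Type*} [TopologicalSpace M] [ChartedSpace (Euc n) M]
  [RiemannianBundle (fun x : M => TangentSpace (𝓡 n) x)] [IsManifold (𝓡 n) ∞ M]
  [IsContMDiffRiemannianBundle (𝓡 n) ∞ (Euc n) (fun x : M => TangentSpace (𝓡 n) x)]

theorem ProductChart.isOpen_source {k q : ℕ} (C : ProductChart n M k q) :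
    IsOpen (C.fst ×ˢ C.snd) := C.isOpen_fst.prod C.isOpen_snd

theorem ProductChart.continuousAt_inv {k q : ℕ} (C : ProductChart n M k q)
    {z : OrthonormalFrame n M} (hz : z ∈ C.target) : ContinuousAt C.inv z :=
  (C.smooth_inv z hz).continuousAt

/-- The derivative of a family of frames, in a product chart. -/
theorem ProductChart.sasakiDeriv_inv {k q : ℕ} (C : ProductChart n M k q) {X : Type*}
    [NormedAddCommGroup X] [NormedSpace ℝ X] {ζ : X → OrthonormalFrame n M} {u : X}
    (hζ : SmoothFrameAt ζ u) (hu : ζ u ∈ C.target) :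
    ContDiffAt ℝ ∞ (fun u => C.inv (ζ u)) u ∧
      sasakiDeriv ζ u = (sasakiDeriv C.toFun (C.inv (ζ u))).comp
        (fderiv ℝ (fun u => C.inv (ζ u)) u) := by
  have h1 : ContDiffAt ℝ ∞ (fun u => C.inv (ζ u)) u := (C.smooth_inv _ hu).contDiffAt hζ
  refine ⟨h1, ?_⟩
  have he : ζ =ᶠ[𝓝 u] fun u => C.toFun (C.inv (ζ u)) := by
    filter_upwards [hζ.1 (C.isOpen_target.mem_nhds hu)] with u' hu'
    exact (C.right_inv _ hu').symm
  rw [sasakiDeriv_congr he, sasakiDeriv_comp (ψ := C.toFun) (θ := fun u => C.inv (ζ u))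
    (C.smooth_toFun _ (C.inv_mem _ hu)) (h1.differentiableAt (by simp))]

variable {d : ℕ} {G : Type*} [TopologicalSpace G] [ChartedSpace (Euc d) G] [Group G]
  [LieGroup (𝓡 d) ∞ G] [MulAction G M] [ContMDiffSMul (𝓡 d) (𝓡 n) ∞ G M] [IsometricAction n M G]

/-- In the chart every group element preserves the parallelism `sasakiDeriv C.toFun`. The
neighbourhood `B` serves all `g` near `g₀` at once, which permits the differentiation of the
estimate along curves in the group. -/
theorem ProductChart.exists_rigid {k q : ℕ} (C : ProductChart n M k q) {z₀ : OrthonormalFrame n M}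
    (hz₀ : z₀ ∈ C.target) (d : ℕ) {G : Type*} [TopologicalSpace G] [ChartedSpace (Euc d) G]
    [Group G] [LieGroup (𝓡 d) ∞ G] [MulAction G M] [ContMDiffSMul (𝓡 d) (𝓡 n) ∞ G M]
    [IsometricAction n M G] {g₀ : G} (hg₀ : g₀ • z₀ = z₀) :
    ∃ B ∈ 𝓝 (C.inv z₀), B ⊆ C.fst ×ˢ C.snd ∧ ∀ᶠ g in 𝓝 g₀, ∀ p ∈ B, g • C.toFun p ∈ C.target ∧
      ∀ p' ∈ B, ‖C.inv (g • C.toFun p) - p‖ ≤ 2 * ‖C.inv (g • C.toFun p') - p'‖ := by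
  have hcs : ContinuousSMul G (OrthonormalFrame n M) := continuousSMul_frame d G
  set p₀ := C.inv z₀ with hp₀
  have hp₀C : p₀ ∈ C.fst ×ˢ C.snd := C.inv_mem z₀ hz₀
  have hΨ₀ : C.toFun p₀ = z₀ := C.right_inv z₀ hz₀
  have hsm : ∀ᶠ p in 𝓝 p₀, SmoothFrameAt C.toFun p := by
    filter_upwards [C.isOpen_source.mem_nhds hp₀C] with p hp using C.smooth_toFun p hp
  obtain ⟨R, hR, ε₀, hε₀, hest⟩ := exists_rigid_estimate
    ((contDiffAt_sasakiDeriv hsm).of_le (by simp)) (C.sasakiDeriv_injective hp₀C)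
  have hc : ContinuousAt (fun q : G × (Euc k × Euc q) => q.1 • C.toFun q.2) (g₀, p₀) :=
    continuousAt_fst.smul (ContinuousAt.comp (g := C.toFun) (f := Prod.snd) (x := (g₀, p₀))
      (C.smooth_toFun p₀ hp₀C).1 continuousAt_snd)
  have hv : g₀ • C.toFun p₀ = z₀ := by rw [hΨ₀, hg₀]
  have ht : ∀ᶠ q : G × (Euc k × Euc q) in 𝓝 (g₀, p₀), q.1 • C.toFun q.2 ∈ C.target :=
    hc (by simp only [hv]; exact C.isOpen_target.mem_nhds hz₀)
  have hi : ∀ᶠ q : G × (Euc k × Euc q) in 𝓝 (g₀, p₀), C.inv (q.1 • C.toFun q.2) ∈ R := by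
    have : ContinuousAt (fun q : G × (Euc k × Euc q) => C.inv (q.1 • C.toFun q.2)) (g₀, p₀) :=
      ContinuousAt.comp (g := C.inv) (by simp only [hv]; exact C.continuousAt_inv hz₀) hc
    exact this (by simp only [hv]; exact hR)
  have hs : ∀ᶠ q : G × (Euc k × Euc q) in 𝓝 (g₀, p₀), q.2 ∈ C.fst ×ˢ C.snd :=
    continuousAt_snd (C.isOpen_source.mem_nhds hp₀C)
  have hall := (ht.and hi).and hs
  rw [nhds_prod_eq] at hall
  obtain ⟨pa, hpa, pb, hpb, hab⟩ := Filter.eventually_prod_iff.1 hall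
  obtain ⟨ε₁, hε₁, hball⟩ := Metric.mem_nhds_iff.1 hpb
  refine ⟨Metric.ball p₀ (min ε₀ ε₁), Metric.ball_mem_nhds _ (lt_min hε₀ hε₁), ?_, ?_⟩
  · intro p hp
    exact (hab hpa.self_of_nhds (hball (Metric.ball_subset_ball (min_le_right _ _) hp))).2
  · filter_upwards [hpa] with g hg p hp
    have hb : ∀ p ∈ Metric.ball p₀ (min ε₀ ε₁), _ := fun p hp =>
      hab hg (hball (Metric.ball_subset_ball (min_le_right _ _) hp))
    refine ⟨(hb p hp).1.1, fun p' hp' => hest _ (min_le_left _ _)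
      (fun p => C.inv (g • C.toFun p)) (fun p hp => (hb p hp).1.2) (fun p hp => ?_) p hp p' hp'⟩
    have hΨ := C.smooth_toFun p (hb p hp).2
    have h1 := C.sasakiDeriv_inv (hΨ.smul g) (hb p hp).1.1
    refine ⟨_, (h1.1.differentiableAt (by simp)).hasFDerivAt, ?_⟩
    rw [← h1.2, sasakiDeriv_smul g hΨ]

/-- The fixed point set of an isometry in the frame bundle is open. -/
theorem eventually_smul_eq (d : ℕ) {G : Type*} [TopologicalSpace G] [ChartedSpace (Euc d) G]
    [Group G] [LieGroup (𝓡 d) ∞ G] [MulAction G M] [ContMDiffSMul (𝓡 d) (𝓡 n) ∞ G M]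
    [IsometricAction n M G] {g : G} {z₀ : OrthonormalFrame n M} (hg : g • z₀ = z₀) :
    ∀ᶠ z in 𝓝 z₀, g • z = z := by
  obtain ⟨C, hz₀, -⟩ := exists_bundleChart z₀
  obtain ⟨B, hB, hBs, hev⟩ := C.exists_rigid hz₀ d hg
  filter_upwards [C.continuousAt_inv hz₀ hB, C.isOpen_target.mem_nhds hz₀] with z hz hzC
  have h1 := hev.self_of_nhds _ hz
  -- The displacement is compared with that of `z₀`, which is zero.
  have h2 := h1.2 _ (mem_of_mem_nhds hB)
  rw [C.right_inv z hzC] at h1 h2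
  rw [C.right_inv z₀ hz₀, hg, sub_self, norm_zero, mul_zero] at h2
  have h3 := sub_eq_zero.1 (norm_le_zero_iff.1 h2)
  rw [← C.right_inv _ h1.1, h3, C.right_inv z hzC]

/-- The zero set of a Killing field in the frame bundle is open. -/
theorem eventually_orbitDeriv_eq_zero {v : Euc d} {z₀ : OrthonormalFrame n M}
    (hv : orbitDeriv d G z₀ v = 0) : ∀ᶠ z in 𝓝 z₀, orbitDeriv d G z v = 0 := by
  obtain ⟨C, hz₀, -⟩ := exists_bundleChart z₀
  obtain ⟨B, hB, hBs, hev⟩ := C.exists_rigid hz₀ d (one_smul G z₀)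
  set φ := extChartAt (𝓡 d) (1 : G) with hφ
  have h1 : φ 1 ∈ φ.target := φ.map_source (mem_extChartAt_source (I := 𝓡 d) (1 : G))
  have hφ1 : φ.symm (φ 1) = 1 := φ.left_inv (mem_extChartAt_source (I := 𝓡 d) (1 : G))
  let f : OrthonormalFrame n M → ℝ → Euc (n.choose 2) × Euc n := fun z t =>
    C.inv (φ.symm (φ 1 + t • v) • z)
  have hl0 : φ 1 + (0 : ℝ) • v = φ 1 := by simp
  have hlc : ContDiff ℝ ∞ (fun t : ℝ => φ 1 + t • v) :=
    contDiff_const.add (contDiff_id.smul contDiff_const)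
  have hld : HasDerivAt (fun t : ℝ => φ 1 + t • v) v 0 := by
    have := ((hasDerivAt_id (0 : ℝ)).smul_const v).const_add (φ 1)
    simpa using this
  have hf : ∀ z ∈ C.target, ∃ ξ, HasDerivAt (f z) ξ 0 ∧
      sasakiDeriv C.toFun (C.inv z) ξ = orbitDeriv d G z v := by
    intro z hz
    have hζ : SmoothFrameAt (fun a => φ.symm a • z) (φ 1 + (0 : ℝ) • v) := by
      rw [hl0]; exact smoothFrameAt_orbit h1 z
    have hzt : φ.symm (φ 1 + (0 : ℝ) • v) • z ∈ C.target := by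
      rw [hl0, hφ1, one_smul]; exact hz
    have h2 := C.sasakiDeriv_inv hζ hzt
    have hF := (h2.1.differentiableAt (by simp)).hasFDerivAt
    refine ⟨_, HasFDerivAt.comp_hasDerivAt (l := fun a => C.inv (φ.symm a • z))
      (f := fun t : ℝ => φ 1 + t • v) (0 : ℝ) hF hld, ?_⟩
    have h3 := DFunLike.congr_fun h2.2 v
    rw [ContinuousLinearMap.comp_apply] at h3
    rw [hl0, hφ1, one_smul] at h3
    rw [hl0]
    exact h3.symm
  have hf0 : ∀ z, f z 0 = C.inv z := fun z => by
    simp only [f, hl0, hφ1, one_smul]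
  obtain ⟨ξ₀, hξ₀, hξ₀'⟩ := hf z₀ hz₀
  rw [hv] at hξ₀'
  have hξ : ξ₀ = 0 := C.sasakiDeriv_injective (C.inv_mem z₀ hz₀) (by rw [hξ₀', map_zero])
  rw [hξ] at hξ₀
  filter_upwards [C.continuousAt_inv hz₀ hB, C.isOpen_target.mem_nhds hz₀] with z hz hzC
  obtain ⟨ξ, hξ, hξ'⟩ := hf z hzC
  have hgt : Filter.Tendsto (fun t : ℝ => φ.symm (φ 1 + t • v)) (𝓝 0) (𝓝 1) := by
    have h2 : ContinuousAt φ.symm (φ 1 + (0 : ℝ) • v) := by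
      rw [hl0]; exact continuousAt_extChartAt_symm'' h1
    have := (ContinuousAt.comp (g := φ.symm) (f := fun t : ℝ => φ 1 + t • v) (x := 0) h2
      hlc.continuous.continuousAt).tendsto
    simp only [Function.comp_def, hl0, hφ1] at this
    exact this
  -- At `z₀` the displacement along the curve through the identity is $o(t)$; hence it is $o(t)$ at
  -- nearby frames, and the velocity there vanishes.
  have hle : ∀ᶠ t in 𝓝 (0 : ℝ), ‖f z t - f z 0‖ ≤ 2 * ‖f z₀ t - f z₀ 0‖ := by
    filter_upwards [hgt.eventually hev] with t ht
    have := (ht _ hz).2 _ (mem_of_mem_nhds hB)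
    rw [C.right_inv z hzC, C.right_inv z₀ hz₀] at this
    rw [hf0, hf0]
    exact this
  have h4 : HasDerivAt (f z) 0 0 := by
    rw [hasDerivAt_iff_isLittleO] at hξ₀ ⊢
    simp only [smul_zero, sub_zero] at hξ₀ ⊢
    exact (Asymptotics.IsBigO.of_bound 2 hle).trans_isLittleO hξ₀
  rw [← hξ', hξ.unique h4, map_zero]

end Rigidity

/-! ### From one frame to all frames: constancy of the orbit dimension -/

section Fibres

variable {n : ℕ} {M : Type*} [TopologicalSpace M] [ChartedSpace (Euc n) M]
  [RiemannianBundle (fun x : M => TangentSpace (𝓡 n) x)]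

theorem exists_frame (x : M) : ∃ z : OrthonormalFrame n M, z.base = x := by
  have : FiniteDimensional ℝ (TangentSpace (𝓡 n) x) :=
    inferInstanceAs (FiniteDimensional ℝ (Euc n))
  have h : Module.finrank ℝ (TangentSpace (𝓡 n) x) = n := by
    have : Module.finrank ℝ (Euc n) = n := by simp
    exact this
  exact ⟨⟨x, (((stdOrthonormalBasis ℝ (TangentSpace (𝓡 n) x)).reindex (finCongr h)).repr).symm⟩, rfl⟩

theorem exists_orth_smul_eq {z w : OrthonormalFrame n M} (h : z.base = w.base) :
    ∃ k : OrthGroup n, k • z = w := by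
  obtain ⟨x, f⟩ := z
  obtain ⟨y, f'⟩ := w
  obtain rfl : x = y := h
  refine ⟨(Unitary.linearIsometryEquiv.symm (f'.trans f.symm))⁻¹, ext_vec rfl fun v => ?_⟩
  rw [orth_smul_vec, inv_inv, MulEquiv.apply_symm_apply]
  simp [vec]

theorem smul_orth_smul {G : Type*} [Group G] [MulAction G M] [IsometricAction n M G] (g : G)
    (k : OrthGroup n) (z : OrthonormalFrame n M) [IsManifold (𝓡 n) ∞ M] : g • k • z = k • g • z := rfl

variable [IsManifold (𝓡 n) ∞ M]
  [IsContMDiffRiemannianBundle (𝓡 n) ∞ (Euc n) (fun x : M => TangentSpace (𝓡 n) x)]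

/-- There are continuous local sections: fix the fibre coordinate of a product chart. -/
theorem isOpenMap_base : IsOpenMap (OrthonormalFrame.base : OrthonormalFrame n M → M) := by
  refine IsOpenMap.of_nhds_le fun z₀ => ?_
  intro V hV
  obtain ⟨C, hz₀, hC⟩ := exists_bundleChart z₀
  set φ := extChartAt (𝓡 n) z₀.base
  have hp₀ := C.inv_mem z₀ hz₀
  set s₀ := (C.inv z₀).1
  have hb := hC s₀ hp₀.1 (C.inv z₀).2 hp₀.2
  have h1 : C.toFun (s₀, (C.inv z₀).2) = z₀ := C.right_inv z₀ hz₀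
  rw [h1] at hb
  have h2 : φ z₀.base = (C.inv z₀).2 := by rw [hb.2]; exact φ.right_inv hb.1
  have h3 : ContinuousAt (fun x => C.toFun (s₀, φ x)) z₀.base := by
    have h4 : ContinuousAt C.toFun (s₀, φ z₀.base) := by
      rw [h2]; exact (C.smooth_toFun (s₀, (C.inv z₀).2) hp₀).1
    exact ContinuousAt.comp (g := C.toFun) (f := fun x => (s₀, φ x)) h4
      (continuousAt_const.prodMk (continuousAt_extChartAt z₀.base))
  have h5 : ∀ᶠ x in 𝓝 z₀.base, C.toFun (s₀, φ x) ∈ OrthonormalFrame.base ⁻¹' V := by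
    refine h3 ?_
    simp only [h2, h1]
    exact hV
  have h6 : ∀ᶠ x in 𝓝 z₀.base, φ x ∈ C.snd :=
    (continuousAt_extChartAt z₀.base) (C.isOpen_snd.mem_nhds (by rw [h2]; exact hp₀.2))
  filter_upwards [h5, h6, extChartAt_source_mem_nhds (I := 𝓡 n) z₀.base] with x hx hx' hx''
  have h7 := (hC s₀ hp₀.1 _ hx').2
  rw [φ.left_inv hx''] at h7
  rw [← h7]
  exact hx

/-- A property of frames that is open and closed and invariant under `O(n)`. -/
theorem forall_of_isOpen [ConnectedSpace M] {A : Set (OrthonormalFrame n M)} (hA : IsOpen A)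
    (hA' : IsOpen Aᶜ) (hk : ∀ (k : OrthGroup n), ∀ z ∈ A, k • z ∈ A) {z₀ : OrthonormalFrame n M}
    (hz₀ : z₀ ∈ A) (z : OrthonormalFrame n M) : z ∈ A := by
  have h1 : IsOpen (OrthonormalFrame.base '' A) := isOpenMap_base _ hA
  have h2 : IsOpen (OrthonormalFrame.base '' Aᶜ) := isOpenMap_base _ hA'
  -- The frame bundle of a connected manifold may be disconnected, so connectedness is used on $M$:
  -- since $O(n)$ is transitive on the fibres, an invariant set is a union of fibres.
  have h3 : (OrthonormalFrame.base '' A)ᶜ = OrthonormalFrame.base '' Aᶜ := by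
    ext x
    constructor
    · intro hx
      obtain ⟨z, rfl⟩ := exists_frame (n := n) x
      exact ⟨z, fun hz => hx ⟨z, hz, rfl⟩, rfl⟩
    · rintro ⟨z, hz, rfl⟩ ⟨w, hw, hwz⟩
      obtain ⟨k, rfl⟩ := exists_orth_smul_eq hwz
      exact hz (hk k w hw)
  have h4 : IsClopen (OrthonormalFrame.base '' A) := ⟨⟨by rw [h3]; exact h2⟩, h1⟩
  have h5 : OrthonormalFrame.base '' A = Set.univ := h4.eq_univ ⟨_, z₀, hz₀, rfl⟩
  have h6 : z.base ∈ OrthonormalFrame.base '' A := by rw [h5]; trivial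
  obtain ⟨w, hw, hwz⟩ := h6
  obtain ⟨k, rfl⟩ := exists_orth_smul_eq hwz
  exact hk k w hw

/-- An isometry that fixes a frame is the identity. -/
theorem smul_eq_of_smul_eq [T2Space M] [ConnectedSpace M] (d : ℕ) {G : Type*} [TopologicalSpace G]
    [ChartedSpace (Euc d) G] [Group G] [LieGroup (𝓡 d) ∞ G] [MulAction G M]
    [ContMDiffSMul (𝓡 d) (𝓡 n) ∞ G M] [IsometricAction n M G] {g : G} {z₀ : OrthonormalFrame n M}
    (hg : g • z₀ = z₀) (z : OrthonormalFrame n M) : g • z = z := by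
  refine forall_of_isOpen (A := {z | g • z = z}) (isOpen_iff_mem_nhds.2 fun z hz =>
    eventually_smul_eq d hz) ?_ (fun k z hz => ?_) hg z
  · have : IsClosed {z : OrthonormalFrame n M | g • z = z} := isClosed_eq
      (continuous_iff_continuousAt.2 fun z => continuousAt_smul_frame g z) continuous_id
    exact this.isOpen_compl
  · have hz' : g • z = z := hz
    change g • k • z = k • z
    rw [smul_orth_smul, hz']

variable {d : ℕ} {G : Type*} [TopologicalSpace G] [ChartedSpace (Euc d) G] [Group G]
  [LieGroup (𝓡 d) ∞ G] [MulAction G M] [ContMDiffSMul (𝓡 d) (𝓡 n) ∞ G M] [IsometricAction n M G]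

/-- The orbit derivative is a partial derivative of the jointly smooth map
$(p,a)\mapsto\varphi^{-1}(a)\cdot C(p)$. -/
theorem continuous_orbitDeriv :
    Continuous (fun z : OrthonormalFrame n M => orbitDeriv d G z) := by
  refine continuous_iff_continuousAt.2 fun z₀ => ?_
  obtain ⟨C, hz₀, -⟩ := exists_bundleChart z₀
  set φ := extChartAt (𝓡 d) (1 : G) with hφ
  have h1 : φ 1 ∈ φ.target := φ.map_source (mem_extChartAt_source (I := 𝓡 d) (1 : G))
  have ho : IsOpen φ.target := isOpen_extChartAt_target (1 : G)
  let Z : (Euc (n.choose 2) × Euc n) × Euc d → OrthonormalFrame n M := fun q =>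
    φ.symm q.2 • C.toFun q.1
  have hZ : ∀ q ∈ (C.fst ×ˢ C.snd) ×ˢ φ.target, SmoothFrameAt Z q := by
    intro q hq
    refine smoothFrameAt_smul_param (d := d) (α := fun q : (Euc (n.choose 2) × Euc n) × Euc d => φ.symm q.2)
      ?_ (SmoothFrameAt.comp (θ := Prod.fst) (C.smooth_toFun q.1 hq.1) contDiffAt_fst)
    exact ContMDiffAt.comp (I' := 𝓘(ℝ, Euc d)) (g := φ.symm) (f := Prod.snd) q
      (contMDiffAt_extChartAt_symm hq.2) (contMDiffAt_iff_contDiffAt.2 contDiffAt_snd)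
  have hp₀ := C.inv_mem z₀ hz₀
  have hc : ContinuousAt (sasakiDeriv Z) (C.inv z₀, φ 1) := by
    refine continuousAt_sasakiDeriv ?_
    filter_upwards [(C.isOpen_source.prod ho).mem_nhds 
      (Set.mk_mem_prod hp₀ h1)] with q hq
    exact hZ q hq
  have he : ∀ p ∈ C.fst ×ˢ C.snd, orbitDeriv d G (C.toFun p) =
      (sasakiDeriv Z (p, φ 1)).comp (ContinuousLinearMap.inr ℝ _ _) := by
    intro p hp
    have := sasakiDeriv_comp (ψ := Z) (θ := fun a => (p, a)) (y := φ 1) (hZ (p, φ 1) ⟨hp, h1⟩)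
      ((differentiableAt_const p).prodMk differentiableAt_id)
    have hd : HasFDerivAt (𝕜 := ℝ) (fun a : Euc d => (p, a)) (ContinuousLinearMap.inr ℝ _ _) (φ 1) :=
      hasFDerivAt_prodMk_right p (φ 1)
    rw [hd.fderiv] at this
    exact this
  have hc' : ContinuousAt (fun z => (sasakiDeriv Z (C.inv z, φ 1)).comp
      (ContinuousLinearMap.inr ℝ (Euc (n.choose 2) × Euc n) (Euc d))) z₀ := by
    refine ContinuousAt.clm_comp ?_ continuousAt_const
    exact ContinuousAt.comp (g := sasakiDeriv Z) (f := fun z => (C.inv z, φ 1)) hc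
      ((C.continuousAt_inv hz₀).prodMk continuousAt_const)
  refine hc'.congr ?_
  filter_upwards [C.isOpen_target.mem_nhds hz₀] with z hz
  rw [← he _ (C.inv_mem z hz), C.right_inv z hz]

/-- The group $O(n)$ does not leave the values of the forms invariant, so the vanishing is compared
in coordinates, where `k` acts by a constant linear map and commutes with $G$. -/
theorem orbitDeriv_orth_smul {z : OrthonormalFrame n M} {v : Euc d} (hv : orbitDeriv d G z v = 0)
    (k : OrthGroup n) : orbitDeriv d G (k • z) v = 0 := by
  set φ := extChartAt (𝓡 d) (1 : G) with hφ
  have h1 : φ 1 ∈ φ.target := φ.map_source (mem_extChartAt_source (I := 𝓡 d) (1 : G))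
  have hs := smoothFrameAt_orbit h1 z
  have hs' := smoothFrameAt_orbit h1 (k • z)
  have h2 := (sasakiDeriv_eq_zero_iff hs (mem_frameDom_self _) v).1 hv
  set x₀ := (φ.symm (φ 1) • z).base
  refine (sasakiDeriv_eq_zero_iff hs' (x₀ := x₀) (mem_frameDom_self (φ.symm (φ 1) • z)) v).2 ?_
  let R : Amb n →L[ℝ] Amb n := (ContinuousLinearMap.fst ℝ _ _).prod
    (((ContinuousLinearMap.compL ℝ (Euc n) (Euc n) (Euc n)).flip
      ((k⁻¹ : OrthGroup n) : Euc n →L[ℝ] Euc n)).comp (ContinuousLinearMap.snd ℝ _ _))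
  have h3 : (fun a => coord x₀ (φ.symm a • k • z)) = fun a => R (coord x₀ (φ.symm a • z)) := by
    funext a
    rw [smul_orth_smul, coord_orth_smul]
    rfl
  have h4 := R.hasFDerivAt.comp (φ 1) (hs.2.differentiableAt (by simp)).hasFDerivAt
  rw [h3]
  have h5 := h4.fderiv
  simp only [Function.comp_def] at h5
  rw [h5, ContinuousLinearMap.comp_apply, h2, map_zero]

/-- A Killing field that vanishes at a frame is zero. -/
theorem orbitDeriv_eq_zero [ConnectedSpace M] {v : Euc d} {z₀ : OrthonormalFrame n M}
    (hv : orbitDeriv d G z₀ v = 0) (z : OrthonormalFrame n M) : orbitDeriv d G z v = 0 := by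
  refine forall_of_isOpen (A := {z | orbitDeriv d G z v = 0}) (isOpen_iff_mem_nhds.2 fun z hz =>
    eventually_orbitDeriv_eq_zero hz) ?_ (fun k z hz => orbitDeriv_orth_smul hz k) hv z
  have : IsClosed {z : OrthonormalFrame n M | orbitDeriv d G z v = 0} := isClosed_eq
    (continuous_orbitDeriv.clm_apply continuous_const) continuous_const
  exact this.isOpen_compl

theorem ker_orbitDeriv [ConnectedSpace M] (z w : OrthonormalFrame n M) :
    LinearMap.ker (orbitDeriv d G z).toLinearMap = LinearMap.ker (orbitDeriv d G w).toLinearMap := by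
  ext v
  exact ⟨fun h => orbitDeriv_eq_zero h w, fun h => orbitDeriv_eq_zero h z⟩

/-- The kernel of the orbit derivative is the same at all frames; rank and nullity do the rest. -/
theorem finrank_orbitTangent [ConnectedSpace M] (z w : OrthonormalFrame n M) :
    Module.finrank ℝ (orbitTangent d G z) = Module.finrank ℝ (orbitTangent d G w) := by
  have h1 := LinearMap.finrank_range_add_finrank_ker (orbitDeriv d G z).toLinearMap
  have h2 := LinearMap.finrank_range_add_finrank_ker (orbitDeriv d G w).toLinearMap
  rw [orbitTangent_eq_range, orbitTangent_eq_range]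
  rw [ker_orbitDeriv z w] at h1
  exact Nat.add_right_cancel (h1.trans h2.symm)

end Fibres

/-! ### Charts adapted to the orbits -/

section Slice

/-- For the derivative `A` of an orbit map, `ι` selects directions in the group that parametrize the
orbit infinitesimally without redundancy, as the stabilizer may have positive dimension, and `ι₂`
selects directions transversal to the orbit. -/
theorem exists_adapted_complement {V X : Type*} [NormedAddCommGroup V] [NormedSpace ℝ V]
    [FiniteDimensional ℝ V] [NormedAddCommGroup X] [NormedSpace ℝ X] [FiniteDimensional ℝ X]
    (A : V →ₗ[ℝ] X) {r q : ℕ} (hr : Module.finrank ℝ (LinearMap.range A) = r)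
    (hq : r + q = Module.finrank ℝ X) :
    ∃ (ι : Euc r →L[ℝ] V) (ι₂ : Euc q →L[ℝ] X),
      ∀ (s : Euc r) (η : Euc q), A (ι s) + ι₂ η = 0 → s = 0 ∧ η = 0 := by
  obtain ⟨T, hT⟩ := (LinearMap.range A).exists_isCompl
  have hTq : Module.finrank ℝ T = q := by
    have := Submodule.finrank_add_eq_of_isCompl hT
    omega
  let e : Euc r ≃ₗ[ℝ] LinearMap.range A := LinearEquiv.ofFinrankEq _ _ (by simp [hr])
  let e₂ : Euc q ≃ₗ[ℝ] T := LinearEquiv.ofFinrankEq _ _ (by simp [hTq])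
  obtain ⟨g, hg⟩ := A.rangeRestrict.exists_rightInverse_of_surjective A.range_rangeRestrict
  refine ⟨LinearMap.toContinuousLinearMap (g ∘ₗ e.toLinearMap),
    LinearMap.toContinuousLinearMap (T.subtype ∘ₗ e₂.toLinearMap), fun s η h => ?_⟩
  have h1 : A (g (e s)) = (e s : X) := congrArg Subtype.val (DFunLike.congr_fun hg (e s))
  have h2 : A (g (e s)) + (e₂ η : X) = 0 := h
  rw [h1] at h2
  have h3 : (e s : X) ∈ LinearMap.range A ⊓ T := by
    refine ⟨(e s).2, ?_⟩
    rw [eq_neg_of_add_eq_zero_left h2]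
    exact T.neg_mem (e₂ η).2
  rw [hT.inf_eq_bot, Submodule.mem_bot] at h3
  rw [h3, zero_add] at h2
  exact ⟨e.map_eq_zero_iff.1 (Subtype.ext h3), e₂.map_eq_zero_iff.1 (Subtype.ext h2)⟩

variable {n : ℕ} {M : Type*} [TopologicalSpace M] [ChartedSpace (Euc n) M]
  [RiemannianBundle (fun x : M => TangentSpace (𝓡 n) x)] [IsManifold (𝓡 n) ∞ M]
  {d : ℕ} {G : Type*} [TopologicalSpace G] [ChartedSpace (Euc d) G] [Group G]
  [MulAction G M] [IsometricAction n M G]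

/-- A chart which is the product of a piece of the group and a transversal to the orbits. -/
structure IsOrbitChart (d : ℕ) {G : Type*} [TopologicalSpace G] [ChartedSpace (Euc d) G] [Group G]
    [MulAction G M] [IsometricAction n M G] {r q : ℕ} (C : ProductChart n M r q) (c : Euc r → G)
    (ψ : Euc q → OrthonormalFrame n M) : Prop where
  contMDiffAt : ∀ u ∈ C.fst, ContMDiffAt 𝓘(ℝ, Euc r) (𝓡 d) ∞ c u
  smooth : ∀ y ∈ C.snd, SmoothFrameAt ψ y
  toFun_eq : ∀ p ∈ C.fst ×ˢ C.snd, C.toFun p = c p.1 • ψ p.2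
  zero_mem : (0, 0) ∈ C.fst ×ˢ C.snd
  map_zero : c 0 = 1

variable [LieGroup (𝓡 d) ∞ G] [ContMDiffSMul (𝓡 d) (𝓡 n) ∞ G M]
  [IsContMDiffRiemannianBundle (𝓡 n) ∞ (Euc n) (fun x : M => TangentSpace (𝓡 n) x)]

theorem finrank_orbitTangent_le (z₀ : OrthonormalFrame n M) :
    Module.finrank ℝ (orbitTangent d G z₀) ≤ n + n.choose 2 := by
  obtain ⟨C₀, hz₀, -⟩ := exists_bundleChart z₀
  set φ := extChartAt (𝓡 d) (1 : G) with hφ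
  have h1s := mem_extChartAt_source (I := 𝓡 d) (1 : G)
  have h1 : φ 1 ∈ φ.target := φ.map_source h1s
  have hφ1 : φ.symm (φ 1) = 1 := φ.left_inv h1s
  have h2 := C₀.sasakiDeriv_inv (smoothFrameAt_orbit h1 z₀)
    (by rw [← hφ, hφ1, one_smul]; exact hz₀)
  have h3 : orbitTangent d G z₀ ≤ LinearMap.range (sasakiDeriv C₀.toFun (C₀.inv z₀)).toLinearMap := by
    rw [orbitTangent_eq_range]
    rintro _ ⟨v, rfl⟩
    have h4 := DFunLike.congr_fun h2.2 v
    rw [← hφ, hφ1, one_smul] at h4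
    exact ⟨_, h4.symm⟩
  refine (Submodule.finrank_mono h3).trans ((LinearMap.finrank_range_le _).trans ?_)
  simp [add_comm]

/-- The inverse function theorem for $(u,y)\mapsto c(u)\cdot\psi(y)$, read in a chart `C₀`, where
`c` and `ψ` are affine in coordinates with the directions of `exists_adapted_complement`. -/
theorem exists_orbitChart (z₀ : OrthonormalFrame n M) {r q : ℕ}
    (hr : Module.finrank ℝ (orbitTangent d G z₀) = r) (hq : r + q = n + n.choose 2) :
    ∃ (C : ProductChart n M r q) (c : Euc r → G) (ψ : Euc q → OrthonormalFrame n M),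
      IsOrbitChart d C c ψ ∧ ψ 0 = z₀ := by
  obtain ⟨C₀, hz₀, -⟩ := exists_bundleChart z₀
  set p₀ := C₀.inv z₀ with hp₀
  have hp₀C : p₀ ∈ C₀.fst ×ˢ C₀.snd := C₀.inv_mem z₀ hz₀
  have hΨ₀ : C₀.toFun p₀ = z₀ := C₀.right_inv z₀ hz₀
  set P₀ := sasakiDeriv C₀.toFun p₀ with hP₀
  have hP₀i : Function.Injective P₀ := C₀.sasakiDeriv_injective hp₀C
  set φ := extChartAt (𝓡 d) (1 : G) with hφ
  have h1s := mem_extChartAt_source (I := 𝓡 d) (1 : G)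
  have h1 : φ 1 ∈ φ.target := φ.map_source h1s
  have hφ1 : φ.symm (φ 1) = 1 := φ.left_inv h1s
  have hφo : IsOpen φ.target := isOpen_extChartAt_target (1 : G)
  obtain ⟨A, hA⟩ : ∃ A : Euc d →L[ℝ] Euc (n.choose 2) × Euc n,
      orbitDeriv d G z₀ = P₀.comp A := by
    have h2 := (C₀.sasakiDeriv_inv (smoothFrameAt_orbit h1 z₀)
      (by rw [← hφ, hφ1, one_smul]; exact hz₀)).2
    rw [← hφ, hφ1, one_smul] at h2
    exact ⟨_, h2⟩
  have hAr : Module.finrank ℝ (LinearMap.range A.toLinearMap) = r := by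
    rw [← hr, orbitTangent_eq_range, hA]
    have : LinearMap.range (P₀.comp A).toLinearMap =
        (LinearMap.range A.toLinearMap).map P₀.toLinearMap := LinearMap.range_comp _ _
    rw [this]
    exact (LinearEquiv.finrank_eq (Submodule.equivMapOfInjective P₀.toLinearMap hP₀i _))
  obtain ⟨ι, ι₂, hι⟩ := exists_adapted_complement A.toLinearMap (q := q) hAr (by simp; omega)
  let c : Euc r → G := fun u => φ.symm (φ 1 + ι u)
  let ψ : Euc q → OrthonormalFrame n M := fun y => C₀.toFun (p₀ + ι₂ y)
  have hc0 : c 0 = 1 := by simp only [c, map_zero, add_zero, hφ1]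
  have hψ0 : ψ 0 = z₀ := by simp only [ψ, map_zero, add_zero, hΨ₀]
  have hlc : ContDiff ℝ ∞ (fun u => φ 1 + ι u) := contDiff_const.add ι.contDiff
  have hlψ : ContDiff ℝ ∞ (fun y => p₀ + ι₂ y) := contDiff_const.add ι₂.contDiff
  have hcs : ∀ u, φ 1 + ι u ∈ φ.target → ContMDiffAt 𝓘(ℝ, Euc r) (𝓡 d) ∞ c u := fun u hu =>
    ContMDiffAt.comp (I' := 𝓘(ℝ, Euc d)) (g := φ.symm) u (contMDiffAt_extChartAt_symm hu)
      (contMDiffAt_iff_contDiffAt.2 hlc.contDiffAt)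
  have hψs : ∀ y, p₀ + ι₂ y ∈ C₀.fst ×ˢ C₀.snd → SmoothFrameAt ψ y := fun y hy =>
    SmoothFrameAt.comp (ψ := C₀.toFun) (θ := fun y => p₀ + ι₂ y) (C₀.smooth_toFun _ hy)
      hlψ.contDiffAt
  let Z : Euc r × Euc q → OrthonormalFrame n M := fun p => c p.1 • ψ p.2
  have hZs : ∀ p : Euc r × Euc q, φ 1 + ι p.1 ∈ φ.target → p₀ + ι₂ p.2 ∈ C₀.fst ×ˢ C₀.snd →
      SmoothFrameAt Z p := fun p hp hp' =>
    smoothFrameAt_smul_param (d := d) (α := fun p : Euc r × Euc q => c p.1)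
      (ContMDiffAt.comp (I' := 𝓘(ℝ, Euc r)) (g := c) (f := Prod.fst) p (hcs _ hp)
        (contMDiffAt_iff_contDiffAt.2 contDiffAt_fst))
      (SmoothFrameAt.comp (ψ := ψ) (θ := Prod.snd) (hψs _ hp') contDiffAt_snd)
  have hc0t : φ 1 + ι (0 : Euc r × Euc q).1 ∈ φ.target := by simpa using h1
  have hψ0t : p₀ + ι₂ (0 : Euc r × Euc q).2 ∈ C₀.fst ×ˢ C₀.snd := by simpa using hp₀C
  have hZ0 : Z 0 = z₀ := by
    change c 0 • ψ 0 = z₀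
    rw [hc0, one_smul, hψ0]
  have hdom : ∀ᶠ p : Euc r × Euc q in 𝓝 0, (φ 1 + ι p.1 ∈ φ.target ∧
      p₀ + ι₂ p.2 ∈ C₀.fst ×ˢ C₀.snd) ∧ Z p ∈ C₀.target := by
    refine Filter.Eventually.and (Filter.Eventually.and ?_ ?_) ?_
    · exact (hlc.continuous.comp continuous_fst).continuousAt (hφo.mem_nhds hc0t)
    · exact (hlψ.continuous.comp continuous_snd).continuousAt (C₀.isOpen_source.mem_nhds hψ0t)
    · exact (hZs 0 hc0t hψ0t).1 (C₀.isOpen_target.mem_nhds (by rw [hZ0]; exact hz₀))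
  have hsm : ∀ᶠ p in 𝓝 (0 : Euc r × Euc q), ContDiffAt ℝ ∞ (fun p => C₀.inv (Z p)) p := by
    filter_upwards [hdom] with p hp using (C₀.sasakiDeriv_inv (hZs p hp.1.1 hp.1.2) hp.2).1
  -- The derivative of `Z` at the origin is $(s,\eta)\mapsto P_0(A\iota s+\iota_2\eta)$, injective
  -- by the choice of `ι` and `ι₂`.
  have hinj : Function.Injective (fderiv ℝ (fun p => C₀.inv (Z p)) 0) := by
    refine (injective_iff_map_eq_zero _).2 fun v hv => ?_
    have hZ := hZs 0 hc0t hψ0t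
    have h2 := (C₀.sasakiDeriv_inv hZ (by rw [hZ0]; exact hz₀)).2
    have h3 : sasakiDeriv Z 0 v = 0 := by
      rw [h2, ContinuousLinearMap.comp_apply, hv, _root_.map_zero]
    have e1 : ∀ s : Euc r, sasakiDeriv Z 0 (s, 0) = P₀ (A (ι s)) := by
      intro s
      have e := sasakiDeriv_comp (ψ := Z) (θ := fun u : Euc r => (u, (0 : Euc q))) (y := 0) hZ
        (differentiableAt_id.prodMk (differentiableAt_const 0))
      have hd : HasFDerivAt (𝕜 := ℝ) (fun u : Euc r => (u, (0 : Euc q)))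
        (ContinuousLinearMap.inl ℝ _ _) 0 := hasFDerivAt_prodMk_left 0 0
      rw [hd.fderiv] at e
      have e' : (fun u : Euc r => Z (u, 0)) = fun u => φ.symm (φ 1 + ι u) • z₀ := by
        funext u
        change c u • ψ 0 = _
        rw [hψ0]
      have hl0 : φ 1 + ι 0 = φ 1 := by simp
      have hd' : HasFDerivAt (𝕜 := ℝ) (fun u => φ 1 + ι u) ι 0 := ι.hasFDerivAt.const_add (φ 1)
      have e'' := sasakiDeriv_comp (ψ := fun a => φ.symm a • z₀) (θ := fun u => φ 1 + ι u) (y := 0)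
        (by rw [hl0]; exact smoothFrameAt_orbit h1 z₀) hd'.differentiableAt
      rw [e'] at e
      rw [e, hd'.fderiv, hl0] at e''
      have := DFunLike.congr_fun e'' s
      simp only [ContinuousLinearMap.comp_apply, ContinuousLinearMap.inl_apply] at this
      have hA' := DFunLike.congr_fun hA (ι s)
      exact this.trans hA'
    have e2 : ∀ η : Euc q, sasakiDeriv Z 0 (0, η) = P₀ (ι₂ η) := by
      intro η
      have e := sasakiDeriv_comp (ψ := Z) (θ := fun y : Euc q => ((0 : Euc r), y)) (y := 0) hZ
        ((differentiableAt_const 0).prodMk differentiableAt_id)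
      have hd : HasFDerivAt (𝕜 := ℝ) (fun y : Euc q => ((0 : Euc r), y))
        (ContinuousLinearMap.inr ℝ _ _) 0 := hasFDerivAt_prodMk_right 0 0
      rw [hd.fderiv] at e
      have e' : (fun y : Euc q => Z (0, y)) = fun y => C₀.toFun (p₀ + ι₂ y) := by
        funext y
        change c 0 • ψ y = _
        rw [hc0, one_smul]
      have hl0 : p₀ + ι₂ 0 = p₀ := by simp
      have hd' : HasFDerivAt (𝕜 := ℝ) (fun y => p₀ + ι₂ y) ι₂ 0 := ι₂.hasFDerivAt.const_add p₀
      have e'' := sasakiDeriv_comp (ψ := C₀.toFun) (θ := fun y => p₀ + ι₂ y) (y := 0)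
        (by rw [hl0]; exact C₀.smooth_toFun _ hp₀C) hd'.differentiableAt
      rw [e'] at e
      rw [e, hd'.fderiv, hl0] at e''
      exact DFunLike.congr_fun e'' η
    have h4 : sasakiDeriv Z 0 v = P₀ (A (ι v.1) + ι₂ v.2) := by
      have : v = (v.1, 0) + (0, v.2) := by simp
      conv_lhs => rw [this]
      rw [map_add, e1, e2, ← map_add]
    rw [h3] at h4
    have h5 := hι v.1 v.2 (hP₀i (h4.symm.trans (_root_.map_zero P₀).symm))
    exact Prod.ext h5.1 h5.2
  obtain ⟨e, he0, hef, hes, het⟩ := exists_localDiffeo hsm (by simp; omega) hinj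
  have hall := hdom.and (e.open_source.mem_nhds he0)
  have hall' : {p | ((φ 1 + ι p.1 ∈ φ.target ∧ p₀ + ι₂ p.2 ∈ C₀.fst ×ˢ C₀.snd) ∧ Z p ∈ C₀.target) ∧
      p ∈ e.source} ∈ 𝓝 ((0 : Euc r), (0 : Euc q)) := hall
  obtain ⟨U, B, hUo, hU0, hBo, hB0, hUB⟩ := mem_nhds_prod_iff'.1 hall'
  have hopen : IsOpen (C₀.target ∩ C₀.inv ⁻¹' (e.target ∩ e.symm ⁻¹' (U ×ˢ B))) :=
    ContinuousOn.isOpen_inter_preimage (fun z hz => (C₀.continuousAt_inv hz).continuousWithinAt)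
      C₀.isOpen_target (e.symm.isOpen_inter_preimage (hUo.prod hBo))
  refine ⟨{ toFun := Z, inv := fun z => e.symm (C₀.inv z), fst := U, snd := B
            target := C₀.target ∩ C₀.inv ⁻¹' (e.target ∩ e.symm ⁻¹' (U ×ˢ B))
            isOpen_fst := hUo, isOpen_snd := hBo, isOpen_target := hopen
            map_mem := fun p hp => ?_
            inv_mem := fun z hz => hz.2.2
            left_inv := fun p hp => ?_
            right_inv := fun z hz => ?_
            smooth_toFun := fun p hp => hZs p (hUB hp).1.1.1 (hUB hp).1.1.2
            smooth_inv := fun z hz => ?_ }, c, ψ,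
    { contMDiffAt := fun u hu => hcs u (hUB (Set.mk_mem_prod hu hB0)).1.1.1
      smooth := fun y hy => hψs y (hUB (Set.mk_mem_prod hU0 hy)).1.1.2
      toFun_eq := fun p _ => rfl
      zero_mem := ⟨hU0, hB0⟩
      map_zero := hc0 }, hψ0⟩
  · have h2 := hUB hp
    have h3 : C₀.inv (Z p) = e p := (hef p).symm
    refine ⟨h2.1.2, ?_⟩
    rw [Set.mem_preimage, h3]
    refine ⟨e.map_source h2.2, ?_⟩
    rw [Set.mem_preimage, e.left_inv h2.2]
    exact hp
  · have h3 : C₀.inv (Z p) = e p := (hef p).symm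
    rw [h3, e.left_inv (hUB hp).2]
  · have h2 := hUB hz.2.2
    have h3 : C₀.inv (Z (e.symm (C₀.inv z))) = C₀.inv z := by
      rw [← hef (e.symm (C₀.inv z)), e.right_inv hz.2.1]
    rw [← C₀.right_inv _ h2.1.2, h3, C₀.right_inv z hz.1]
  · obtain ⟨H, hH, hHe⟩ := C₀.smooth_inv z hz.1
    refine ⟨fun p => e.symm (H p), ?_, hHe.mono fun w hw => congrArg e.symm hw⟩
    refine ContDiffAt.comp _ ?_ hH
    rw [← hHe.self_of_nhds]
    exact het _ hz.2.1

end Slice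

/-! ### The projection to the orbit space and its slices -/

section OrbitSpace

variable {n : ℕ} {M : Type*} [TopologicalSpace M] [ChartedSpace (Euc n) M]
  [RiemannianBundle (fun x : M => TangentSpace (𝓡 n) x)] [IsManifold (𝓡 n) ∞ M]
  {d : ℕ} {G : Type*} [TopologicalSpace G] [ChartedSpace (Euc d) G] [Group G]
  [MulAction G M] [IsometricAction n M G]

theorem proj_eq_iff {z w : OrthonormalFrame n M} :
    proj n M G z = proj n M G w ↔ ∃ g : G, g • w = z := by
  rw [proj, proj, Quotient.eq, MulAction.orbitRel_apply, MulAction.mem_orbit_iff]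

theorem proj_smul (g : G) (z : OrthonormalFrame n M) : proj n M G (g • z) = proj n M G z :=
  proj_eq_iff.2 ⟨g, rfl⟩

theorem measurable_proj : Measurable (proj n M G) := measurable_quotient_mk''

variable [IsContMDiffRiemannianBundle (𝓡 n) ∞ (Euc n) (fun x : M => TangentSpace (𝓡 n) x)]
  {r q : ℕ} {C : ProductChart n M r q} {c : Euc r → G} {ψ : Euc q → OrthonormalFrame n M}

/-- Invariance under `c p.1` makes the derivative along the transversal independent of the group
coordinate; therefore the orthogonal density depends only on the point of the orbit space. -/
theorem IsOrbitChart.sasakiDeriv_inr (h : IsOrbitChart d C c ψ) {p : Euc r × Euc q}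
    (hp : p ∈ C.fst ×ˢ C.snd) (η : Euc q) :
    sasakiDeriv C.toFun p (0, η) = sasakiDeriv ψ p.2 η := by
  have e := sasakiDeriv_comp (ψ := C.toFun) (θ := fun y : Euc q => (p.1, y)) (y := p.2)
    (C.smooth_toFun p hp) ((differentiableAt_const p.1).prodMk differentiableAt_id)
  have hd : HasFDerivAt (𝕜 := ℝ) (fun y : Euc q => (p.1, y)) (ContinuousLinearMap.inr ℝ _ _) p.2 :=
    hasFDerivAt_prodMk_right p.1 p.2
  have he : (fun y => C.toFun (p.1, y)) =ᶠ[𝓝 p.2] fun y => c p.1 • ψ y := by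
    filter_upwards [C.isOpen_snd.mem_nhds hp.2] with y hy using h.toFun_eq (p.1, y) ⟨hp.1, hy⟩
  rw [hd.fderiv, sasakiDeriv_congr he, sasakiDeriv_smul _ (h.smooth _ hp.2)] at e
  exact (DFunLike.congr_fun e η).symm

variable [LieGroup (𝓡 d) ∞ G] [ContMDiffSMul (𝓡 d) (𝓡 n) ∞ G M]

theorem IsOrbitChart.sasakiDeriv_inl_mem (h : IsOrbitChart d C c ψ) {p : Euc r × Euc q}
    (hp : p ∈ C.fst ×ˢ C.snd) (s : Euc r) :
    sasakiDeriv C.toFun p (s, 0) ∈ orbitTangent d G (ψ p.2) := by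
  have e := sasakiDeriv_comp (ψ := C.toFun) (θ := fun u : Euc r => (u, p.2)) (y := p.1)
    (C.smooth_toFun p hp) (differentiableAt_id.prodMk (differentiableAt_const p.2))
  have hd : HasFDerivAt (𝕜 := ℝ) (fun u : Euc r => (u, p.2)) (ContinuousLinearMap.inl ℝ _ _) p.1 :=
    hasFDerivAt_prodMk_left p.1 p.2
  have he : (fun u => C.toFun (u, p.2)) =ᶠ[𝓝 p.1] fun u => c u • ψ p.2 := by
    filter_upwards [C.isOpen_fst.mem_nhds hp.1] with u hu using h.toFun_eq (u, p.2) ⟨hu, hp.2⟩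
  rw [hd.fderiv, sasakiDeriv_congr he] at e
  have h1 := sasakiDeriv_orbit_mem (h.contMDiffAt _ hp.1) (ψ p.2) s
  rw [e] at h1
  exact h1

theorem IsOrbitChart.orbitTangent_eq (h : IsOrbitChart d C c ψ) {p : Euc r × Euc q}
    (hp : p ∈ C.fst ×ˢ C.snd) (hr : Module.finrank ℝ (orbitTangent d G (ψ p.2)) = r) :
    LinearMap.range ((sasakiDeriv C.toFun p).toLinearMap ∘ₗ LinearMap.inl ℝ (Euc r) (Euc q)) =
      orbitTangent d G (ψ p.2) := by
  refine Submodule.eq_of_le_of_finrank_eq ?_ ?_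
  · rintro _ ⟨s, rfl⟩
    exact h.sasakiDeriv_inl_mem hp s
  · rw [LinearMap.finrank_range_of_inj, hr]
    · simp
    · exact (C.sasakiDeriv_injective hp).comp (fun s t h => congrArg Prod.fst h)

open scoped Pointwise in
/-- An orbit chart in which the transversal meets every orbit at most once. -/
theorem exists_sliceChart [T2Space M] [ConnectedSpace M] [CompactSpace G]
    (z₀ : OrthonormalFrame n M) {r q : ℕ}
    (hr : ∀ z : OrthonormalFrame n M, Module.finrank ℝ (orbitTangent d G z) = r)
    (hq : r + q = n + n.choose 2) :
    ∃ (C : ProductChart n M r q) (c : Euc r → G) (ψ : Euc q → OrthonormalFrame n M),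
      IsOrbitChart d C c ψ ∧ z₀ ∈ C.target ∧
        ∀ y ∈ C.snd, ∀ y' ∈ C.snd, proj n M G (ψ y) = proj n M G (ψ y') → y = y' := by
  have hcs : ContinuousSMul G (OrthonormalFrame n M) := continuousSMul_frame d G
  have htg : IsTopologicalGroup G := topologicalGroup_of_lieGroup (𝓡 d) ∞
  obtain ⟨C, c, ψ, h, hψ0⟩ := exists_orbitChart z₀ (hr z₀) hq
  have hinv : ∀ y ∈ C.snd, ψ y ∈ C.target ∧ C.inv (ψ y) = (0, y) := by
    intro y hy
    have hp : ((0 : Euc r), y) ∈ C.fst ×ˢ C.snd := ⟨h.zero_mem.1, hy⟩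
    have h1 := h.toFun_eq _ hp
    simp only [h.map_zero, one_smul] at h1
    rw [← h1]
    exact ⟨C.map_mem _ hp, C.left_inv _ hp⟩
  have hz₀ : z₀ ∈ C.target := by rw [← hψ0]; exact (hinv 0 h.zero_mem.2).1
  have hψc : ContinuousAt ψ 0 := (h.smooth 0 h.zero_mem.2).1
  set φ := extChartAt (𝓡 d) (1 : G) with hφ
  have h1s := mem_extChartAt_source (I := 𝓡 d) (1 : G)
  have h1 : φ 1 ∈ φ.target := φ.map_source h1s
  have hφ1 : φ.symm (φ 1) = 1 := φ.left_inv h1s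
  have hφo : IsOpen φ.target := isOpen_extChartAt_target (1 : G)
  have hnear : ∀ᶠ aq : Euc d × Euc q in 𝓝 (φ 1, 0),
      (aq.1 ∈ φ.target ∧ φ.symm aq.1 • ψ aq.2 ∈ C.target) ∧ aq.2 ∈ C.snd := by
    refine Filter.Eventually.and (Filter.Eventually.and
      (continuousAt_fst (hφo.mem_nhds h1)) ?_) (continuousAt_snd (C.isOpen_snd.mem_nhds h.zero_mem.2))
    have h2 : ContinuousAt (fun aq : Euc d × Euc q => φ.symm aq.1 • ψ aq.2) (φ 1, 0) :=
      (ContinuousAt.comp (g := φ.symm) (f := Prod.fst) (x := (φ 1, (0 : Euc q)))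
        (continuousAt_extChartAt_symm'' h1) continuousAt_fst).smul
        (ContinuousAt.comp (g := ψ) (f := Prod.snd) (x := (φ 1, (0 : Euc q))) hψc continuousAt_snd)
    refine h2 (C.isOpen_target.mem_nhds ?_)
    simp only [hφ1, one_smul, hψ0]; exact hz₀
  rw [nhds_prod_eq] at hnear
  obtain ⟨pa, hpa, pb, hpb, hab⟩ := Filter.eventually_prod_iff.1 hnear
  obtain ⟨ε, hε, hball⟩ := Metric.mem_nhds_iff.1 hpa
  -- Motion by small group elements does not change the transversal coordinate: orbit directions are
  -- exactly the directions of the first factor, because the dimensions agree at every frame, so the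
  -- derivative vanishes on the ball.
  have hconst : ∀ y, pb y → ∀ a ∈ Metric.ball (φ 1) ε, (C.inv (φ.symm a • ψ y)).2 = y := by
    intro y hy a ha
    have hd : ∀ a ∈ Metric.ball (φ 1) ε, HasFDerivWithinAt
        (fun a => (C.inv (φ.symm a • ψ y)).2) (0 : Euc d →L[ℝ] Euc q) (Metric.ball (φ 1) ε) a := by
      intro a ha
      have hh := hab (hball ha) hy
      have h2 := C.sasakiDeriv_inv (smoothFrameAt_orbit hh.1.1 (ψ y)) hh.1.2
      have h3 := ((h2.1.differentiableAt (by simp)).hasFDerivAt).snd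
      refine HasFDerivAt.hasFDerivWithinAt (h3.congr_fderiv ?_)
      ext1 v
      have h4 := sasakiDeriv_orbit_mem (contMDiffAt_extChartAt_symm hh.1.1) (ψ y) v
      have hpC := C.inv_mem _ hh.1.2
      have h5 : orbitTangent d G (ψ y) =
          orbitTangent d G (ψ (C.inv (φ.symm a • ψ y)).2) := by
        rw [← orbitTangent_smul (φ.symm a) (ψ y), ← C.right_inv _ hh.1.2, h.toFun_eq _ hpC,
          orbitTangent_smul, ← h.toFun_eq _ hpC, C.right_inv _ hh.1.2]
      rw [h5, ← h.orbitTangent_eq hpC (hr _)] at h4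
      obtain ⟨s, hs⟩ := h4
      have h6 := DFunLike.congr_fun h2.2 v
      have h7 := C.sasakiDeriv_injective hpC (hs.trans h6)
      have h8 := congrArg Prod.snd h7
      exact h8.symm
    have h2 := (convex_ball (φ 1) ε).norm_image_sub_le_of_norm_hasFDerivWithin_le (C := 0) hd
      (fun a _ => by simp) (Metric.mem_ball_self hε) ha
    rw [zero_mul] at h2
    have h3 := sub_eq_zero.1 (norm_le_zero_iff.1 h2)
    have hyC := (hab (hball ha) hy).2
    rw [h3, hφ1, one_smul, (hinv y hyC).2]
  -- An open set of group elements that contains the stabilizer of `z₀`, because by rigidity the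
  -- stabilizer acts trivially on all frames.
  let O : Set G := {g | ∃ a ∈ Metric.ball (φ 1) ε, ∃ m : G, (∀ z : OrthonormalFrame n M, m • z = z) ∧
    g = m * φ.symm a}
  have hbt : Metric.ball (φ 1) ε ⊆ φ.target := fun a ha =>
    (hab (hball ha) hpb.self_of_nhds).1.1
  have hOo : IsOpen O := by
    have hW : IsOpen (φ.symm '' Metric.ball (φ 1) ε) := by
      rw [show φ.symm '' Metric.ball (φ 1) ε = φ.source ∩ φ ⁻¹' Metric.ball (φ 1) ε from
        φ.symm.image_eq_target_inter_inv_preimage hbt]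
      exact (continuousOn_extChartAt (1 : G)).isOpen_inter_preimage
        (isOpen_extChartAt_source (1 : G)) Metric.isOpen_ball
    have : O = {m : G | ∀ z : OrthonormalFrame n M, m • z = z} * (φ.symm '' Metric.ball (φ 1) ε) := by
      ext g
      constructor
      · rintro ⟨a, ha, m, hm, rfl⟩
        exact Set.mul_mem_mul hm ⟨a, ha, rfl⟩
      · rintro ⟨m, hm, _, ⟨a, ha, rfl⟩, rfl⟩
        exact ⟨a, ha, m, hm, rfl⟩
    rw [this]
    exact hW.mul_left
  -- Elements outside `O` move `z₀`. By compactness of the complement of `O`, they all separate the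
  -- points of a small transversal.
  have htube : ∀ᶠ yy : Euc q × Euc q in 𝓝 (0, 0), ∀ g ∈ Oᶜ, g • ψ yy.1 ≠ ψ yy.2 := by
    refine hOo.isClosed_compl.isCompact.eventually_forall_of_forall_eventually
      (P := fun (yy : Euc q × Euc q) (g : G) => g • ψ yy.1 ≠ ψ yy.2) fun g hg => ?_
    have hc1 : ContinuousAt (fun x : (Euc q × Euc q) × G => x.2 • ψ x.1.1) ((0, 0), g) :=
      continuousAt_snd.smul (ContinuousAt.comp (g := ψ)
        (f := fun x : (Euc q × Euc q) × G => x.1.1) (x := ((0, 0), g)) hψc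
        (continuous_fst.comp continuous_fst).continuousAt)
    have hc2 : ContinuousAt (fun x : (Euc q × Euc q) × G => ψ x.1.2) ((0, 0), g) :=
      ContinuousAt.comp (g := ψ) (f := fun x : (Euc q × Euc q) × G => x.1.2) (x := ((0, 0), g)) hψc
        (continuous_snd.comp continuous_fst).continuousAt
    have hne : ((fun x : (Euc q × Euc q) × G => x.2 • ψ x.1.1) ((0, 0), g),
        (fun x : (Euc q × Euc q) × G => ψ x.1.2) ((0, 0), g)) ∈
        (Set.diagonal (OrthonormalFrame n M))ᶜ := ?_
    · exact (hc1.prodMk hc2) (isClosed_diagonal.isOpen_compl.mem_nhds hne)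
    rw [Set.mem_compl_iff, Set.mem_diagonal_iff]
    simp only [hψ0]
    intro he
    exact hg ⟨φ 1, Metric.mem_ball_self hε, g, smul_eq_of_smul_eq d he, by rw [hφ1, mul_one]⟩
  rw [nhds_prod_eq] at htube
  obtain ⟨p1, hp1, p2, hp2, hp12⟩ := Filter.eventually_prod_iff.1 htube
  obtain ⟨B, hBs, hBo, hB0⟩ := mem_nhds_iff.1
    (Filter.inter_mem (Filter.inter_mem hpb (C.isOpen_snd.mem_nhds h.zero_mem.2))
      (Filter.inter_mem hp1 hp2))
  refine ⟨C.restrict C.fst B C.isOpen_fst hBo subset_rfl (fun y hy => (hBs hy).1.2), c, ψ,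
    { contMDiffAt := h.contMDiffAt
      smooth := fun y hy => h.smooth y (hBs hy).1.2
      toFun_eq := fun p hp => h.toFun_eq p ⟨hp.1, (hBs hp.2).1.2⟩
      zero_mem := ⟨h.zero_mem.1, hB0⟩
      map_zero := h.map_zero }, ?_, ?_⟩
  · refine ⟨hz₀, ?_⟩
    rw [Set.mem_preimage, ← hψ0, (hinv 0 h.zero_mem.2).2]
    exact ⟨h.zero_mem.1, hB0⟩
  · intro y hy y' hy' he
    have hy1 := hBs hy
    have hy1' := hBs hy'
    obtain ⟨g, hg⟩ := proj_eq_iff.1 he.symm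
    have hgO : g ∈ O := by
      by_contra hgO
      exact hp12 hy1.2.1 hy1'.2.2 g hgO hg
    obtain ⟨a, ha, m, hm, rfl⟩ := hgO
    -- The factor `m` acts trivially, so `ψ y` and `ψ y'` differ by a small group element and have
    -- the same transversal coordinate.
    rw [mul_smul, hm] at hg
    have h2 := hconst y hy1.1.1 a ha
    rw [hg, (hinv y' hy1'.1.2).2] at h2
    exact h2.symm

end OrbitSpace

/-! ### The volume of the orbit space -/

section QuotientVolume

variable {n : ℕ} {M : Type*} [TopologicalSpace M] [ChartedSpace (Euc n) M]
  [RiemannianBundle (fun x : M => TangentSpace (𝓡 n) x)] [IsManifold (𝓡 n) ∞ M]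
  [IsContMDiffRiemannianBundle (𝓡 n) ∞ (Euc n) (fun x : M => TangentSpace (𝓡 n) x)]
  {d : ℕ} {G : Type*} [TopologicalSpace G] [ChartedSpace (Euc d) G] [Group G]
  [MulAction G M] [IsometricAction n M G]
  {r q : ℕ} {C : ProductChart n M r q} {c : Euc r → G} {ψ : Euc q → OrthonormalFrame n M}

theorem IsOrbitChart.mem_target (h : IsOrbitChart d C c ψ) {y : Euc q} (hy : y ∈ C.snd) :
    ψ y ∈ C.target ∧ C.inv (ψ y) = (0, y) := by
  have hp : ((0 : Euc r), y) ∈ C.fst ×ˢ C.snd := ⟨h.zero_mem.1, hy⟩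
  have h1 := h.toFun_eq _ hp
  simp only [h.map_zero, one_smul] at h1
  rw [← h1]
  exact ⟨C.map_mem _ hp, C.left_inv _ hp⟩

theorem IsOrbitChart.proj_eq (h : IsOrbitChart d C c ψ) {z : OrthonormalFrame n M}
    (hz : z ∈ C.target) : proj n M G (ψ (C.inv z).2) = proj n M G z := by
  conv_rhs => rw [← C.right_inv z hz, h.toFun_eq _ (C.inv_mem z hz), proj_smul]

/-- Measurability in the orbit space is measurability of the preimage in the frame bundle, and this
preimage is a union of translates of an open set. -/
theorem IsOrbitChart.measurableSet_image (h : IsOrbitChart d C c ψ) {B : Set (Euc q)}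
    (hB : IsOpen B) (hBC : B ⊆ C.snd) :
    MeasurableSet ((fun y => proj n M G (ψ y)) '' B) := by
  have h1 : proj n M G ⁻¹' ((fun y => proj n M G (ψ y)) '' B) =
      ⋃ g : G, (fun z : OrthonormalFrame n M => g • z) ⁻¹' (C.target ∩ C.inv ⁻¹' (Set.univ ×ˢ B)) := by
    ext z
    simp only [Set.mem_preimage, Set.mem_image, Set.mem_iUnion, Set.mem_inter_iff, Set.mem_prod,
      Set.mem_univ, true_and]
    constructor
    · rintro ⟨y, hy, hyz⟩
      obtain ⟨g, hg⟩ := proj_eq_iff.1 hyz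
      refine ⟨g, ?_⟩
      rw [hg, (h.mem_target (hBC hy)).2]
      exact ⟨(h.mem_target (hBC hy)).1, hy⟩
    · rintro ⟨g, hg, hg'⟩
      exact ⟨_, hg', (h.proj_eq hg).trans (proj_smul g z)⟩
  have h2 : IsOpen (C.target ∩ C.inv ⁻¹' (Set.univ ×ˢ B)) :=
    ContinuousOn.isOpen_inter_preimage (fun z hz => (C.continuousAt_inv hz).continuousWithinAt)
      C.isOpen_target (isOpen_univ.prod hB)
  refine measurableSet_quotient.2 ?_
  change MeasurableSet (proj n M G ⁻¹' _)
  rw [h1]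
  exact (isOpen_iUnion fun g => h2.preimage
    (continuous_iff_continuousAt.2 fun z => continuousAt_smul_frame g z)).measurableSet

variable [LieGroup (𝓡 d) ∞ G] [ContMDiffSMul (𝓡 d) (𝓡 n) ∞ G M]

/-- The derivative of the projection to the orbit space, in an orbit chart. -/
theorem IsOrbitChart.starProjection_sasakiDeriv (h : IsOrbitChart d C c ψ) {k : ℕ}
    {ψ' : Euc k → OrthonormalFrame n M} {u : Euc k} (hψ' : SmoothFrameAt ψ' u) {y : Euc q}
    (hy : y ∈ C.snd) {g : G} (hg : g • ψ' u = ψ y) :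
    ∃ θ : Euc k → Euc q, DifferentiableAt ℝ θ u ∧ θ u = y ∧
      (∀ᶠ u' in 𝓝 u, θ u' ∈ C.snd ∧ proj n M G (ψ (θ u')) = proj n M G (ψ' u')) ∧
      ∀ v, (orbitTangent d G (ψ' u))ᗮ.starProjection (sasakiDeriv ψ' u v) =
        (orbitTangent d G (ψ y))ᗮ.starProjection (sasakiDeriv ψ y (fderiv ℝ θ u v)) := by
  have hm := h.mem_target hy
  have hζ := hψ'.smul g
  have hζu : g • ψ' u ∈ C.target := by rw [hg]; exact hm.1
  have h1 := C.sasakiDeriv_inv hζ hζu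
  have hd := h1.1.differentiableAt (by simp)
  refine ⟨fun u' => (C.inv (g • ψ' u')).2, hd.snd, by simp only [hg, hm.2], ?_, fun v => ?_⟩
  · filter_upwards [hζ.1 (C.isOpen_target.mem_nhds hζu)] with u' hu'
    exact ⟨(C.inv_mem _ hu').2, (h.proj_eq hu').trans (proj_smul _ _)⟩
  · have hT : orbitTangent d G (ψ' u) = orbitTangent d G (ψ y) := by
      rw [← hg, orbitTangent_smul]
    have hp : ((0 : Euc r), y) ∈ C.fst ×ˢ C.snd := ⟨h.zero_mem.1, hy⟩
    set D := fderiv ℝ (fun u' => C.inv (g • ψ' u')) u v with hD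
    have h2 : fderiv ℝ (fun u' => (C.inv (g • ψ' u')).2) u v = D.2 := by
      rw [hd.hasFDerivAt.snd.fderiv]; rfl
    have h3 : sasakiDeriv ψ' u v = sasakiDeriv C.toFun (0, y) (D.1, 0) + sasakiDeriv ψ y D.2 := by
      rw [← h.sasakiDeriv_inr hp, ← map_add, ← sasakiDeriv_smul g hψ', h1.2, hg, hm.2]
      simp [D]
    rw [hT, h2, h3, map_add]
    -- The motion in the group coordinate is tangent to the orbit and disappears in the projection.
    have h4 : (orbitTangent d G (ψ y))ᗮ.starProjection (sasakiDeriv C.toFun (0, y) (D.1, 0)) = 0 := by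
      rw [Submodule.starProjection_apply_eq_zero_iff]
      exact Submodule.le_orthogonal_orthogonal _ (h.sasakiDeriv_inl_mem hp D.1)
    rw [h4, zero_add]

/-- The volume of the orbit space in an orbit chart. -/
theorem IsOrbitChart.quotientVolume_restrict (h : IsOrbitChart d C c ψ)
    (hr : ∀ z : OrthonormalFrame n M, Module.finrank ℝ (orbitTangent d G z) = r)
    (hq : r + q = n + n.choose 2)
    (hinj : ∀ y ∈ C.snd, ∀ y' ∈ C.snd, proj n M G (ψ y) = proj n M G (ψ y') → y = y') :
    (quotientVolume (n := n) (M := M) d G).restrict ((fun y => proj n M G (ψ y)) '' C.snd) =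
      ((volume.restrict C.snd).withDensity (fun y => gramDensity fun a =>
        (orbitTangent d G (ψ y))ᗮ.starProjection (sasakiDeriv ψ y (stdVec a)))).map
        (fun y => proj n M G (ψ y)) := by
  classical
  set V := (fun y => proj n M G (ψ y)) '' C.snd with hV
  have hVm : MeasurableSet V := h.measurableSet_image C.isOpen_snd subset_rfl
  have hmψ : ∀ {k : ℕ} {ψ : Euc k → OrthonormalFrame n M} {U : Set (Euc k)},
      (∀ u ∈ U, SmoothFrameAt ψ u) → Measurable fun u : U => proj n M G (ψ u) := fun h =>
    measurable_proj.comp (measurable_subtype_of_continuousAt fun u hu => (h u hu).1)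
  let Q : FrameQuotient n M G → Euc q := Function.invFunOn (fun y => proj n M G (ψ y)) C.snd
  have hQ : ∀ b ∈ V, Q b ∈ C.snd ∧ proj n M G (ψ (Q b)) = b := fun b hb =>
    ⟨Function.invFunOn_mem hb, Function.invFunOn_eq hb⟩
  have hQ' : ∀ y ∈ C.snd, Q (proj n M G (ψ y)) = y := fun y hy =>
    hinj _ (hQ _ ⟨y, hy, rfl⟩).1 y hy (hQ _ ⟨y, hy, rfl⟩).2
  refine restrict_eq_of_le hVm ?_ ?_ ?_
  · refine iSup_le fun q' => iSup_le fun ψ' => iSup_le fun U => iSup_le fun h' => ?_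
    have hs : ∀ u ∈ U, SmoothFrameAt ψ' u := fun u hu => h'.1.smoothFrameAt hu
    rcases U.eq_empty_or_nonempty with rfl | ⟨u₀, hu₀⟩
    · rw [Measure.restrict_empty, withDensity_zero_left, Measure.map_zero]
      exact Measure.zero_le _
    -- All orbits have dimension `r`, so the dimension condition at a single point fixes the
    -- dimension of the parameter space.
    obtain rfl : q' = q := by
      have := h'.2.2 u₀ hu₀
      rw [hr] at this
      omega
    refine le_add_restrict_compl hVm ?_ ?_
    -- Since the transversal meets an orbit at most once, `Q ∘ proj ∘ ψ'` coincides near `u` with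
    -- the differentiable map of `starProjection_sasakiDeriv`, although the group element used there
    -- depends on `u`.
    · have hex : ∀ u ∈ U, proj n M G (ψ' u) ∈ V → ∃ L : Euc q' →L[ℝ] Euc q',
          HasFDerivAt (fun u => Q (proj n M G (ψ' u))) L u ∧
          ∀ v, (orbitTangent d G (ψ' u))ᗮ.starProjection (sasakiDeriv ψ' u v) =
            (orbitTangent d G (ψ (Q (proj n M G (ψ' u)))))ᗮ.starProjection
              (sasakiDeriv ψ (Q (proj n M G (ψ' u))) (L v)) := by
        intro u hu huV
        have hQu := hQ _ huV
        obtain ⟨g, hg⟩ := proj_eq_iff.1 hQu.2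
        obtain ⟨θ, hθd, hθu, hθ, hθ'⟩ := h.starProjection_sasakiDeriv (hs u hu) hQu.1 hg
        refine ⟨fderiv ℝ θ u, hθd.hasFDerivAt.congr_of_eventuallyEq ?_, hθ'⟩
        filter_upwards [hθ] with u' hu'
        rw [← hu'.2, hQ' _ hu'.1]
      choose! L hL hL' using hex
      refine map_withDensity_restrict_le h'.1.1.measurableSet C.isOpen_snd.measurableSet hVm
        (hmψ hs) (hmψ h.smooth) hL ?_ (fun u _ huV => (hQ _ huV).1)
        (fun u _ huV => (hQ _ huV).2.symm) ?_
      · intro u hu u' hu' he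
        refine h'.2.1 hu.1 hu'.1 ?_
        have h1 := (hQ _ hu.2).2
        have h2 := (hQ _ hu'.2).2
        change proj n M G (ψ' u) = proj n M G (ψ' u')
        have h3 : Q (proj n M G (ψ' u)) = Q (proj n M G (ψ' u')) := he
        exact h1.symm.trans ((congrArg (fun y => proj n M G (ψ y)) h3).trans h2)
      · intro u hu huV
        simp only [sasakiVec_eq]
        have h1 := gramDensity_comp
          (((orbitTangent d G (ψ (Q (proj n M G (ψ' u)))))ᗮ.starProjection).comp
            (sasakiDeriv ψ (Q (proj n M G (ψ' u))))) (L u)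
        refine Eq.trans ?_ h1
        congr 1
        funext a
        exact hL' u hu huV (stdVec a)
    · exact le_iSup_of_le q' (le_iSup_of_le ψ' (le_iSup_of_le U (le_iSup_of_le h' le_rfl)))
  · refine le_iSup_of_le q (le_iSup_of_le ψ (le_iSup_of_le C.snd (le_iSup_of_le
      ⟨isSmoothParam_of_smoothFrameAt C.isOpen_snd h.smooth,
        fun y hy y' hy' he => hinj y hy y' hy' he, fun y _ => by rw [hr, add_comm, hq]⟩ ?_)))
    simp only [sasakiVec_eq]; rfl
  · rw [map_withDensity_apply C.isOpen_snd.measurableSet (hmψ h.smooth) _ hVm.compl]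
    have : C.snd ∩ (fun y => proj n M G (ψ y)) ⁻¹' Vᶜ = ∅ := by
      ext y
      simp only [Set.mem_inter_iff, Set.mem_preimage, Set.mem_compl_iff, Set.mem_empty_iff_false,
        iff_false, not_and, not_not]
      exact fun hy => ⟨y, hy, rfl⟩
    rw [this]; simp

theorem IsOrbitChart.sub_starProjection_mem (h : IsOrbitChart d C c ψ)
    (hr : ∀ z : OrthonormalFrame n M, Module.finrank ℝ (orbitTangent d G z) = r)
    {p : Euc r × Euc q} (hp : p ∈ C.fst ×ˢ C.snd) (b : Fin q) :
    sasakiDeriv C.toFun p (0, stdVec b) -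
        (orbitTangent d G (ψ p.2))ᗮ.starProjection (sasakiDeriv ψ p.2 (stdVec b)) ∈
      Submodule.span ℝ (Set.range fun a : Fin r => sasakiDeriv C.toFun p (stdVec a, 0)) := by
  have h1 : sasakiDeriv ψ p.2 (stdVec b) -
      (orbitTangent d G (ψ p.2))ᗮ.starProjection (sasakiDeriv ψ p.2 (stdVec b)) ∈
        orbitTangent d G (ψ p.2) := by
    have := Submodule.sub_starProjection_mem_orthogonal (K := (orbitTangent d G (ψ p.2))ᗮ)
      (sasakiDeriv ψ p.2 (stdVec b))
    rwa [Submodule.orthogonal_orthogonal] at this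
  rw [h.sasakiDeriv_inr hp]
  refine (?_ : orbitTangent d G (ψ p.2) ≤ _) h1
  rw [← h.orbitTangent_eq hp (hr _)]
  let L := (sasakiDeriv C.toFun p).toLinearMap ∘ₗ LinearMap.inl ℝ (Euc r) (Euc q)
  have h3 : (Set.range fun a : Fin r => sasakiDeriv C.toFun p (stdVec a, 0)) =
      L '' Set.range (EuclideanSpace.basisFun (Fin r) ℝ).toBasis := by
    rw [← Set.range_comp]; congr 1; ext1 a; simp [L]
  rw [h3, Submodule.span_image, Module.Basis.span_eq, Submodule.map_top]

/-- Continuity of the projections in `y` is not needed: by the splitting of the Gram density this is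
the quotient of the full density by the density along the orbit, both continuous, the latter
positive and finite. -/
theorem IsOrbitChart.measurable_density (h : IsOrbitChart d C c ψ)
    (hr : ∀ z : OrthonormalFrame n M, Module.finrank ℝ (orbitTangent d G z) = r)
    (hq : r + q = n + n.choose 2) :
    Measurable fun y : C.snd => gramDensity fun a =>
        (orbitTangent d G (ψ y))ᗮ.starProjection (sasakiDeriv ψ y (stdVec a)) := by
  let δ : Euc q → ℝ≥0∞ := fun y =>
    gramDensity fun a => sasakiDeriv C.toFun (0, y) (splitEquiv hq (stdVec a))
  let δ₁ : Euc q → ℝ≥0∞ := fun y =>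
    gramDensity fun a : Fin r => sasakiDeriv C.toFun (0, y) (stdVec a, 0)
  have hc : ∀ y ∈ C.snd, ContinuousAt (fun y => sasakiDeriv C.toFun ((0 : Euc r), y)) y := by
    intro y hy
    have hp : ((0 : Euc r), y) ∈ C.fst ×ˢ C.snd := ⟨h.zero_mem.1, hy⟩
    have h1 : ContinuousAt (sasakiDeriv C.toFun) (0, y) := by
      refine continuousAt_sasakiDeriv ?_
      filter_upwards [C.isOpen_source.mem_nhds hp] with p' hp' using C.smooth_toFun p' hp'
    exact ContinuousAt.comp (g := sasakiDeriv C.toFun) (f := fun y => ((0 : Euc r), y)) h1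
      (continuousAt_const.prodMk continuousAt_id)
  have hδ : Measurable fun y : C.snd => δ y := measurable_subtype_of_continuousAt fun y hy =>
    continuousAt_gramDensity fun a => (hc y hy).clm_apply continuousAt_const
  have hδ₁ : Measurable fun y : C.snd => δ₁ y := measurable_subtype_of_continuousAt fun y hy =>
    continuousAt_gramDensity fun a => (hc y hy).clm_apply continuousAt_const
  have hfun : (fun y : C.snd => gramDensity fun a =>
      (orbitTangent d G (ψ y))ᗮ.starProjection (sasakiDeriv ψ y (stdVec a))) =
      fun y : C.snd => δ y / δ₁ y := by
    funext y
    have hp : ((0 : Euc r), y.1) ∈ C.fst ×ˢ C.snd := ⟨h.zero_mem.1, y.2⟩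
    have h1 := gramDensity_split hq (sasakiDeriv C.toFun (0, y.1))
      (fun a => (orbitTangent d G (ψ y))ᗮ.starProjection (sasakiDeriv ψ y (stdVec a)))
      (h.sub_starProjection_mem hr hp) fun a b => Submodule.inner_right_of_mem_orthogonal
        (h.sasakiDeriv_inl_mem hp (stdVec a)) (Submodule.starProjection_apply_mem _ _)
    have h2 : δ₁ y ≠ 0 := by
      have hli : LinearIndependent ℝ fun a : Fin r => sasakiDeriv C.toFun (0, y.1) (stdVec a, 0) := by
        have := (EuclideanSpace.basisFun (Fin r) ℝ).toBasis.linearIndependent.map'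
          ((sasakiDeriv C.toFun (0, y.1)).toLinearMap ∘ₗ LinearMap.inl ℝ (Euc r) (Euc q))
          (LinearMap.ker_eq_bot.2
            ((C.sasakiDeriv_injective hp).comp (fun s t h => congrArg Prod.fst h)))
        have hs : (fun a : Fin r => sasakiDeriv C.toFun (0, y.1) (stdVec a, 0)) =
            ((sasakiDeriv C.toFun (0, y.1)).toLinearMap ∘ₗ LinearMap.inl ℝ (Euc r) (Euc q)) ∘
              (EuclideanSpace.basisFun (Fin r) ℝ).toBasis := by
          funext a; simp
        rw [hs]
        exact this
      have h3 := (Matrix.posDef_gram_of_linearIndependent hli).det_pos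
      exact (ENNReal.ofReal_pos.2 (Real.sqrt_pos.2 h3)).ne'
    have h3 : δ₁ y ≠ ⊤ := ENNReal.ofReal_ne_top
    rw [show δ y = _ from h1]
    exact by rw [mul_comm, ENNReal.mul_div_cancel_right h2 h3]
  rw [hfun]
  exact hδ.div hδ₁

end QuotientVolume

/-! ### Integration along the orbits -/

section Orbits

variable {n : ℕ} {M : Type*} [TopologicalSpace M] [ChartedSpace (Euc n) M]
  [RiemannianBundle (fun x : M => TangentSpace (𝓡 n) x)] [IsManifold (𝓡 n) ∞ M]
  [IsContMDiffRiemannianBundle (𝓡 n) ∞ (Euc n) (fun x : M => TangentSpace (𝓡 n) x)]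
  {d : ℕ} {G : Type*} [TopologicalSpace G] [ChartedSpace (Euc d) G] [Group G]
  [MulAction G M] [IsometricAction n M G] [LieGroup (𝓡 d) ∞ G] [ContMDiffSMul (𝓡 d) (𝓡 n) ∞ G M]

theorem measurableSet_orbitFiber [T2Space M] [CompactSpace G] (d : ℕ) [ChartedSpace (Euc d) G]
    [LieGroup (𝓡 d) ∞ G] [ContMDiffSMul (𝓡 d) (𝓡 n) ∞ G M] (y : FrameQuotient n M G) :
    MeasurableSet (orbitFiber G y) := by
  have hcs : ContinuousSMul G (OrthonormalFrame n M) := continuousSMul_frame d G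
  induction y using Quotient.inductionOn with | h w => ?_
  have h1 : orbitFiber G (proj n M G w) = Set.range fun g : G => g • w := by
    ext z
    exact proj_eq_iff
  change MeasurableSet (orbitFiber G (proj n M G w))
  rw [h1]
  exact (isCompact_range (continuous_id.smul continuous_const)).isClosed.measurableSet

/-- Integration over the frame bundle, along the orbits. -/
theorem lintegral_orbit [T2Space M] [SecondCountableTopology M] [ConnectedSpace M] [CompactSpace G]
    {f : OrthonormalFrame n M → ℝ≥0∞} (hf : Measurable f) :
    ∫⁻ y : FrameQuotient n M G, (∫⁻ z, f z ∂(submanifoldVolume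
        (Module.finrank ℝ (orbitTangent d G y.out)) (orbitFiber G y))) ∂(quotientVolume d G) =
      ∫⁻ z, f z ∂(submanifoldVolume (n + n.choose 2) Set.univ) := by
  obtain ⟨w⟩ : Nonempty (OrthonormalFrame n M) := by
    obtain ⟨x⟩ := (inferInstance : Nonempty M)
    obtain ⟨z, -⟩ := exists_frame (n := n) x
    exact ⟨z⟩
  -- The common dimension of the orbits allows slice charts of the same type at all frames.
  obtain ⟨r, hr⟩ : ∃ r, ∀ z : OrthonormalFrame n M,
      Module.finrank ℝ (orbitTangent d G z) = r := ⟨_, fun z => finrank_orbitTangent z w⟩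
  obtain ⟨q, hq⟩ : ∃ q, r + q = n + n.choose 2 := by
    have := finrank_orbitTangent_le (d := d) (G := G) w
    rw [hr] at this
    exact ⟨_, Nat.add_sub_cancel' this⟩
  simp only [hr]
  refine lintegral_lintegral_of_local (fun z₀ => ?_) hf
  obtain ⟨C, c, ψ, h, hz₀, hinj⟩ := exists_sliceChart z₀ hr hq
  refine ⟨C.target, C.isOpen_target.mem_nhds hz₀, C.isOpen_target.measurableSet,
    fun A hA hAC => ?_⟩
  have hVm := h.measurableSet_image C.isOpen_snd subset_rfl
  set V := (fun y => proj n M G (ψ y)) '' C.snd with hV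
  let Q : FrameQuotient n M G → Euc q := Function.invFunOn (fun y => proj n M G (ψ y)) C.snd
  have hQ : ∀ b ∈ V, Q b ∈ C.snd ∧ proj n M G (ψ (Q b)) = b := fun b hb =>
    ⟨Function.invFunOn_mem hb, Function.invFunOn_eq hb⟩
  have hQ' : ∀ y ∈ C.snd, Q (proj n M G (ψ y)) = y := fun y hy =>
    hinj _ (hQ _ ⟨y, hy, rfl⟩).1 y hy (hQ _ ⟨y, hy, rfl⟩).2
  -- The preimages of open sets under `Q` are images of open pieces of the transversal.
  have hQm : Measurable fun b : V => Q b := by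
    refine measurable_of_isOpen fun O hO => ?_
    refine ⟨_, h.measurableSet_image (C.isOpen_snd.inter hO) Set.inter_subset_left, ?_⟩
    ext ⟨b, hb⟩
    simp only [Set.mem_preimage, Set.mem_image]
    constructor
    · rintro ⟨y, hy, rfl⟩
      rw [hQ' y hy.1]; exact hy.2
    · exact fun hO => ⟨Q b, ⟨(hQ b hb).1, hO⟩, (hQ b hb).2⟩
  have hPm : Measurable fun y : C.snd => proj n M G (ψ y) :=
    measurable_proj.comp (measurable_subtype_of_continuousAt fun u hu => (h.smooth u hu).1)
  refine C.disintegration hq (fun p b => (orbitTangent d G (ψ p.2))ᗮ.starProjection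
    (sasakiDeriv ψ p.2 (stdVec b))) (h.measurable_density hr hq) (fun p _ => rfl)
    (fun p hp => h.sub_starProjection_mem hr hp)
    (fun p hp a b => Submodule.inner_right_of_mem_orthogonal
      (h.sasakiDeriv_inl_mem hp (stdVec a)) (Submodule.starProjection_apply_mem _ _))
    hPm hVm hQm hQ' (h.quotientVolume_restrict hr hq hinj) ?_ ?_ hA hAC
  · intro y hy
    refine C.submanifoldVolume_slice hy fun z hz => ?_
    have h1 : z ∈ orbitFiber G (proj n M G (ψ y)) ↔ proj n M G z = proj n M G (ψ y) := Iff.rfl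
    rw [h1, ← h.proj_eq hz]
    exact ⟨fun he => hinj _ (C.inv_mem z hz).2 _ hy he, fun he => by rw [he]⟩
  · intro b hb
    refine submanifoldVolume_of_disjoint C.isOpen_target ?_
    ext z
    simp only [Set.mem_inter_iff, Set.mem_empty_iff_false, iff_false, not_and]
    intro hz hzC
    exact hb ⟨(C.inv z).2, (C.inv_mem z hzC).2, (h.proj_eq hzC).trans hz⟩

end Orbits

/-! ### Burnside's theorem -/

section Burnside

variable {A W : Type*} [Group A] [NormedAddCommGroup W] [InnerProductSpace ℂ W] [CompleteSpace W]
  [FiniteDimensional ℂ W]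

/-- Burnside's theorem: the operators of an irreducible representation span all operators. -/
theorem IsIrreducibleRep.exists_sum_eq {τ : A →* UnitaryGroup W} (hτ : IsIrreducibleRep τ)
    (f : W →ₗ[ℂ] W) :
    ∃ c : A →₀ ℂ, c.sum (fun a r => r • ((τ a : W →L[ℂ] W) : W →ₗ[ℂ] W)) = f := by
  classical
  let θ : A →* Module.End ℂ W :=
    { toFun := fun a => ((τ a : W →L[ℂ] W) : W →ₗ[ℂ] W)
      map_one' := by rw [map_one]; rfl
      map_mul' := fun a b => by rw [map_mul]; rfl }
  let R : Subalgebra ℂ (Module.End ℂ W) := Algebra.adjoin ℂ (Set.range θ)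
  have hθ : ∀ a, θ a ∈ R := fun a => Algebra.subset_adjoin ⟨a, rfl⟩
  have : Nontrivial W := hτ.1
  have hsimple : IsSimpleModule R W := by
    rw [isSimpleModule_iff]
    refine { toNontrivial := inferInstance, eq_bot_or_eq_top := fun U => ?_ }
    let U' : Submodule ℂ W := U.restrictScalars ℂ
    rcases hτ.2 U' fun a w hw => U.smul_mem (⟨θ a, hθ a⟩ : R) hw with h | h
    · exact Or.inl ((Submodule.restrictScalars_eq_bot_iff ℂ R W).1 h)
    · exact Or.inr ((Submodule.restrictScalars_eq_top_iff ℂ R W).1 h)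
  -- Schur's lemma: the commutant of `R` is $\mathbb C$, so every linear `f` commutes with it. The
  -- density theorem, applied to a basis, puts `f` in `R`.
  have hs := (IsSimpleModule.algebraMap_end_bijective_of_isAlgClosed (A := R) (V := W) ℂ).2
  let f' : Module.End (Module.End R W) W :=
    { toFun := f
      map_add' := f.map_add
      map_smul' := fun e w => by
        obtain ⟨c, rfl⟩ := hs e
        exact f.map_smul c w }
  obtain ⟨r, hr⟩ := jacobson_density f' (Finset.univ.image (Module.finBasis ℂ W))
  have hrf : (r : Module.End ℂ W) = f := by
    refine (Module.finBasis ℂ W).ext fun i => ?_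
    exact (hr _ (Finset.mem_image_of_mem _ (Finset.mem_univ i))).symm
  -- The range of `θ` is closed under products, so the algebra generated by it is its linear span.
  have hspan : f ∈ Submodule.span ℂ (Set.range θ) := by
    have h1 := r.2
    rw [← Subalgebra.mem_toSubmodule, Algebra.adjoin_eq_span, ← MonoidHom.coe_mrange,
      Submonoid.closure_eq, hrf] at h1
    exact h1
  rw [Finsupp.mem_span_range_iff_exists_finsupp] at hspan
  exact hspan

end Burnside

/-! ### Translation of sections by group elements -/

section Translations

variable {n : ℕ} {M : Type*} [TopologicalSpace M] [ChartedSpace (Euc n) M]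
  [RiemannianBundle (fun x : M => TangentSpace (𝓡 n) x)] [IsManifold (𝓡 n) ∞ M]
  [IsContMDiffRiemannianBundle (𝓡 n) ∞ (Euc n) (fun x : M => TangentSpace (𝓡 n) x)]

/-- A group acts on the frame bundle by smooth maps. -/
def IsSmoothAction (n : ℕ) (M A : Type*) [TopologicalSpace M] [ChartedSpace (Euc n) M]
    [RiemannianBundle (fun x : M => TangentSpace (𝓡 n) x)] [IsManifold (𝓡 n) ∞ M]
    [Group A] [MulAction A (OrthonormalFrame n M)] : Prop :=
  ∀ (a : A) (z₀ : OrthonormalFrame n M), ContinuousAt (fun z : OrthonormalFrame n M => a • z) z₀ ∧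
    SmoothAtIn (coord z₀.base) (fun z : OrthonormalFrame n M => coord (a • z₀).base (a • z)) z₀

theorem isSmoothAction {G : Type*} [Group G] [MulAction G M] [IsometricAction n M G] :
    IsSmoothAction n M G := by
  intro g z₀
  have h0 := mem_frameDom_self z₀
  have h1 := mem_frameDom_self (g • z₀)
  refine ⟨continuousAt_smul_frame g z₀, frameTrans (chartMap z₀.base (g • z₀).base (fun x => g • x)),
    contDiffAt_frameTrans_coord (IsometricAction.contMDiff_smul g) h0 h1, ?_⟩
  filter_upwards [frameDom_mem_nhds h0,
    continuousAt_smul_frame g z₀ (frameDom_mem_nhds h1)] with w hw hw'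
  exact coord_smul g hw hw'

theorem isSmoothAction_orth : IsSmoothAction n M (OrthGroup n) := by
  intro k z₀
  have h0 := mem_frameDom_self z₀
  have hs : SmoothAtIn (coord z₀.base)
      (fun z : OrthonormalFrame n M => coord (k • z₀).base (k • z)) z₀ :=
    ⟨fun p => (p.1, p.2.comp ((k⁻¹ : OrthGroup n) : Euc n →L[ℝ] Euc n)),
      contDiffAt_fst.prodMk (contDiffAt_snd.clm_comp contDiffAt_const), .of_forall fun z => rfl⟩
  refine ⟨tendsto_of_tendsto_coord (mem_frameDom_self (k • z₀)) ?_ hs.continuousAt, hs⟩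
  exact frameDom_mem_nhds h0

variable {F : Type*} [NormedAddCommGroup F] [NormedSpace ℂ F]
  {E : OrthonormalFrame n M → Type*} [∀ z, NormedAddCommGroup (E z)]
  [∀ z, InnerProductSpace ℂ (E z)] [TopologicalSpace (TotalSpace F E)]
  [FiberBundle F E] [VectorBundle ℂ F E]

variable (E) in
/-- Sections of the bundle over the whole frame bundle. -/
abbrev TotalSection : Type _ := ∀ z : (Set.univ : Set (OrthonormalFrame n M)), E z

theorem mem_smoothSections_univ {S : TotalSection E} :
    S ∈ smoothSections F E Set.univ ↔ ∀ z₀ : OrthonormalFrame n M, SmoothAtIn (coord z₀.base)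
      (fun z => (trivializationAt F E z₀ ⟨z, S ⟨z, trivial⟩⟩).2) z₀ := by
  constructor
  · intro h z₀
    obtain ⟨H, hH, he⟩ := h ⟨z₀, trivial⟩
    refine ⟨H, hH, ?_⟩
    have hc : Continuous fun z : OrthonormalFrame n M =>
        (⟨z, trivial⟩ : (Set.univ : Set (OrthonormalFrame n M))) := by fun_prop
    exact hc.continuousAt.eventually he
  · intro h z₀
    obtain ⟨H, hH, he⟩ := h z₀.1
    exact ⟨H, hH, continuousAt_subtype_val.eventually he⟩

theorem restrict_mem_smoothSections {S : TotalSection E} (hS : S ∈ smoothSections F E Set.univ)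
    (Z : Set (OrthonormalFrame n M)) :
    (fun z : Z => S ⟨z.1, trivial⟩) ∈ smoothSections F E Z := by
  intro z₀
  obtain ⟨H, hH, he⟩ := mem_smoothSections_univ.1 hS z₀.1
  exact ⟨H, hH, continuousAt_subtype_val.eventually he⟩

variable {A N : Type*} [Group A] [TopologicalSpace A] [NormedAddCommGroup N] [NormedSpace ℝ N]
  (κ : A → A → N) [MulAction A (OrthonormalFrame n M)] [MulAction A (TotalSpace F E)]
  [IsEquivariantBundle F E κ]

variable (E) in
/-- The action of `a` on the fibre at `z`. -/
def fiberMap (a : A) (z : OrthonormalFrame n M) : E z ≃ₗᵢ[ℂ] E (a • z) :=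
  (IsEquivariantBundle.exists_fiberMap (F := F) (E := E) κ a z).choose

theorem smul_mk (a : A) (z : OrthonormalFrame n M) (v : E z) :
    a • (⟨z, v⟩ : TotalSpace F E) = ⟨a • z, fiberMap (F := F) E κ a z v⟩ :=
  (IsEquivariantBundle.exists_fiberMap (F := F) (E := E) κ a z).choose_spec v

variable (F E) in
/-- The translate of a section by `a⁻¹`. -/
def pull (a : A) : TotalSection E →ₗ[ℂ] TotalSection E where
  toFun S z := (fiberMap (F := F) E κ a z.1).symm (S ⟨a • z.1, trivial⟩)
  map_add' S T := by funext z; exact map_add _ _ _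
  map_smul' c S := by funext z; exact map_smul _ _ _

theorem pull_apply_eq_iff (a : A) (S : TotalSection E) (z : OrthonormalFrame n M) (v : E z) :
    pull F E κ a S ⟨z, trivial⟩ = v ↔
      a • (⟨z, v⟩ : TotalSpace F E) = ⟨a • z, S ⟨a • z, trivial⟩⟩ := by
  rw [smul_mk κ]
  change (fiberMap (F := F) E κ a z).symm (S ⟨a • z, trivial⟩) = v ↔ _
  rw [LinearIsometryEquiv.symm_apply_eq, eq_comm]
  constructor
  · intro h; rw [h]
  · intro h; exact eq_of_heq (TotalSpace.mk.inj h).2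

theorem smul_pull (a : A) (S : TotalSection E) (z : OrthonormalFrame n M) :
    a • (⟨z, pull F E κ a S ⟨z, trivial⟩⟩ : TotalSpace F E) = ⟨a • z, S ⟨a • z, trivial⟩⟩ :=
  (pull_apply_eq_iff κ a S z _).1 rfl

theorem pull_one (S : TotalSection E) : pull F E κ (1 : A) S = S := by
  funext ⟨z, _⟩
  refine (pull_apply_eq_iff κ 1 S z _).2 ?_
  have h : ∀ w : OrthonormalFrame n M, w = z →
      (⟨z, S ⟨z, trivial⟩⟩ : TotalSpace F E) = ⟨w, S ⟨w, trivial⟩⟩ := by rintro w rfl; rfl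
  rw [one_smul]
  exact h _ (one_smul A z)

/-- Pull-back reverses the order of products, which accounts for the inverses `τ a⁻¹` in `killed`.
-/
theorem pull_pull (a b : A) (S : TotalSection E) :
    pull F E κ b (pull F E κ a S) = pull F E κ (a * b) S := by
  funext ⟨z, _⟩
  refine ((pull_apply_eq_iff κ (a * b) S z _).2 ?_).symm
  have h : ∀ w : OrthonormalFrame n M, w = a • b • z →
      (⟨a • b • z, S ⟨a • b • z, trivial⟩⟩ : TotalSpace F E) = ⟨w, S ⟨w, trivial⟩⟩ := by
    rintro w rfl; rfl
  rw [mul_smul, smul_pull, smul_pull]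
  exact h _ (mul_smul a b z)

/-- Near `a • z₀` the section is expanded in the local frame of a trivialization. Its coefficients
are smooth, and $a^{-1}$ carries each vector of the frame to a smooth local section by
`smooth_smul`. -/
theorem pull_mem_smoothSections [FiniteDimensional ℂ F] (hA : IsSmoothAction n M A) (a : A)
    {S : TotalSection E} (hS : S ∈ smoothSections F E Set.univ) :
    pull F E κ a S ∈ smoothSections F E Set.univ := by
  rw [mem_smoothSections_univ] at hS ⊢
  intro z₀
  obtain ⟨hc, ha⟩ := hA a z₀
  set w₀ := a • z₀ with hw₀
  set e := trivializationAt F E w₀ with he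
  set e₀ := trivializationAt F E z₀ with he₀
  have hz : a⁻¹ • w₀ = z₀ := inv_smul_smul a z₀
  obtain ⟨H, hH, hHS⟩ := hS w₀
  obtain ⟨α, hα, hαe⟩ := ha
  let b := Module.finBasis ℂ F
  have hK := fun i => IsEquivariantBundle.smooth_smul (F := F) (E := E) (κ := κ) a⁻¹ w₀ (b i)
  rw [hz] at hK
  choose K hKs hKe using hK
  let ev : ∀ i, F →L[ℝ] ℂ := fun i =>
    (LinearMap.toContinuousLinearMap (b.coord i)).restrictScalars ℝ
  refine ⟨fun p => ∑ i, ev i (H (α p)) • K i (κ a⁻¹ a⁻¹, α p), ?_, ?_⟩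
  · have hα0 : α (coord z₀.base z₀) = coord w₀.base w₀ := hαe.self_of_nhds.symm
    refine ContDiffAt.sum fun i _ => ContDiffAt.smul ?_ ?_
    · refine (ev i).contDiff.contDiffAt.comp _ (ContDiffAt.comp _ ?_ hα)
      rwa [hα0]
    · refine ContDiffAt.comp (g := K i) (f := fun p => (κ a⁻¹ a⁻¹, α p)) _ ?_ (contDiffAt_const.prodMk hα)
      rw [hα0]
      exact hKs i
  · have hb0 : ∀ᶠ z in 𝓝 z₀, z ∈ e₀.baseSet :=
      e₀.open_baseSet.mem_nhds (FiberBundle.mem_baseSet_trivializationAt' z₀)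
    have hb1 : ∀ᶠ z in 𝓝 z₀, a • z ∈ e.baseSet :=
      hc (e.open_baseSet.mem_nhds (FiberBundle.mem_baseSet_trivializationAt' w₀))
    have hk : ∀ᶠ z in 𝓝 z₀, ∀ i, (e₀ (a⁻¹ • (⟨a • z, e.symm (a • z) (b i)⟩ : TotalSpace F E))).2 =
        K i (κ a⁻¹ a⁻¹, coord w₀.base (a • z)) := by
      rw [Filter.eventually_all]
      intro i
      have hcc : ContinuousAt (fun z : OrthonormalFrame n M => (a⁻¹, a • z)) z₀ :=
        continuousAt_const.prodMk hc
      exact hcc.eventually (hKe i)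
    filter_upwards [hb0, hb1, hk, hc.eventually hHS, hαe] with z h0 h1 h2 h3 h4
    rw [← h4]
    have hlin : ∀ v : E (a • z), a⁻¹ • (⟨a • z, v⟩ : TotalSpace F E) =
        ⟨z, (fiberMap (F := F) E κ a z).symm v⟩ := by
      intro v
      rw [inv_smul_eq_iff, smul_mk κ, LinearIsometryEquiv.apply_symm_apply]
    let L : E (a • z) →ₗ[ℂ] F := (e₀.linearMapAt ℂ z).comp
      (fiberMap (F := F) E κ a z).symm.toLinearEquiv.toLinearMap
    have hL : ∀ v : E (a • z), L v = (e₀ (a⁻¹ • (⟨a • z, v⟩ : TotalSpace F E))).2 := by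
      intro v
      rw [hlin]
      change e₀.linearMapAt ℂ z _ = _
      rw [e₀.coe_linearMapAt_of_mem (R := ℂ) h0]
      rfl
    change (e₀ ⟨z, (fiberMap (F := F) E κ a z).symm (S ⟨a • z, trivial⟩)⟩).2 = _
    rw [← hlin, ← hL]
    have hS' : S ⟨a • z, trivial⟩ = e.symmₗ ℂ (a • z) (e ⟨a • z, S ⟨a • z, trivial⟩⟩).2 := by
      rw [e.symmₗ_apply h1]
      exact (e.symm_apply_apply_mk h1 _).symm
    rw [hS', h3]
    conv_lhs => rw [← b.sum_repr (H (coord w₀.base (a • z)))]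
    rw [map_sum, map_sum]
    refine Finset.sum_congr rfl fun i _ => ?_
    rw [map_smul, map_smul, e.symmₗ_apply h1, hL, ← h2 i]
    rfl

end Translations

/-! ### The part of a given type as an annihilator -/

section TypeParts

variable {n : ℕ} {M : Type*} [TopologicalSpace M] [ChartedSpace (Euc n) M]
  [RiemannianBundle (fun x : M => TangentSpace (𝓡 n) x)] [IsManifold (𝓡 n) ∞ M]
  [IsContMDiffRiemannianBundle (𝓡 n) ∞ (Euc n) (fun x : M => TangentSpace (𝓡 n) x)]
  {F : Type*} [NormedAddCommGroup F] [NormedSpace ℂ F]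
  {E : OrthonormalFrame n M → Type*} [∀ z, NormedAddCommGroup (E z)]
  [∀ z, InnerProductSpace ℂ (E z)] [TopologicalSpace (TotalSpace F E)]
  [FiberBundle F E] [VectorBundle ℂ F E]
  {A N : Type*} [Group A] [TopologicalSpace A] [NormedAddCommGroup N] [NormedSpace ℝ N]
  (κ : A → A → N) [MulAction A (OrthonormalFrame n M)] [MulAction A (TotalSpace F E)]
  [IsEquivariantBundle F E κ]
  {W : Type*} [NormedAddCommGroup W] [InnerProductSpace ℂ W] [CompleteSpace W]
  (τ : A →* UnitaryGroup W)

variable (F E) in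
/-- The sections annihilated by all elements of the group algebra that vanish in `τ`. -/
def killed : Submodule ℂ (TotalSection E) where
  carrier := {S | ∀ c : A →₀ ℂ, c.sum (fun a r => r • (τ a⁻¹ : W →L[ℂ] W)) = 0 →
    c.sum (fun a r => r • pull F E κ a S) = 0}
  zero_mem' := fun c _ => by simp
  add_mem' := fun {S T} hS hT c hc => by
    have := congrArg₂ (· + ·) (hS c hc) (hT c hc)
    simpa [Finsupp.sum, Finset.sum_add_distrib] using this
  smul_mem' := fun r S hS c hc => by
    have := congrArg (r • ·) (hS c hc)
    simpa only [Finsupp.sum, Finset.smul_sum, map_smul, smul_zero, smul_comm r] using this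

theorem sum_pull_apply (c : A →₀ ℂ) (S : TotalSection E) (z : (Set.univ : Set (OrthonormalFrame n M))) :
    (c.sum fun a r => r • pull F E κ a S) z = c.sum fun a r => r • pull F E κ a S z := by
  simp only [Finsupp.sum, Finset.sum_apply, Pi.smul_apply]

/-- For an equivariant `T` the translate of `T w` by `a` is $T(\tau(a)^{-1}w)$, so the sum is `T` of
a zero vector. Only the values on the orbit of `z` enter, so a section over an invariant set
suffices; `mem_killed_of_forall` uses this on each fibre separately. -/
theorem sum_fiberMap_eq_zero {Z : Set (OrthonormalFrame n M)} (hZ : ∀ a : A, ∀ z ∈ Z, a • z ∈ Z)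
    {V : Submodule ℂ (∀ z : Z, E z)} {s : ∀ z : Z, E z} (hs : s ∈ typePart F E τ V LinearMap.id)
    {c : A →₀ ℂ} (hc : c.sum (fun a r => r • (τ a⁻¹ : W →L[ℂ] W)) = 0) (z : Z) :
    c.sum (fun a r => r • (fiberMap (F := F) E κ a z.1).symm (s ⟨a • z.1, hZ a z.1 z.2⟩)) = 0 := by
  let Q : (∀ z : Z, E z) →ₗ[ℂ] E z.1 := c.sum fun a r =>
    r • ((fiberMap (F := F) E κ a z.1).symm.toLinearEquiv.toLinearMap ∘ₗ
      LinearMap.proj (⟨a • z.1, hZ a z.1 z.2⟩ : Z))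
  have hQ : ∀ s, Q s = c.sum fun a r =>
      r • (fiberMap (F := F) E κ a z.1).symm (s ⟨a • z.1, hZ a z.1 z.2⟩) := by
    intro s
    simp only [Q, Finsupp.sum, LinearMap.sum_apply]
    rfl
  rw [← hQ]
  suffices h : typePart F E τ V LinearMap.id ≤ LinearMap.ker Q from h hs
  refine iSup₂_le fun T hT => ?_
  rintro _ ⟨w, rfl⟩
  rw [LinearMap.mem_ker, hQ]
  have h1 : ∀ a : A, (fiberMap (F := F) E κ a z.1).symm (T w ⟨a • z.1, hZ a z.1 z.2⟩) =
      T ((τ a⁻¹ : W →L[ℂ] W) w) z := by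
    intro a
    have h := hT.2 a ((τ a⁻¹ : W →L[ℂ] W) w) z ⟨a • z.1, hZ a z.1 z.2⟩ rfl
    have h2 : (τ a : W →L[ℂ] W) ((τ a⁻¹ : W →L[ℂ] W) w) = w := by
      have : ((τ a * τ a⁻¹ : UnitaryGroup W) : W →L[ℂ] W) w = w := by
        rw [← map_mul, mul_inv_cancel, map_one]; rfl
      exact this
    rw [h2, smul_mk κ] at h
    rw [LinearIsometryEquiv.symm_apply_eq]
    exact (eq_of_heq (TotalSpace.mk.inj h).2).symm
  simp only [h1]
  have h3 : c.sum (fun a r => r • T ((τ a⁻¹ : W →L[ℂ] W) w) z) =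
      (T ((c.sum fun a r => r • (τ a⁻¹ : W →L[ℂ] W)) w)) z := by
    simp only [Finsupp.sum, sum_apply, map_sum, Finset.sum_apply]
    refine Finset.sum_congr rfl fun a _ => ?_
    rw [smul_apply, map_smul]
    rfl
  rw [h3, hc]
  simp

theorem mem_killed_of_forall {S : TotalSection E}
    (h : ∀ z : OrthonormalFrame n M, ∃ (Z : Set (OrthonormalFrame n M)) (V : Submodule ℂ (∀ z : Z, E z)),
      z ∈ Z ∧ (∀ a : A, ∀ z ∈ Z, a • z ∈ Z) ∧
      (fun z : Z => S ⟨z.1, trivial⟩) ∈ typePart F E τ V LinearMap.id) :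
    S ∈ killed F E κ τ := by
  intro c hc
  funext z
  obtain ⟨Z, V, hz, hZ, hS⟩ := h z.1
  rw [sum_pull_apply]
  exact sum_fiberMap_eq_zero κ τ hZ hS hc ⟨z.1, hz⟩

theorem typePart_le {X : Type*} [AddCommGroup X] [Module ℂ X] {Z : Set (OrthonormalFrame n M)}
    (V : Submodule ℂ X) (ev : X →ₗ[ℂ] ∀ z : Z, E z) : typePart F E τ V ev ≤ V := by
  refine iSup₂_le fun T hT => ?_
  rintro _ ⟨w, rfl⟩
  exact hT.1 w

theorem restrict_mem_typePart {S : TotalSection E}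
    (hS : S ∈ typePart F E τ (smoothSections F E Set.univ) LinearMap.id)
    (Z : Set (OrthonormalFrame n M)) :
    (fun z : Z => S ⟨z.1, trivial⟩) ∈ typePart F E τ (smoothSections F E Z) LinearMap.id := by
  let res : TotalSection E →ₗ[ℂ] ∀ z : Z, E z :=
    { toFun := fun S z => S ⟨z.1, trivial⟩
      map_add' := fun _ _ => rfl
      map_smul' := fun _ _ => rfl }
  suffices h : typePart F E τ (smoothSections F E Set.univ) LinearMap.id ≤
    (typePart F E τ (smoothSections F E Z) LinearMap.id).comap res from h hS
  refine iSup₂_le fun T hT => ?_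
  rintro _ ⟨w, rfl⟩
  refine Submodule.mem_iSup_of_mem (res ∘ₗ T) (Submodule.mem_iSup_of_mem ⟨fun w => ?_, ?_⟩ ⟨w, rfl⟩)
  · exact restrict_mem_smoothSections (hT.1 w) Z
  · intro a w z z' hz
    exact hT.2 a w ⟨z.1, trivial⟩ ⟨z'.1, trivial⟩ hz

/-- Since the action is specified through `ev` alone, equivariant maps lift along the injective
`ev`. This moves the question from sections of $\mathcal E^\sigma$ or $\mathcal T^\rho$ to sections
of $E$. -/
theorem map_typePart {X : Type*} [AddCommGroup X] [Module ℂ X] (V : Submodule ℂ X)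
    {ev : X →ₗ[ℂ] TotalSection E} (hev : Function.Injective ev) :
    (typePart F E τ V ev).map ev = typePart F E τ (V.map ev) LinearMap.id := by
  refine le_antisymm ?_ ?_
  · rw [Submodule.map_le_iff_le_comap]
    refine iSup₂_le fun T hT => ?_
    rintro _ ⟨w, rfl⟩
    exact Submodule.mem_iSup_of_mem (ev ∘ₗ T)
      (Submodule.mem_iSup_of_mem ⟨fun w => ⟨_, hT.1 w, rfl⟩, hT.2⟩ ⟨w, rfl⟩)
  · refine iSup₂_le fun T hT => ?_
    have hr : ∀ w, T w ∈ LinearMap.range ev := fun w => by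
      obtain ⟨x, -, hx⟩ := hT.1 w
      exact ⟨x, hx⟩
    let T' : W →ₗ[ℂ] X := (LinearEquiv.ofInjective ev hev).symm.toLinearMap ∘ₗ T.codRestrict _ hr
    have hT' : ∀ w, ev (T' w) = T w := fun w =>
      congrArg Subtype.val ((LinearEquiv.ofInjective ev hev).apply_symm_apply ⟨T w, hr w⟩)
    rintro _ ⟨w, rfl⟩
    refine ⟨T' w, Submodule.mem_iSup_of_mem T' (Submodule.mem_iSup_of_mem ⟨fun w => ?_, ?_⟩ ⟨w, rfl⟩),
      hT' w⟩
    · obtain ⟨x, hx, hx'⟩ := hT.1 w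
      rwa [hev ((hT' w).trans hx'.symm)]
    · intro a w z z' hz
      rw [hT', hT']
      exact hT.2 a w z z' hz

/-- The part of type `τ` of a space of sections that is stable under translations. -/
theorem typePart_eq_inf_killed [FiniteDimensional ℂ W] (hτ : IsIrreducibleRep τ)
    {V : Submodule ℂ (TotalSection E)} (hV : ∀ (a : A), ∀ S ∈ V, pull F E κ a S ∈ V) :
    typePart F E τ V LinearMap.id = V ⊓ killed F E κ τ := by
  refine le_antisymm (le_inf (typePart_le τ V _) fun S hS => mem_killed_of_forall κ τ fun z =>
    ⟨Set.univ, V, trivial, fun _ _ _ => trivial, hS⟩) ?_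
  rintro S ⟨hSV, hS⟩
  let p : (A →₀ ℂ) →ₗ[ℂ] (W →ₗ[ℂ] W) :=
    Finsupp.linearCombination ℂ fun a => ((τ a⁻¹ : W →L[ℂ] W) : W →ₗ[ℂ] W)
  let q : (A →₀ ℂ) →ₗ[ℂ] TotalSection E := Finsupp.linearCombination ℂ fun a => pull F E κ a S
  -- The translate of `S` by an element `c` of the group algebra depends only on the operator `p c`.
  have hpq : ∀ c, p c = 0 → q c = 0 := by
    intro c hc
    refine hS c ?_
    ext w
    have := LinearMap.congr_fun hc w
    simpa [p, Finsupp.linearCombination_apply, Finsupp.sum, sum_apply,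
      LinearMap.sum_apply] using this
  -- By Burnside's theorem every operator occurs, so `q` factors through a linear map `Λ` on all of
  -- $\operatorname{End}W$.
  have hp : Function.Surjective p := by
    intro f
    obtain ⟨c, hc⟩ := hτ.exists_sum_eq f
    refine ⟨c.mapDomain (fun a => a⁻¹), ?_⟩
    rw [← hc, Finsupp.linearCombination_mapDomain, Finsupp.linearCombination_apply]
    simp
  obtain ⟨g, hg⟩ := p.exists_rightInverse_of_surjective (LinearMap.range_eq_top.2 hp)
  let Λ : (W →ₗ[ℂ] W) →ₗ[ℂ] TotalSection E := q ∘ₗ g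
  have hΛ : ∀ c, Λ (p c) = q c := by
    intro c
    have h1 : p (g (p c) - c) = 0 := by
      rw [map_sub, sub_eq_zero]
      exact LinearMap.congr_fun hg (p c)
    have h2 := hpq _ h1
    rwa [map_sub, sub_eq_zero] at h2
  have hΛs : ∀ a, Λ ((τ a⁻¹ : W →L[ℂ] W) : W →ₗ[ℂ] W) = pull F E κ a S := by
    intro a
    have := hΛ (Finsupp.single a 1)
    simpa [p, q] using this
  have hΛV : ∀ f, Λ f ∈ V := by
    intro f
    change q (g f) ∈ V
    rw [Finsupp.linearCombination_apply]
    exact V.sum_mem fun a _ => V.smul_mem _ (hV a S hSV)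
  have hΛm : ∀ a f, pull F E κ a (Λ f) = Λ (((τ a⁻¹ : W →L[ℂ] W) : W →ₗ[ℂ] W) ∘ₗ f) := by
    intro a f
    obtain ⟨c, rfl⟩ := hp f
    have hlin : (pull F E κ a ∘ₗ Λ) ∘ₗ p =
        (Λ ∘ₗ LinearMap.llcomp ℂ W W W ((τ a⁻¹ : W →L[ℂ] W) : W →ₗ[ℂ] W)) ∘ₗ p := by
      refine Finsupp.lhom_ext fun b r => ?_
      have h1 : p (Finsupp.single b r) = r • ((τ b⁻¹ : W →L[ℂ] W) : W →ₗ[ℂ] W) := by simp [p]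
      have h2 : ((τ a⁻¹ : W →L[ℂ] W) : W →ₗ[ℂ] W) ∘ₗ ((τ b⁻¹ : W →L[ℂ] W) : W →ₗ[ℂ] W) =
          ((τ (b * a)⁻¹ : W →L[ℂ] W) : W →ₗ[ℂ] W) := by
        rw [mul_inv_rev, map_mul]; rfl
      simp only [LinearMap.comp_apply, h1, map_smul, hΛs, pull_pull]
      rw [← hΛs, ← h2]
      rfl
    exact LinearMap.congr_fun hlin c
  have hS1 : S = Λ LinearMap.id := by
    have := hΛs 1
    rw [inv_one, map_one, pull_one] at this
    exact this.symm
  let b := Module.finBasis ℂ W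
  -- The section is `Λ 1`, and the identity is a sum of operators of rank one. For fixed `i`,
  -- sending `w` to `Λ` of the operator $x\mapsto x_iw$ is an equivariant map on $W$, as translation
  -- corresponds to left multiplication (`hΛm`).
  have hid : (LinearMap.id : W →ₗ[ℂ] W) = ∑ i, (b.coord i).smulRight (b i) := by
    ext w
    simp [LinearMap.sum_apply, b.sum_repr]
  rw [hS1, hid, map_sum]
  refine Submodule.sum_mem _ fun i _ => ?_
  let T : W →ₗ[ℂ] TotalSection E := Λ ∘ₗ LinearMap.smulRightₗ (b.coord i)
  refine Submodule.mem_iSup_of_mem T (Submodule.mem_iSup_of_mem ⟨fun w => hΛV _, ?_⟩ ⟨b i, rfl⟩)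
  rintro a w ⟨z, _⟩ ⟨z', _⟩ rfl
  change a • (⟨z, T w ⟨z, trivial⟩⟩ : TotalSpace F E) = ⟨a • z, T ((τ a : W →L[ℂ] W) w) ⟨a • z, trivial⟩⟩
  rw [← pull_apply_eq_iff κ]
  have h1 : pull F E κ a (T ((τ a : W →L[ℂ] W) w)) = T w := by
    change pull F E κ a (Λ ((b.coord i).smulRight _)) = Λ ((b.coord i).smulRight w)
    rw [hΛm]
    congr 1
    ext x
    have : (τ a⁻¹ : W →L[ℂ] W) ((τ a : W →L[ℂ] W) w) = w := by
      have : ((τ a⁻¹ * τ a : UnitaryGroup W) : W →L[ℂ] W) w = w := by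
        rw [← map_mul, inv_mul_cancel, map_one]; rfl
      exact this
    rw [LinearMap.comp_apply, LinearMap.smulRight_apply, LinearMap.smulRight_apply, map_smul]
    exact congrArg _ this
  rw [h1]

variable {B N' : Type*} [Group B] [TopologicalSpace B] [NormedAddCommGroup N'] [NormedSpace ℝ N']
  (κ' : B → B → N') [MulAction B (OrthonormalFrame n M)] [MulAction B (TotalSpace F E)]
  [IsEquivariantBundle F E κ']

theorem pull_comm [SMulCommClass A B (OrthonormalFrame n M)] [SMulCommClass A B (TotalSpace F E)]
    (a : A) (b : B) (S : TotalSection E) :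
    pull F E κ a (pull F E κ' b S) = pull F E κ' b (pull F E κ a S) := by
  funext ⟨z, _⟩
  refine (pull_apply_eq_iff κ a _ z _).2 ?_
  have h : ∀ w : OrthonormalFrame n M, w = a • b • z →
      (⟨w, S ⟨w, trivial⟩⟩ : TotalSpace F E) = ⟨a • b • z, S ⟨a • b • z, trivial⟩⟩ := by
    rintro w rfl; rfl
  rw [← smul_left_cancel_iff b, ← smul_comm a b, smul_pull, smul_pull, smul_pull]
  exact (h _ (smul_comm a b z).symm).symm

/-- Because the actions commute, imposing one type leaves a space that is invariant under the other
group, so that `typePart_eq_inf_killed` applies a second time. -/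
theorem pull_mem_killed [SMulCommClass A B (OrthonormalFrame n M)] [SMulCommClass A B (TotalSpace F E)]
    (b : B) {S : TotalSection E} (hS : S ∈ killed F E κ τ) : pull F E κ' b S ∈ killed F E κ τ := by
  intro c hc
  have := congrArg (pull F E κ' b) (hS c hc)
  simpa only [Finsupp.sum, map_sum, map_smul, map_zero, ← pull_comm κ κ'] using this

end TypeParts

/-! ### The isomorphism of the spaces of sections -/

section Correspondence

variable {n d : ℕ} {M : Type*} [TopologicalSpace M] [ChartedSpace (Euc n) M]
  [RiemannianBundle (fun x : M => TangentSpace (𝓡 n) x)] [IsManifold (𝓡 n) ∞ M]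
  [IsContMDiffRiemannianBundle (𝓡 n) ∞ (Euc n) (fun x : M => TangentSpace (𝓡 n) x)]
  {F : Type*} [NormedAddCommGroup F] [NormedSpace ℂ F]
  {E : OrthonormalFrame n M → Type*} [∀ z, NormedAddCommGroup (E z)]
  [∀ z, InnerProductSpace ℂ (E z)] [TopologicalSpace (TotalSpace F E)]
  [FiberBundle F E] [VectorBundle ℂ F E]

instance {G : Type*} [Group G] [MulAction G M] [IsometricAction n M G] :
    SMulCommClass G (OrthGroup n) (OrthonormalFrame n M) := ⟨fun g k z => smul_orth_smul g k z⟩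

instance {G : Type*} [Group G] [MulAction G M] [IsometricAction n M G] :
    SMulCommClass (OrthGroup n) G (OrthonormalFrame n M) := .symm _ _ _

section OverM

variable
  [MulAction (OrthGroup n) (TotalSpace F E)]
  {W : Type*} [NormedAddCommGroup W] [InnerProductSpace ℂ W] [CompleteSpace W]
  (σ : OrthGroup n →* UnitaryGroup W)

theorem totalE_apply (s : ∀ x : M, bundleE F E σ x) (x : M) (z : fiber (n := n) x) :
    totalE F E σ s ⟨z.1, trivial⟩ = (s x).1 z := by
  obtain ⟨z, rfl⟩ := z
  rfl

theorem totalE_injective : Function.Injective (totalE (n := n) (M := M) F E σ) := by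
  intro s s' h
  funext x
  refine Subtype.ext (funext fun z => ?_)
  rw [← totalE_apply, ← totalE_apply, h]

variable (n) in
/-- The coordinates of the orthogonal group as a submanifold of the space of operators. -/
abbrev orthCoord (_ k : OrthGroup n) : Euc n →L[ℝ] Euc n := k

variable [FiniteDimensional ℂ F] [FiniteDimensional ℂ W] [IsEquivariantBundle F E (orthCoord n)]

/-- If each restriction to a fibre is of type $\sigma$, the section is annihilated, since this is
tested on orbits. Conversely, an annihilated smooth section lies in the part of type $\sigma$ of
$\Gamma(F_O,E)$, and equivariant maps into $\Gamma(F_O,E)$ can be restricted to the fibres. -/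
theorem map_totalE_sectionsE (hσ : IsIrreducibleRep σ) :
    (sectionsE F E σ).map (totalE (n := n) (M := M) F E σ) =
      smoothSections F E Set.univ ⊓ killed F E (orthCoord n) σ := by
  refine le_antisymm ?_ ?_
  · rintro _ ⟨s, hs, rfl⟩
    refine ⟨hs, mem_killed_of_forall _ σ fun z => ⟨fiber z.base, smoothSections F E _, rfl, fun k w hw => hw, ?_⟩⟩
    exact (funext fun z' => (totalE_apply σ s z.base z').symm : (s z.base).1 = _) ▸ (s z.base).2
  · rintro S ⟨hS, hk⟩
    have h1 : S ∈ typePart F E σ (smoothSections F E Set.univ) LinearMap.id := by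
      rw [typePart_eq_inf_killed (orthCoord n) σ hσ fun a S hS =>
        pull_mem_smoothSections _ isSmoothAction_orth a hS]
      exact ⟨hS, hk⟩
    exact ⟨fun x => ⟨_, restrict_mem_typePart σ h1 (fiber x)⟩, hS, rfl⟩

end OverM

section OverQuotient

variable
  {G : Type*} [TopologicalSpace G] [ChartedSpace (Euc d) G] [Group G]
  [MulAction G M] [IsometricAction n M G] [MulAction G (TotalSpace F E)]
  {V : Type*} [NormedAddCommGroup V] [InnerProductSpace ℂ V] [CompleteSpace V]
  (ρ : G →* UnitaryGroup V)

theorem totalT_apply (t : ∀ y : FrameQuotient n M G, bundleT F E ρ y) (y : FrameQuotient n M G)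
    (z : orbitFiber G y) : totalT F E ρ t ⟨z.1, trivial⟩ = (t y).1 z := by
  obtain ⟨z, rfl⟩ := z
  rfl

theorem totalT_injective : Function.Injective (totalT (n := n) (M := M) F E ρ) := by
  intro s s' h
  funext x
  refine Subtype.ext (funext fun z => ?_)
  rw [← totalT_apply, ← totalT_apply, h]

variable (d G) in
/-- The charts of `G`. -/
abbrev groupCoord (a₀ a : G) : Euc d := extChartAt (𝓡 d) a₀ a

variable [FiniteDimensional ℂ F] [FiniteDimensional ℂ V] [IsEquivariantBundle F E (groupCoord d G)]

theorem map_totalT_sectionsT (hρ : IsIrreducibleRep ρ) :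
    (sectionsT F E ρ).map (totalT (n := n) (M := M) F E ρ) =
      smoothSections F E Set.univ ⊓ killed F E (groupCoord d G) ρ := by
  refine le_antisymm ?_ ?_
  · rintro _ ⟨s, hs, rfl⟩
    refine ⟨hs, mem_killed_of_forall _ ρ fun z => ⟨orbitFiber G (proj n M G z), smoothSections F E _, rfl,
      fun k w hw => (proj_smul k w).trans hw, ?_⟩⟩
    exact (funext fun z' => (totalT_apply ρ s _ z').symm : (s (proj n M G z)).1 = _) ▸
      (s (proj n M G z)).2
  · rintro S ⟨hS, hk⟩
    have h1 : S ∈ typePart F E ρ (smoothSections F E Set.univ) LinearMap.id := by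
      rw [typePart_eq_inf_killed (groupCoord d G) ρ hρ fun a S hS =>
        pull_mem_smoothSections _ isSmoothAction a hS]
      exact ⟨hS, hk⟩
    exact ⟨fun x => ⟨_, restrict_mem_typePart ρ h1 (orbitFiber G x)⟩, hS, rfl⟩

end OverQuotient

variable
  {G : Type*} [TopologicalSpace G] [ChartedSpace (Euc d) G] [Group G]
  [MulAction G M] [IsometricAction n M G] [MulAction G (TotalSpace F E)]
  {V : Type*} [NormedAddCommGroup V] [InnerProductSpace ℂ V] [CompleteSpace V]
  (ρ : G →* UnitaryGroup V)
  [MulAction (OrthGroup n) (TotalSpace F E)]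
  {W : Type*} [NormedAddCommGroup W] [InnerProductSpace ℂ W] [CompleteSpace W]
  (σ : OrthGroup n →* UnitaryGroup W)
  [FiniteDimensional ℂ F] [FiniteDimensional ℂ V] [FiniteDimensional ℂ W]
  [IsEquivariantBundle F E (groupCoord d G)] [IsEquivariantBundle F E (orthCoord n)]
  [@SMulCommClass G (OrthGroup n) (TotalSpace F E) SemigroupAction.toSMul SemigroupAction.toSMul]

theorem map_totalE_sectionsETyped (hρ : IsIrreducibleRep ρ) (hσ : IsIrreducibleRep σ) :
    (sectionsETyped F E σ ρ).map (totalE (n := n) (M := M) F E σ) =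
      (smoothSections F E Set.univ ⊓ killed F E (orthCoord n) σ) ⊓ killed F E (groupCoord d G) ρ := by
  have : @SMulCommClass (OrthGroup n) G (TotalSpace F E) SemigroupAction.toSMul SemigroupAction.toSMul :=
    .symm _ _ _
  rw [sectionsETyped, map_typePart ρ _ (totalE_injective (F := F) (E := E) σ),
    map_totalE_sectionsE (F := F) (E := E) σ hσ]
  exact typePart_eq_inf_killed (groupCoord d G) ρ hρ fun g S hS =>
    ⟨pull_mem_smoothSections _ isSmoothAction g hS.1, pull_mem_killed _ σ _ g hS.2⟩

theorem map_totalT_sectionsTTyped (hρ : IsIrreducibleRep ρ) (hσ : IsIrreducibleRep σ) :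
    (sectionsTTyped F E ρ σ).map (totalT (n := n) (M := M) F E ρ) =
      (smoothSections F E Set.univ ⊓ killed F E (groupCoord d G) ρ) ⊓ killed F E (orthCoord n) σ := by
  rw [sectionsTTyped, map_typePart σ _ (totalT_injective (F := F) (E := E) ρ),
    map_totalT_sectionsT (d := d) (F := F) (E := E) ρ hρ]
  exact typePart_eq_inf_killed (orthCoord n) σ hσ fun g S hS =>
    ⟨pull_mem_smoothSections _ isSmoothAction_orth g hS.1, pull_mem_killed _ ρ _ g hS.2⟩

variable (d F E) in
/-- The isomorphism between the two spaces of sections. -/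
def sectionsEquiv (hρ : IsIrreducibleRep ρ) (hσ : IsIrreducibleRep σ) :
    sectionsETyped (n := n) (M := M) F E σ ρ ≃ₗ[ℂ] sectionsTTyped (n := n) (M := M) F E ρ σ :=
  ((Submodule.equivMapOfInjective (totalE F E σ) (totalE_injective (F := F) (E := E) σ) _).trans
    -- The two images in the sections over the frame bundle differ only in the order of the
    -- intersections.
    (LinearEquiv.ofEq _ _ (by
      rw [map_totalE_sectionsETyped (d := d) (F := F) (E := E) ρ σ hρ hσ,
        map_totalT_sectionsTTyped (d := d) (F := F) (E := E) ρ σ hρ hσ, inf_right_comm]))).trans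
    (Submodule.equivMapOfInjective (totalT F E ρ) (totalT_injective (F := F) (E := E) ρ) _).symm

theorem totalT_sectionsEquiv (hρ : IsIrreducibleRep ρ) (hσ : IsIrreducibleRep σ)
    (s : sectionsETyped (n := n) (M := M) F E σ ρ) :
    totalT F E ρ (sectionsEquiv d F E ρ σ hρ hσ s).1 = totalE F E σ s.1 :=
  congrArg Subtype.val ((Submodule.equivMapOfInjective (totalT F E ρ)
    (totalT_injective (F := F) (E := E) ρ) (sectionsTTyped (n := n) (M := M) F E ρ σ)).apply_symm_apply _)

end Correspondence

/-! ### The norms as integrals over the frame bundle -/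

section Norms

variable {n d : ℕ} {M : Type*} [TopologicalSpace M] [T2Space M] [SecondCountableTopology M]
  [ChartedSpace (Euc n) M] [MeasurableSpace M] [BorelSpace M]
  [RiemannianBundle (fun x : M => TangentSpace (𝓡 n) x)] [IsManifold (𝓡 n) ∞ M]
  [IsContMDiffRiemannianBundle (𝓡 n) ∞ (Euc n) (fun x : M => TangentSpace (𝓡 n) x)]
  {F : Type*} [NormedAddCommGroup F] [NormedSpace ℂ F] [FiniteDimensional ℂ F]
  {E : OrthonormalFrame n M → Type*} [∀ z, NormedAddCommGroup (E z)]
  [∀ z, InnerProductSpace ℂ (E z)] [TopologicalSpace (TotalSpace F E)]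
  [FiberBundle F E] [VectorBundle ℂ F E] [IsSmoothHermitianBundle F E]

variable (n M) in
/-- The volume of the frame bundle. -/
abbrev frameVolume : Measure (OrthonormalFrame n M) := submanifoldVolume (n + n.choose 2) Set.univ

theorem continuous_inner_section {S T : TotalSection E} (hS : S ∈ smoothSections F E Set.univ)
    (hT : T ∈ smoothSections F E Set.univ) :
    Continuous fun z : OrthonormalFrame n M => inner ℂ (S ⟨z, trivial⟩) (T ⟨z, trivial⟩) := by
  rw [mem_smoothSections_univ] at hS hT
  refine continuous_iff_continuousAt.2 fun z₀ => ?_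
  let b := Module.finBasis ℂ F
  set e := trivializationAt F E z₀
  have hb : ∀ᶠ z in 𝓝 z₀, z ∈ e.baseSet :=
    e.open_baseSet.mem_nhds (FiberBundle.mem_baseSet_trivializationAt' z₀)
  have hco : ∀ i, Continuous (b.coord i) := fun i => LinearMap.continuous_of_finiteDimensional _
  have hc : ContinuousAt (fun z => ∑ i, ∑ j,
      starRingEnd ℂ (b.coord i (e ⟨z, S ⟨z, trivial⟩⟩).2) * (b.coord j (e ⟨z, T ⟨z, trivial⟩⟩).2 *
        inner ℂ (e.symm z (b i)) (e.symm z (b j)))) z₀ := by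
    refine tendsto_finsetSum _ fun i _ => tendsto_finsetSum _ fun j _ => ?_
    refine ContinuousAt.mul (Complex.continuous_conj.continuousAt.comp
      ((hco i).continuousAt.comp (hS z₀).continuousAt)) (ContinuousAt.mul
      ((hco j).continuousAt.comp (hT z₀).continuousAt) ?_)
    exact (IsSmoothHermitianBundle.smooth_inner (F := F) (E := E) e z₀
      (FiberBundle.mem_baseSet_trivializationAt' z₀) (b i) (b j)).continuousAt
  refine hc.congr ?_
  filter_upwards [hb] with z hz
  have h1 : ∀ v : E z, v = ∑ i, b.coord i (e ⟨z, v⟩).2 • e.symm z (b i) := by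
    intro v
    have h2 : v = e.symmₗ ℂ z (e ⟨z, v⟩).2 := by
      rw [e.symmₗ_apply hz]
      exact (e.symm_apply_apply_mk hz _).symm
    conv_lhs => rw [h2, ← b.sum_repr (e ⟨z, v⟩).2]
    rw [map_sum]
    refine Finset.sum_congr rfl fun i _ => ?_
    rw [map_smul, e.symmₗ_apply hz]
    rfl
  conv_rhs => rw [h1 (S ⟨z, trivial⟩), h1 (T ⟨z, trivial⟩), sum_inner]
  refine Finset.sum_congr rfl fun i _ => ?_
  rw [inner_sum]
  refine Finset.sum_congr rfl fun j _ => ?_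
  rw [inner_smul_left, inner_smul_right]

theorem measurable_enorm_section {S : TotalSection E} (hS : S ∈ smoothSections F E Set.univ) :
    Measurable fun z : OrthonormalFrame n M => ‖S ⟨z, trivial⟩‖ₑ ^ 2 := by
  have h := (continuous_inner_section hS hS).norm.measurable.ennreal_ofReal
  refine (congrArg Measurable (funext fun z => ?_)).mp h
  rw [inner_self_eq_norm_sq_to_K, norm_pow, ENNReal.ofReal_pow (norm_nonneg _)]
  simp

/-- The squared `L²`-norm over `M`, as an integral over the frame bundle. -/
theorem normSqE_eq [MulAction (OrthGroup n) (TotalSpace F E)]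
    {W : Type*} [NormedAddCommGroup W] [InnerProductSpace ℂ W] [CompleteSpace W]
    (σ : OrthGroup n →* UnitaryGroup W) {s : ∀ x : M, bundleE F E σ x} (hs : s ∈ sectionsE F E σ) :
    normSqE F E σ s = ∫⁻ z, ‖totalE F E σ s ⟨z, trivial⟩‖ₑ ^ 2 ∂(frameVolume n M) := by
  rw [← lintegral_fiber (measurable_enorm_section hs)]
  refine lintegral_congr fun x => ?_
  rw [← lintegral_comap_submanifoldVolume (measurableSet_fiber x)]
  refine lintegral_congr fun z => ?_
  rw [totalE_apply]

/-- The squared `L²`-norm over the orbit space, as an integral over the frame bundle. -/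
theorem normSqT_eq [ConnectedSpace M] {G : Type*} [TopologicalSpace G] [T2Space G] [CompactSpace G]
    [ChartedSpace (Euc d) G] [Group G] [LieGroup (𝓡 d) ∞ G] [MulAction G M]
    [ContMDiffSMul (𝓡 d) (𝓡 n) ∞ G M] [IsometricAction n M G] [MulAction G (TotalSpace F E)]
    {V : Type*} [NormedAddCommGroup V] [InnerProductSpace ℂ V] [CompleteSpace V]
    (ρ : G →* UnitaryGroup V) {t : ∀ y : FrameQuotient n M G, bundleT F E ρ y}
    (ht : t ∈ sectionsT F E ρ) :
    normSqT F E d ρ t = ∫⁻ z, ‖totalT F E ρ t ⟨z, trivial⟩‖ₑ ^ 2 ∂(frameVolume n M) := by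
  rw [← lintegral_orbit (d := d) (G := G) (measurable_enorm_section ht)]
  refine lintegral_congr fun y => ?_
  rw [← lintegral_comap_submanifoldVolume (measurableSet_orbitFiber d y)]
  refine lintegral_congr fun z => ?_
  rw [totalT_apply]

end Norms

/-! ### Hilbert space completions -/

theorem exists_hilbert_completion {Y : Type uM} [AddCommGroup Y] [Module ℂ Y]
    (c : PreInnerProductSpace.Core ℂ Y) :
    ∃ (H : Type uM) (_ : NormedAddCommGroup H) (_ : InnerProductSpace ℂ H) (ι : Y →ₗ[ℂ] H),
      CompleteSpace H ∧ DenseRange ι ∧ ∀ s, ‖ι s‖ ^ 2 = RCLike.re (c.inner s s) := by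
  -- A semidefinite form suffices, because the completion identifies the elements at distance zero.
  let : SeminormedAddCommGroup Y := InnerProductSpace.Core.toSeminormedAddCommGroup (c := c)
  let : InnerProductSpace ℂ Y := InnerProductSpace.ofCore c
  refine ⟨UniformSpace.Completion Y, inferInstance, inferInstance,
    (UniformSpace.Completion.toComplₗᵢ (𝕜 := ℂ) (E := Y)).toLinearMap, inferInstance,
    UniformSpace.Completion.denseRange_coe, fun s => ?_⟩
  rw [LinearIsometry.coe_toLinearMap, LinearIsometry.norm_map, ← inner_self_eq_norm_sq (𝕜 := ℂ)]

/-- A norm preserving isomorphism of two spaces extends uniquely to their completions. -/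
theorem existsUnique_extension {X₁ X₂ : Type*} [AddCommGroup X₁] [Module ℂ X₁] [AddCommGroup X₂]
    [Module ℂ X₂] {V₁ : Submodule ℂ X₁} {V₂ : Submodule ℂ X₂} {N₁ : X₁ → ℝ≥0∞} {N₂ : X₂ → ℝ≥0∞}
    (h₁ : ∀ s, s ∈ squareIntegrable V₁ N₁ ↔ s ∈ V₁ ∧ N₁ s < ⊤)
    (h₂ : ∀ s, s ∈ squareIntegrable V₂ N₂ ↔ s ∈ V₂ ∧ N₂ s < ⊤)
    (Φ : V₁ ≃ₗ[ℂ] V₂) (hΦ : ∀ s, N₂ (Φ s).1 = N₁ s.1)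
    {H₁ : Type*} [NormedAddCommGroup H₁] [InnerProductSpace ℂ H₁]
    {ι₁ : squareIntegrable V₁ N₁ →ₗ[ℂ] H₁} (hι₁ : IsL2Completion V₁ N₁ ι₁)
    {H₂ : Type*} [NormedAddCommGroup H₂] [InnerProductSpace ℂ H₂]
    {ι₂ : squareIntegrable V₂ N₂ →ₗ[ℂ] H₂} (hι₂ : IsL2Completion V₂ N₂ ι₂) :
    ∃! Ψ : H₁ ≃ₗᵢ[ℂ] H₂, ∀ (s : V₁) (hs : s.1 ∈ squareIntegrable V₁ N₁)
      (ht : (Φ s).1 ∈ squareIntegrable V₂ N₂), Ψ (ι₁ ⟨s.1, hs⟩) = ι₂ ⟨(Φ s).1, ht⟩ := by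
  obtain ⟨hc₁, hd₁, hn₁⟩ := hι₁
  obtain ⟨hc₂, hd₂, hn₂⟩ := hι₂
  have hmem : ∀ s : squareIntegrable V₁ N₁,
      (Φ ⟨s.1, ((h₁ _).1 s.2).1⟩).1 ∈ squareIntegrable V₂ N₂ := fun s =>
    (h₂ _).2 ⟨(Φ _).2, (hΦ _).trans_lt ((h₁ _).1 s.2).2⟩
  have hmem' : ∀ t : squareIntegrable V₂ N₂,
      (Φ.symm ⟨t.1, ((h₂ _).1 t.2).1⟩).1 ∈ squareIntegrable V₁ N₁ := fun t =>
    (h₁ _).2 ⟨(Φ.symm _).2, by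
      rw [← hΦ, Φ.apply_symm_apply]
      exact ((h₂ _).1 t.2).2⟩
  let e : squareIntegrable V₁ N₁ ≃ₗ[ℂ] squareIntegrable V₂ N₂ :=
    { toFun := fun s => ⟨_, hmem s⟩
      invFun := fun t => ⟨_, hmem' t⟩
      left_inv := fun s => Subtype.ext (congrArg (Subtype.val : V₁ → X₁)
        (Φ.symm_apply_apply ⟨s.1, ((h₁ _).1 s.2).1⟩))
      right_inv := fun s => Subtype.ext (congrArg (Subtype.val : V₂ → X₂)
        (Φ.apply_symm_apply ⟨s.1, ((h₂ _).1 s.2).1⟩))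
      map_add' := fun s t => Subtype.ext (congrArg (Subtype.val : V₂ → X₂)
        (Φ.map_add ⟨s.1, ((h₁ _).1 s.2).1⟩ ⟨t.1, ((h₁ _).1 t.2).1⟩))
      map_smul' := fun c s => Subtype.ext (congrArg (Subtype.val : V₂ → X₂)
        (Φ.map_smul c ⟨s.1, ((h₁ _).1 s.2).1⟩)) }
  have hnorm : ∀ s, ‖ι₂ (e s)‖ = ‖ι₁ s‖ := by
    intro s
    have h : ‖ι₂ (e s)‖ₑ ^ 2 = ‖ι₁ s‖ₑ ^ 2 := by
      rw [hn₁, hn₂]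
      exact hΦ _
    have h' := (ENNReal.pow_right_strictMono two_ne_zero).injective h
    simpa using congrArg ENNReal.toReal h'
  refine ⟨e.extendOfIsometry ι₁ ι₂ hd₁ hd₂ hnorm, fun s hs ht => ?_, fun Ψ hΨ => ?_⟩
  · exact e.extendOfIsometry_eq ι₁ ι₂ hd₁ hd₂ hnorm ⟨s.1, hs⟩
  · refine LinearIsometryEquiv.ext fun x => ?_
    refine congrFun (hd₁.equalizer Ψ.continuous
      (e.extendOfIsometry ι₁ ι₂ hd₁ hd₂ hnorm).continuous (funext fun s => ?_)) x
    exact (hΨ ⟨s.1, ((h₁ _).1 s.2).1⟩ s.2 (hmem s)).trans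
      (e.extendOfIsometry_eq ι₁ ι₂ hd₁ hd₂ hnorm s).symm

section SquareIntegrable

variable {n : ℕ} {M : Type*} [TopologicalSpace M] [T2Space M] [SecondCountableTopology M]
  [ChartedSpace (Euc n) M] [MeasurableSpace M] [BorelSpace M]
  [RiemannianBundle (fun x : M => TangentSpace (𝓡 n) x)] [IsManifold (𝓡 n) ∞ M]
  [IsContMDiffRiemannianBundle (𝓡 n) ∞ (Euc n) (fun x : M => TangentSpace (𝓡 n) x)]
  {F : Type*} [NormedAddCommGroup F] [NormedSpace ℂ F] [FiniteDimensional ℂ F]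
  {E : OrthonormalFrame n M → Type*} [∀ z, NormedAddCommGroup (E z)]
  [∀ z, InnerProductSpace ℂ (E z)] [TopologicalSpace (TotalSpace F E)]
  [FiberBundle F E] [VectorBundle ℂ F E] [IsSmoothHermitianBundle F E]

/-- The span in `squareIntegrable` adds nothing, by $\|a+b\|^2\le2(\|a\|^2+\|b\|^2)$. -/
theorem mem_squareIntegrable_iff {X : Type*} [AddCommGroup X] [Module ℂ X] {V : Submodule ℂ X}
    {N : X → ℝ≥0∞} {L : X →ₗ[ℂ] TotalSection E} {μ : Measure (OrthonormalFrame n M)}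
    (hL : ∀ s ∈ V, L s ∈ smoothSections F E Set.univ)
    (hN : ∀ s ∈ V, N s = ∫⁻ z, ‖L s ⟨z, trivial⟩‖ₑ ^ 2 ∂μ) (s : X) :
    s ∈ squareIntegrable V N ↔ s ∈ V ∧ N s < ⊤ := by
  refine ⟨fun hs => ?_, fun hs => Submodule.subset_span hs⟩
  induction hs using Submodule.span_induction with
  | mem s hs => exact hs
  | zero =>
    refine ⟨V.zero_mem, ?_⟩
    rw [hN 0 V.zero_mem]
    simp
  | add s t _ _ hs ht =>
    refine ⟨V.add_mem hs.1 ht.1, ?_⟩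
    rw [hN _ (V.add_mem hs.1 ht.1)]
    have h1 := hs.2
    have h2 := ht.2
    rw [hN _ hs.1] at h1
    rw [hN _ ht.1] at h2
    have hle : ∀ z : OrthonormalFrame n M, ‖L (s + t) ⟨z, trivial⟩‖ₑ ^ 2 ≤
        2 * (‖L s ⟨z, trivial⟩‖ₑ ^ 2 + ‖L t ⟨z, trivial⟩‖ₑ ^ 2) := by
      intro z
      rw [map_add]
      have h3 := enorm_add_le (L s ⟨z, trivial⟩) (L t ⟨z, trivial⟩)
      refine (pow_le_pow_left' h3 2).trans ?_
      have := ENNReal.rpow_add_le_mul_rpow_add_rpow ‖L s ⟨z, trivial⟩‖ₑ ‖L t ⟨z, trivial⟩‖ₑ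
        (p := 2) (by norm_num)
      norm_num at this
      exact this
    refine (lintegral_mono hle).trans_lt ?_
    have hm : Measurable fun z : OrthonormalFrame n M =>
        ‖L s ⟨z, trivial⟩‖ₑ ^ 2 + ‖L t ⟨z, trivial⟩‖ₑ ^ 2 :=
      (measurable_enorm_section (hL s hs.1)).add (measurable_enorm_section (hL t ht.1))
    rw [lintegral_const_mul _ hm, lintegral_add_left (measurable_enorm_section (hL s hs.1))]
    exact ENNReal.mul_lt_top (by simp) (ENNReal.add_lt_top.2 ⟨h1, h2⟩)
  | smul c s _ hs =>
    refine ⟨V.smul_mem c hs.1, ?_⟩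
    have h1 := hs.2
    rw [hN _ hs.1] at h1
    rw [hN _ (V.smul_mem c hs.1)]
    have h2 : ∀ z : OrthonormalFrame n M, ‖L (c • s) ⟨z, trivial⟩‖ₑ ^ 2 =
        ‖c‖ₑ ^ 2 * ‖L s ⟨z, trivial⟩‖ₑ ^ 2 := by
      intro z
      rw [map_smul, Pi.smul_apply, enorm_smul, mul_pow]
    simp only [h2]
    rw [lintegral_const_mul _ (measurable_enorm_section (hL s hs.1))]
    exact ENNReal.mul_lt_top (by simp) h1

theorem integrable_inner_section {S T : TotalSection E} {μ : Measure (OrthonormalFrame n M)}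
    (hS : S ∈ smoothSections F E Set.univ) (hT : T ∈ smoothSections F E Set.univ)
    (hS' : ∫⁻ z, ‖S ⟨z, trivial⟩‖ₑ ^ 2 ∂μ < ⊤) (hT' : ∫⁻ z, ‖T ⟨z, trivial⟩‖ₑ ^ 2 ∂μ < ⊤) :
    Integrable (fun z => inner ℂ (S ⟨z, trivial⟩) (T ⟨z, trivial⟩)) μ := by
  refine ⟨(continuous_inner_section hS hT).aestronglyMeasurable, ?_⟩
  have hle : ∀ z : OrthonormalFrame n M, ‖inner ℂ (S ⟨z, trivial⟩) (T ⟨z, trivial⟩)‖ₑ ≤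
      ‖S ⟨z, trivial⟩‖ₑ ^ 2 + ‖T ⟨z, trivial⟩‖ₑ ^ 2 := by
    intro z
    have h1 : ‖inner ℂ (S ⟨z, trivial⟩) (T ⟨z, trivial⟩)‖ₑ ≤
        ‖S ⟨z, trivial⟩‖ₑ * ‖T ⟨z, trivial⟩‖ₑ := by
      simp only [← ofReal_norm, ← ENNReal.ofReal_mul (norm_nonneg _)]
      exact ENNReal.ofReal_le_ofReal (norm_inner_le_norm _ _)
    refine h1.trans ?_
    rcases le_total ‖S ⟨z, trivial⟩‖ₑ ‖T ⟨z, trivial⟩‖ₑ with h | h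
    · refine le_add_of_nonneg_of_le zero_le ?_
      rw [sq]
      exact mul_le_mul_left h _
    · refine le_add_of_le_of_nonneg ?_ zero_le
      rw [sq]
      exact mul_le_mul_right h _
  refine (lintegral_mono hle).trans_lt ?_
  rw [lintegral_add_left (measurable_enorm_section hS)]
  exact ENNReal.add_lt_top.2 ⟨hS', hT'⟩

/-- The inner product is the integral over the frame bundle of the pointwise inner product of the
total sections, which converges for sections of finite norm. -/
theorem exists_l2Completion {X : Type uM} [AddCommGroup X] [Module ℂ X] {V : Submodule ℂ X}
    {N : X → ℝ≥0∞} {L : X →ₗ[ℂ] TotalSection E} {μ : Measure (OrthonormalFrame n M)}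
    (hL : ∀ s ∈ V, L s ∈ smoothSections F E Set.univ)
    (hN : ∀ s ∈ V, N s = ∫⁻ z, ‖L s ⟨z, trivial⟩‖ₑ ^ 2 ∂μ) :
    ∃ (H : Type uM) (_ : NormedAddCommGroup H) (_ : InnerProductSpace ℂ H)
      (ι : squareIntegrable V N →ₗ[ℂ] H), IsL2Completion V N ι := by
  have hV : ∀ s : squareIntegrable V N, L s.1 ∈ smoothSections F E Set.univ := fun s =>
    hL _ ((mem_squareIntegrable_iff hL hN _).1 s.2).1
  have hN' : ∀ s : squareIntegrable V N, N s.1 = ∫⁻ z, ‖L s.1 ⟨z, trivial⟩‖ₑ ^ 2 ∂μ := fun s =>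
    hN _ ((mem_squareIntegrable_iff hL hN _).1 s.2).1
  have hfin : ∀ s : squareIntegrable V N, ∫⁻ z, ‖L s.1 ⟨z, trivial⟩‖ₑ ^ 2 ∂μ < ⊤ := fun s =>
    (hN' s).symm.trans_lt ((mem_squareIntegrable_iff hL hN _).1 s.2).2
  have hint : ∀ s t : squareIntegrable V N, Integrable
      (fun z => inner ℂ (L s.1 ⟨z, trivial⟩) (L t.1 ⟨z, trivial⟩)) μ := fun s t =>
    integrable_inner_section (hV s) (hV t) (hfin s) (hfin t)
  have hre : ∀ s : squareIntegrable V N,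
      RCLike.re (∫ z, inner ℂ (L s.1 ⟨z, trivial⟩) (L s.1 ⟨z, trivial⟩) ∂μ) =
        ∫ z, ‖L s.1 ⟨z, trivial⟩‖ ^ 2 ∂μ := by
    intro s
    rw [← integral_re (hint s s)]
    refine integral_congr_ae (.of_forall fun z => ?_)
    exact inner_self_eq_norm_sq _
  let c : PreInnerProductSpace.Core ℂ (squareIntegrable V N) :=
    { inner := fun s t => ∫ z, inner ℂ (L s.1 ⟨z, trivial⟩) (L t.1 ⟨z, trivial⟩) ∂μ
      conj_inner_symm := fun s t => by
        rw [← integral_conj]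
        simp only [inner_conj_symm]
      re_inner_nonneg := fun s => by
        rw [hre]
        exact integral_nonneg fun z => sq_nonneg _
      add_left := fun s t u => by
        rw [← integral_add (hint s u) (hint t u)]
        simp only [Submodule.coe_add, map_add, Pi.add_apply, inner_add_left]
      smul_left := fun s t r => by
        rw [← integral_const_mul]
        simp only [Submodule.coe_smul, map_smul, Pi.smul_apply, inner_smul_left] }
  obtain ⟨H, h1, h2, ι, hc, hd, hn⟩ := exists_hilbert_completion c
  refine ⟨H, h1, h2, ι, hc, hd, fun s => ?_⟩
  have hm : AEStronglyMeasurable (fun z => ‖L s.1 ⟨z, trivial⟩‖ ^ 2) μ := by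
    refine (hint s s).norm.aestronglyMeasurable.congr (.of_forall fun z => ?_)
    simp [inner_self_eq_norm_sq_to_K]
  have h3 : ‖ι s‖ ^ 2 = ∫ z, ‖L s.1 ⟨z, trivial⟩‖ ^ 2 ∂μ := (hn s).trans (hre s)
  rw [integral_eq_lintegral_of_nonneg_ae (.of_forall fun z => sq_nonneg _) hm] at h3
  have h4 : ∀ z : OrthonormalFrame n M, ENNReal.ofReal (‖L s.1 ⟨z, trivial⟩‖ ^ 2) =
      ‖L s.1 ⟨z, trivial⟩‖ₑ ^ 2 := fun z => by
    rw [ENNReal.ofReal_pow (norm_nonneg _), ofReal_norm]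
  simp only [h4] at h3
  rw [hN' s, ← ENNReal.ofReal_toReal (hfin s).ne, ← h3, ENNReal.ofReal_pow (norm_nonneg _),
    ofReal_norm]

end SquareIntegrable

end FrameBundleSections

end

set_option maxHeartbeats 1000000 in
theorem mainTheorem3
    {n d : ℕ}
    -- the Riemannian manifold
    {M : Type uM} [TopologicalSpace M] [T2Space M] [SecondCountableTopology M] [ConnectedSpace M]
    [ChartedSpace (Euc n) M] [IsManifold (𝓡 n) ∞ M] [MeasurableSpace M] [BorelSpace M]
    [RiemannianBundle (fun x : M => TangentSpace (𝓡 n) x)]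
    [IsContMDiffRiemannianBundle (𝓡 n) ∞ (Euc n) (fun x : M => TangentSpace (𝓡 n) x)]
    -- the compact Lie group and its isometric action
    {G : Type*} [TopologicalSpace G] [T2Space G] [CompactSpace G] [ChartedSpace (Euc d) G]
    [Group G] [LieGroup (𝓡 d) ∞ G] [MulAction G M] [ContMDiffSMul (𝓡 d) (𝓡 n) ∞ G M]
    [IsometricAction n M G]
    -- the equivariant Hermitian vector bundle over the frame bundle
    {F : Type*} [NormedAddCommGroup F] [NormedSpace ℂ F] [FiniteDimensional ℂ F]
    {E : OrthonormalFrame n M → Type uE} [∀ z, NormedAddCommGroup (E z)]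
    [∀ z, InnerProductSpace ℂ (E z)] [TopologicalSpace (TotalSpace F E)]
    [FiberBundle F E] [VectorBundle ℂ F E] [IsSmoothHermitianBundle F E]
    [MulAction G (TotalSpace F E)] [MulAction (OrthGroup n) (TotalSpace F E)]
    [SMulCommClass G (OrthGroup n) (TotalSpace F E)]
    [IsEquivariantBundle F E (fun a₀ a : G => extChartAt (𝓡 d) a₀ a)]
    [IsEquivariantBundle F E (fun _ k : OrthGroup n => (k : Euc n →L[ℝ] Euc n))]
    -- the irreducible unitary representations
    {V : Type*} [NormedAddCommGroup V] [InnerProductSpace ℂ V] [FiniteDimensional ℂ V]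
    [CompleteSpace V] (ρ : G →* UnitaryGroup V) (hρ : Continuous ρ) (hρ' : IsIrreducibleRep ρ)
    {W : Type*} [NormedAddCommGroup W] [InnerProductSpace ℂ W] [FiniteDimensional ℂ W]
    [CompleteSpace W] (σ : OrthGroup n →* UnitaryGroup W) (hσ : Continuous σ)
    (hσ' : IsIrreducibleRep σ) :
    ∃ Φ : sectionsETyped F E σ ρ ≃ₗ[ℂ] sectionsTTyped F E ρ σ,
      -- the isomorphism is the explicit one
      (∀ (s : sectionsETyped F E σ ρ) (z : OrthonormalFrame n M),
        ((Φ s).1 (proj n M G z)).1 ⟨z, rfl⟩ = (s.1 z.base).1 ⟨z, rfl⟩) ∧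
      -- it preserves the `L²`-norms
      (∀ s : sectionsETyped F E σ ρ, normSqT F E d ρ (Φ s).1 = normSqE F E σ s.1) ∧
      -- the Hilbert spaces of `L²`-sections exist
      (∃ (H : Type (max uM uE)) (_ : NormedAddCommGroup H) (_ : InnerProductSpace ℂ H)
        (ι : squareIntegrable (sectionsETyped F E σ ρ) (normSqE F E σ) →ₗ[ℂ] H),
        IsL2Completion (sectionsETyped F E σ ρ) (normSqE F E σ) ι) ∧
      (∃ (H : Type (max uM uE)) (_ : NormedAddCommGroup H) (_ : InnerProductSpace ℂ H)
        (ι : squareIntegrable (sectionsTTyped F E ρ σ) (normSqT F E d ρ) →ₗ[ℂ] H),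
        IsL2Completion (sectionsTTyped F E ρ σ) (normSqT F E d ρ) ι) ∧
      -- it extends uniquely to a surjective isometry between them
      (∀ (H₁ : Type*) [NormedAddCommGroup H₁] [InnerProductSpace ℂ H₁]
        (ι₁ : squareIntegrable (sectionsETyped F E σ ρ) (normSqE F E σ) →ₗ[ℂ] H₁)
        (_ : IsL2Completion (sectionsETyped F E σ ρ) (normSqE F E σ) ι₁)
        (H₂ : Type*) [NormedAddCommGroup H₂] [InnerProductSpace ℂ H₂]
        (ι₂ : squareIntegrable (sectionsTTyped F E ρ σ) (normSqT F E d ρ) →ₗ[ℂ] H₂)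
        (_ : IsL2Completion (sectionsTTyped F E ρ σ) (normSqT F E d ρ) ι₂),
        ∃! Ψ : H₁ ≃ₗᵢ[ℂ] H₂, ∀ (s : sectionsETyped F E σ ρ)
          (hs : s.1 ∈ squareIntegrable (sectionsETyped F E σ ρ) (normSqE F E σ))
          (ht : (Φ s).1 ∈ squareIntegrable (sectionsTTyped F E ρ σ) (normSqT F E d ρ)),
          Ψ (ι₁ ⟨s.1, hs⟩) = ι₂ ⟨(Φ s).1, ht⟩) := by
  have hE : ∀ s ∈ sectionsETyped F E σ ρ, s ∈ sectionsE F E σ := fun s hs => typePart_le ρ _ _ hs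
  have hT : ∀ t ∈ sectionsTTyped F E ρ σ, t ∈ sectionsT F E ρ := fun t ht => typePart_le σ _ _ ht
  have hNE : ∀ s ∈ sectionsETyped F E σ ρ, normSqE F E σ s =
      ∫⁻ z, ‖totalE F E σ s ⟨z, trivial⟩‖ₑ ^ 2 ∂(frameVolume n M) := fun s hs =>
    normSqE_eq σ (hE s hs)
  have hNT : ∀ t ∈ sectionsTTyped F E ρ σ, normSqT F E d ρ t =
      ∫⁻ z, ‖totalT F E ρ t ⟨z, trivial⟩‖ₑ ^ 2 ∂(frameVolume n M) := fun t ht =>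
    normSqT_eq ρ (hT t ht)
  have hΦ := totalT_sectionsEquiv (d := d) (F := F) (E := E) ρ σ hρ' hσ'
  -- Both norms are the same integral, because `s` and its image have the same total section.
  have hN : ∀ s : sectionsETyped F E σ ρ,
      normSqT F E d ρ (sectionsEquiv d F E ρ σ hρ' hσ' s).1 = normSqE F E σ s.1 := fun s => by
    rw [hNE _ s.2, hNT _ (sectionsEquiv d F E ρ σ hρ' hσ' s).2, hΦ]
  refine ⟨sectionsEquiv d F E ρ σ hρ' hσ', fun s z => congrFun (hΦ s) ⟨z, trivial⟩, hN,
    exists_l2Completion (F := F) (E := E) hE hNE,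
    exists_l2Completion (F := F) (E := E) hT hNT, ?_⟩
  intro H₁ _ _ ι₁ hι₁ H₂ _ _ ι₂ hι₂
  exact existsUnique_extension (mem_squareIntegrable_iff (F := F) (E := E) hE hNE)
    (mem_squareIntegrable_iff (F := F) (E := E) hT hNT)
    (sectionsEquiv d F E ρ σ hρ' hσ') hN hι₁ hι₂
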